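/- An instance of Min-TCO is a triple $(U,T,\mathrm{INT})$ of a finite set $U$ of users, a finite set $T$ of topics and a function $\mathrm{INT}:U\to 2^T$; put $U_t=\{u\in U: t\in \mathrm{INT}(u)\}$. A feasible solution is a set $E\subseteq\{\{u,v\}: u,v\in U,\ u\ne v\}$ such that for every $t\in T$ the subgraph of $(U,E)$ induced by $U_t$ is connected (the empty graph counting as connected). For $d\ge 1$, Min-$d$-TCO($k$) is the problem: given an instance with $|U_t|\le d$ for all $t\in T$ and a number $k\in\mathbb{N}$, output a feasible solution with at most $k$ edges, or report that none exists. The input is given as the list of the numbers $|U|$, $|T|$, $k$ followed by the sets $U_t$ ($t\in T$), each listed as its size and its elements. Time is measured on a unit-cost random access machine with addition and subtraction. Theorem. There are real numbers $c_d$ $(d\ge1)$ with $$c_d=\lfloor d/2\rfloor\cdot\lceil d/2\rceil-1+O(d^{-2})$$ such that, for every fixed $d\ge 1$, Min-$d$-TCO($k$) on instances with $n=|U|$ users can be solved in time $O(c_d^{\,k}+n^2+r)$, where $r=|T|-|\{U_t: t\in T\}|$ is the number of repeated topics and the constant in this last bound depends only on $d$. In particular, the time is $O(c_d^{\,k}+n^2)$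 if different topics have different sets of interested users. -/

import Mathlib

/-! ## Topic-connected overlays -/

/-- An instance `(U, T, INT)` with `n` users, `m` topics and interest function `INT : U → 2^T`. -/
structure TCOInstance where
  n : ℕ
  m : ℕ
  interest : Fin n → Finset (Fin m)

namespace TCOInstance

variable (I : TCOInstance)

/-- The set `U_t` of the users interested in topic `t`. -/
def users (t : Fin I.m) : Finset (Fin I.n) :=
  Finset.univ.filter fun u => t ∈ I.interest u

/-- The graph `(U, E)` is `t`-topic-connected: any two users in `U_t` are joined by a path in the
subgraph induced by `U_t` (no condition if `U_t` is empty). -/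
def TopicConnected (E : Finset (Sym2 (Fin I.n))) (t : Fin I.m) : Prop :=
  ((SimpleGraph.fromEdgeSet (E : Set (Sym2 (Fin I.n)))).induce
    (I.users t : Set (Fin I.n))).Preconnected

/-- `E` is a set of edges `{u, v}` with `u ≠ v` such that `(U, E)` is topic-connected. -/
def Feasible (E : Finset (Sym2 (Fin I.n))) : Prop :=
  (∀ e ∈ E, ¬ e.IsDiag) ∧ ∀ t, I.TopicConnected E t

/-- The number of repeated topics, `|T| - |{U_t : t ∈ T}|`. It is `0` if and only if different
topics have different sets of interested users. -/
def repeatedTopics : ℕ :=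
  I.m - (Finset.univ.image I.users).card

/-- The input `(I, k)` as a list of numbers: `n`, `m`, `k`, and then, for each topic `t`,
the number `|U_t|` followed by the elements of `U_t` in increasing order. -/
def encode (k : ℕ) : List ℕ :=
  I.n :: I.m :: k :: (List.finRange I.m).flatMap fun t =>
    (I.users t).card :: ((I.users t).sort (· ≤ ·)).map Fin.val

/-- The word `out` is a correct answer for the input `(I, k)`: either it is `1` followed by the
endpoints of the edges, each edge listed once, of a feasible solution with at most `k` edges, or
it is `0` and no feasible solution has at most `k` edges. -/
def CorrectAnswer (k : ℕ) (out : List ℕ) : Prop :=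
  (∃ L : List (Fin I.n × Fin I.n),
      out = 1 :: L.flatMap (fun e => [e.1.val, e.2.val]) ∧
      (L.map fun e => s(e.1, e.2)).Nodup ∧
      I.Feasible (L.map fun e => s(e.1, e.2)).toFinset ∧
      (L.map fun e => s(e.1, e.2)).toFinset.card ≤ k) ∨
  (out = [0] ∧ ¬ ∃ E : Finset (Sym2 (Fin I.n)), I.Feasible E ∧ E.card ≤ k)

end TCOInstance

/-! ## Random access machine with unit costs

Structured programs over registers holding natural numbers and an indirectly addressed memory,
with addition and truncated subtraction, a one-way input tape and a one-way output tape. -/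

/-- A configuration: registers, memory, the unread part of the input, the output so far. -/
structure RAMState where
  reg : ℕ → ℕ
  mem : ℕ → ℕ
  inp : List ℕ
  out : List ℕ

/-- Programs. -/
inductive RAMProg where
  /-- `r_i := c` -/
  | const (i c : ℕ)
  /-- `r_i := r_j + r_l` -/
  | add (i j l : ℕ)
  /-- `r_i := max (r_j - r_l) 0` -/
  | sub (i j l : ℕ)
  /-- `r_i := M[r_j]` -/
  | load (i j : ℕ)
  /-- `M[r_i] := r_j` -/
  | store (i j : ℕ)
  /-- Read the next input number into `r_i` (`0` when the input is exhausted). -/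
  | read (i : ℕ)
  /-- Append `r_i` to the output. -/
  | print (i : ℕ)
  | seq (p q : RAMProg)
  /-- `if r_i ≠ 0 then p else q` -/
  | ite (i : ℕ) (p q : RAMProg)
  /-- `while r_i ≠ 0 do p` -/
  | loop (i : ℕ) (p : RAMProg)

/-- `RAMExec p s t s'`: started in `s`, the program `p` halts in `s'` after exactly `t` steps,
where each basic instruction and each evaluation of a test is one step. -/
inductive RAMExec : RAMProg → RAMState → ℕ → RAMState → Prop
  | const (i c : ℕ) (s : RAMState) :
      RAMExec (.const i c) s 1 { s with reg := Function.update s.reg i c }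
  | add (i j l : ℕ) (s : RAMState) :
      RAMExec (.add i j l) s 1 { s with reg := Function.update s.reg i (s.reg j + s.reg l) }
  | sub (i j l : ℕ) (s : RAMState) :
      RAMExec (.sub i j l) s 1 { s with reg := Function.update s.reg i (s.reg j - s.reg l) }
  | load (i j : ℕ) (s : RAMState) :
      RAMExec (.load i j) s 1 { s with reg := Function.update s.reg i (s.mem (s.reg j)) }
  | store (i j : ℕ) (s : RAMState) :
      RAMExec (.store i j) s 1 { s with mem := Function.update s.mem (s.reg i) (s.reg j) }
  | read (i : ℕ) (s : RAMState) :
      RAMExec (.read i) s 1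
        { s with reg := Function.update s.reg i (s.inp.headD 0), inp := s.inp.tail }
  | print (i : ℕ) (s : RAMState) :
      RAMExec (.print i) s 1 { s with out := s.out ++ [s.reg i] }
  | seq {p q : RAMProg} {s s' s'' : RAMState} {t t' : ℕ} :
      RAMExec p s t s' → RAMExec q s' t' s'' → RAMExec (.seq p q) s (t + t') s''
  | ite_true {i : ℕ} {p : RAMProg} (q : RAMProg) {s s' : RAMState} {t : ℕ} :
      s.reg i ≠ 0 → RAMExec p s t s' → RAMExec (.ite i p q) s (t + 1) s'
  | ite_false {i : ℕ} (p : RAMProg) {q : RAMProg} {s s' : RAMState} {t : ℕ} :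
      s.reg i = 0 → RAMExec q s t s' → RAMExec (.ite i p q) s (t + 1) s'
  | loop_done {i : ℕ} (p : RAMProg) {s : RAMState} :
      s.reg i = 0 → RAMExec (.loop i p) s 1 s
  | loop_step {i : ℕ} {p : RAMProg} {s s' s'' : RAMState} {t t' : ℕ} :
      s.reg i ≠ 0 → RAMExec p s t s' → RAMExec (.loop i p) s' t' s'' →
      RAMExec (.loop i p) s (t + t' + 1) s''

/-- The initial configuration on a given input: registers and memory are zero, no output. -/
def RAMState.init (input : List ℕ) : RAMState :=
  ⟨fun _ => 0, fun _ => 0, input, []⟩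

/-- On the given input, the program halts after exactly `t` steps with the given output. -/
def RAMProg.HaltsWith (p : RAMProg) (input : List ℕ) (t : ℕ) (output : List ℕ) : Prop :=
  ∃ s, RAMExec p (RAMState.init input) t s ∧ s.out = output

/-!
A set `E` of edges connects a set of users if and only if it meets every cut of it. So the
feasible solutions are the hitting sets of the family of all edge sets that cross a cut of some
`U_t`. A cut of at most `d` users is crossed by at most `⌊d/2⌋ * ⌈d/2⌉` edges, so hitting sets of
size `k` have to be found in a family of sets with bounded size.

*Input.* The edge `{u, v}` is represented by the number `2 ^ u + 2 ^ v`, which determines it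
(`edgeId_inj`) and which is found with additions only, from a table of powers. A cut becomes a
block of `w` slots that hold the elements of the edges crossing it, padded with `0` (`Family`).
The marks for topics already seen are indexed by sums of powers as well. A solution with `k` edges
touches at most `2 * k` users, so if there is one, there are at most `(2 * k + 1) ^ d` different
sets `U_t` with at least two elements (`card_distinctSet_le`), and reading stops when this bound
is exceeded. Since only `n + 1` sets have fewer elements, at most `r + (2 * k + 1) ^ d + n + 2`
topics are read (`topics_read_le`). This gives the terms `n` and `r` of the running time.

*Search.* A node of the search tree is a list of pairs `(y, x)`: the element `y` is chosen, and
`x` is excluded (`x = 0` if nothing is). Take a block that is not hit, with as few live slots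
(those with elements not excluded) as possible, and a live element `x` of it. If another live
element `y` of it dominates `x`, in the sense that every unhit block containing `x` contains `y`,
then one of the live elements other than `x` may be chosen, as `y` can replace `x` in a solution.
Otherwise, either `x` is chosen, or another live element `y` is chosen and `x` is excluded; in the
latter case, some unhit block contains `x` but not `y`, and it loses a slot without being hit. If
the blocks have `W + 1` slots, a node has thus at most one child without a reduced block and `W`
children with one, and at most `W - 1` of these if it has a reduced block itself; the case of a
dominated `x` is not worse (`sum_weight_children`). The recursion `nodeBound` for the number of
nodes has growth rate at most `W + 2 / W` (`nodeBound_le_pow`), where `W = ⌊d/2⌋ * ⌈d/2⌉ - 1` for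
`d ≥ 4`. The base `c_d = W + 3 / W` absorbs the polynomial factor in `k` that processing a node
takes (`pow_mul_pow_le`), and `3 / W = O(d ^ (-2))`.

*Machine.* The programs are written in a small language with scalars, arrays and compound
expressions, whose states carry a bound for the number of machine steps. The rules `Tr_seq`,
`Tr_ite`, `Tr_while`, `Tr_for` prove termination, correctness and running time together, and
`Cmd.compile_correct` transfers the result to the random access machine.
-/

/-! ### A small imperative language and its translation to the random access machine -/

namespace TCO

/-- Expressions over scalar variables `V` and arrays `A`. -/
inductive Expr (V A : Type) where
  | lit (c : ℕ)
  | var (x : V)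
  | add (e f : Expr V A)
  | sub (e f : Expr V A)
  /-- The entry of the array `a` at the index `e`. -/
  | get (a : A) (e : Expr V A)
  /-- `f` if `c ≠ 0`, and `g` otherwise. -/
  | cond (c f g : Expr V A)

/-- Commands over scalar variables `V` and arrays `A`. `rd` reads a number from the input, and `pr`
writes one to the output; a condition holds if its value is not `0`. -/
inductive Cmd (V A : Type) where
  | skip
  | set (x : V) (e : Expr V A)
  /-- `a[e] := f` -/
  | put (a : A) (e f : Expr V A)
  | rd (x : V)
  | pr (e : Expr V A)
  | seq (p q : Cmd V A)
  | ite (e : Expr V A) (p q : Cmd V A)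
  | while (e : Expr V A) (p : Cmd V A)

/-- States: scalars, arrays, unread input, output, and an upper bound `tm` for the number of
machine steps made so far. -/
structure St (V A : Type) where
  v : V → ℕ
  a : A → ℕ → ℕ
  inp : List ℕ
  out : List ℕ
  tm : ℕ

variable {V A : Type}

namespace St

/-- Let `c` steps pass. -/
def tick (s : St V A) (c : ℕ) : St V A := { s with tm := s.tm + c }

/-- Assign `n` to the scalar `x`. -/
def setv [DecidableEq V] (s : St V A) (x : V) (n : ℕ) : St V A :=
  { s with v := Function.update s.v x n }

/-- Assign `n` to the entry `i` of the array `a`. -/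
def seta [DecidableEq A] (s : St V A) (a : A) (i n : ℕ) : St V A :=
  { s with a := Function.update s.a a (Function.update (s.a a) i n) }

/-- Replace the unread input. -/
def setinp (s : St V A) (l : List ℕ) : St V A := { s with inp := l }

/-- Append `n` to the output. -/
def print (s : St V A) (n : ℕ) : St V A := { s with out := s.out ++ [n] }

section
variable (s : St V A) (x y : V) (a b : A) (i n c : ℕ) (l : List ℕ)
@[simp] theorem tick_v : (s.tick c).v = s.v := rfl
@[simp] theorem tick_a : (s.tick c).a = s.a := rfl
@[simp] theorem tick_inp : (s.tick c).inp = s.inp := rfl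
@[simp] theorem tick_out : (s.tick c).out = s.out := rfl
@[simp] theorem tick_tm : (s.tick c).tm = s.tm + c := rfl
@[simp] theorem setv_v [DecidableEq V] : (s.setv x n).v y = if y = x then n else s.v y := by
  simp [setv, Function.update_apply]
@[simp] theorem setv_a [DecidableEq V] : (s.setv x n).a = s.a := rfl
@[simp] theorem setv_inp [DecidableEq V] : (s.setv x n).inp = s.inp := rfl
@[simp] theorem setv_out [DecidableEq V] : (s.setv x n).out = s.out := rfl
@[simp] theorem setv_tm [DecidableEq V] : (s.setv x n).tm = s.tm := rfl
@[simp] theorem seta_v [DecidableEq A] : (s.seta a i n).v = s.v := rfl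
@[simp] theorem seta_a [DecidableEq A] :
    (s.seta a i n).a b = if b = a then Function.update (s.a a) i n else s.a b := by
  simp only [seta, Function.update_apply]
@[simp] theorem seta_inp [DecidableEq A] : (s.seta a i n).inp = s.inp := rfl
@[simp] theorem seta_out [DecidableEq A] : (s.seta a i n).out = s.out := rfl
@[simp] theorem seta_tm [DecidableEq A] : (s.seta a i n).tm = s.tm := rfl
@[simp] theorem setinp_v : (s.setinp l).v = s.v := rfl
@[simp] theorem setinp_a : (s.setinp l).a = s.a := rfl
@[simp] theorem setinp_inp : (s.setinp l).inp = l := rfl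
@[simp] theorem setinp_out : (s.setinp l).out = s.out := rfl
@[simp] theorem setinp_tm : (s.setinp l).tm = s.tm := rfl
@[simp] theorem print_v : (s.print n).v = s.v := rfl
@[simp] theorem print_a : (s.print n).a = s.a := rfl
@[simp] theorem print_tm : (s.print n).tm = s.tm := rfl
@[simp] theorem print_out : (s.print n).out = s.out ++ [n] := rfl
end
end St

namespace Expr

/-- The value of an expression. -/
def eval (s : St V A) : Expr V A → ℕ
  | lit c => c
  | var x => s.v x
  | add e f => e.eval s + f.eval s
  | sub e f => e.eval s - f.eval s
  | get a e => s.a a (e.eval s)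
  | cond c f g => if c.eval s = 0 then g.eval s else f.eval s

/-- A bound for the number of machine steps in the evaluation of an expression. -/
def cost : Expr V A → ℕ
  | lit _ => 1
  | var _ => 2
  | add e f => e.cost + f.cost + 1
  | sub e f => e.cost + f.cost + 1
  | get _ e => e.cost + 7
  | cond c f g => c.cost + f.cost + g.cost + 1

/-- An expression that is nonzero exactly when `e` and `f` differ. -/
def ne (e f : Expr V A) : Expr V A := add (sub e f) (sub f e)

theorem eval_ne_eq_zero (s : St V A) (e f : Expr V A) :
    (ne e f).eval s = 0 ↔ e.eval s = f.eval s := by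
  simp only [ne, eval]; omega

end Expr

section Semantics

variable [DecidableEq V] [DecidableEq A]

/-- Execution of commands, with the time bound `tm` carried along. -/
inductive Exec : Cmd V A → St V A → St V A → Prop
  | skip (s) : Exec .skip s (s.tick 1)
  | set (x e s) : Exec (.set x e) s ((s.setv x (e.eval s)).tick (e.cost + 2))
  | put (a e f s) :
      Exec (.put a e f) s ((s.seta a (e.eval s) (f.eval s)).tick (e.cost + f.cost + 7))
  | rd (x s) : Exec (.rd x) s (((s.setv x (s.inp.headD 0)).setinp s.inp.tail).tick 1)
  | pr (e s) : Exec (.pr e) s ((s.print (e.eval s)).tick (e.cost + 1))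
  | seq {p q s s' s''} : Exec p s s' → Exec q s' s'' → Exec (.seq p q) s s''
  | ite_true {e p q s s'} : e.eval s ≠ 0 → Exec p (s.tick (e.cost + 1)) s' →
      Exec (.ite e p q) s s'
  | ite_false {e p q s s'} : e.eval s = 0 → Exec q (s.tick (e.cost + 1)) s' →
      Exec (.ite e p q) s s'
  | while_done {e p s} : e.eval s = 0 → Exec (.while e p) s (s.tick (e.cost + 1))
  | while_step {e p s s' s''} : e.eval s ≠ 0 → Exec p (s.tick (e.cost + 1)) s' →
      Exec (.while e p) s' s'' → Exec (.while e p) s s''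

end Semantics

/-! #### Translation -/

section Compile

variable (iv : V → ℕ) (ia : A → ℕ)

/-- Evaluate an expression into the register `2 * δ`, using only even registers from there on;
the scalar `x` is kept in the register `2 * iv x + 1`, and the entry `i` of the array `a` in the
memory cell `16 * i + ia a`. -/
def Expr.compile : Expr V A → ℕ → RAMProg
  | .lit c, δ => .const (2 * δ) c
  | .var x, δ => .seq (.const (2 * δ) 0) (.add (2 * δ) (2 * δ) (2 * iv x + 1))
  | .add e f, δ =>
      .seq (e.compile δ) (.seq (f.compile (δ + 1)) (.add (2 * δ) (2 * δ) (2 * (δ + 1))))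
  | .sub e f, δ =>
      .seq (e.compile δ) (.seq (f.compile (δ + 1)) (.sub (2 * δ) (2 * δ) (2 * (δ + 1))))
  | .get a e, δ =>
      .seq (e.compile δ) (.seq (.add (2 * δ) (2 * δ) (2 * δ)) (.seq (.add (2 * δ) (2 * δ) (2 * δ))
        (.seq (.add (2 * δ) (2 * δ) (2 * δ)) (.seq (.add (2 * δ) (2 * δ) (2 * δ))
        (.seq (.const (2 * (δ + 1)) (ia a)) (.seq (.add (2 * δ) (2 * δ) (2 * (δ + 1)))
        (.load (2 * δ) (2 * δ))))))))
  | .cond c f g, δ =>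
      .seq (c.compile δ) (.ite (2 * δ) (f.compile δ) (g.compile δ))

/-- Translation of commands. -/
def Cmd.compile : Cmd V A → RAMProg
  | .skip => .const 0 0
  | .set x e => .seq (e.compile iv ia 0) (.seq (.const 2 0) (.add (2 * iv x + 1) 0 2))
  | .put a e f =>
      .seq (e.compile iv ia 0) (.seq (.add 0 0 0) (.seq (.add 0 0 0) (.seq (.add 0 0 0)
        (.seq (.add 0 0 0) (.seq (.const 2 (ia a)) (.seq (.add 0 0 2)
        (.seq (f.compile iv ia 1) (.store 0 2))))))))
  | .rd x => .read (2 * iv x + 1)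
  | .pr e => .seq (e.compile iv ia 0) (.print 0)
  | .seq p q => .seq p.compile q.compile
  | .ite e p q => .seq (e.compile iv ia 0) (.ite 0 p.compile q.compile)
  | .while e p => .seq (e.compile iv ia 0) (.loop 0 (.seq p.compile (e.compile iv ia 0)))

/-- The machine configuration `r` represents the state `s`. -/
structure Rep (r : RAMState) (s : St V A) : Prop where
  v : ∀ x, r.reg (2 * iv x + 1) = s.v x
  a : ∀ a i, r.mem (16 * i + ia a) = s.a a i
  inp : r.inp = s.inp
  out : r.out = s.out

variable {iv ia}

theorem Rep.of_odd {r r' : RAMState} {s : St V A} (h : Rep iv ia r s)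
    (h1 : ∀ i, r'.reg (2 * i + 1) = r.reg (2 * i + 1)) (h2 : r'.mem = r.mem)
    (h3 : r'.inp = r.inp) (h4 : r'.out = r.out) : Rep iv ia r' s :=
  ⟨fun x => by rw [h1, h.v], fun a i => by rw [h2, h.a], by rw [h3, h.inp], by rw [h4, h.out]⟩

/-- The configuration `r'` arises from `r` by changing even registers from `2 * δ` on. -/
structure Scratch (δ : ℕ) (r r' : RAMState) : Prop where
  odd : ∀ i, r'.reg (2 * i + 1) = r.reg (2 * i + 1)
  low : ∀ i < δ, r'.reg (2 * i) = r.reg (2 * i)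
  mem : r'.mem = r.mem
  inp : r'.inp = r.inp
  out : r'.out = r.out

theorem Scratch.trans {δ δ' : ℕ} {r r' r'' : RAMState} (h : Scratch δ r r')
    (h' : Scratch δ' r' r'') (hd : δ ≤ δ') : Scratch δ r r'' :=
  ⟨fun i => (h'.odd i).trans (h.odd i), fun i hi => (h'.low i (by omega)).trans (h.low i hi),
    h'.mem.trans h.mem, h'.inp.trans h.inp, h'.out.trans h.out⟩

theorem Scratch.update (δ : ℕ) (r : RAMState) (δ' n : ℕ) (h : δ ≤ δ') :
    Scratch δ r { r with reg := Function.update r.reg (2 * δ') n } := by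
  refine ⟨fun i => ?_, fun i hi => ?_, rfl, rfl, rfl⟩
  · exact Function.update_of_ne (by omega) _ _
  · exact Function.update_of_ne (by omega) _ _

theorem Rep.scratch {δ : ℕ} {r r' : RAMState} {s : St V A} (h : Rep iv ia r s)
    (h' : Scratch δ r r') : Rep iv ia r' s :=
  h.of_odd h'.odd h'.mem h'.inp h'.out

/-- The value of an expression is found in the target register, and the lower scratch registers keep
the values of the subexpressions already evaluated. -/
theorem Expr.compile_correct (s : St V A) (e : Expr V A) :
    ∀ (δ : ℕ) (r : RAMState), Rep iv ia r s →
      ∃ t r', RAMExec (e.compile iv ia δ) r t r' ∧ t ≤ e.cost ∧ Scratch δ r r' ∧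
        r'.reg (2 * δ) = e.eval s := by
  induction e with
  | lit c =>
    intro δ r _
    exact ⟨1, _, .const _ _ _, le_rfl, Scratch.update _ _ _ _ le_rfl, by simp [Expr.eval]⟩
  | var x =>
    intro δ r h
    refine ⟨_, _, .seq (.const _ _ _) (.add _ _ _ _), le_rfl,
      (Scratch.update _ _ _ _ le_rfl).trans (Scratch.update _ _ _ _ le_rfl) le_rfl, ?_⟩
    have : 2 * iv x + 1 ≠ 2 * δ := by omega
    simp [Expr.eval, h.v, this]
  | add e f he hf =>
    intro δ r h
    obtain ⟨t1, r1, e1, c1, s1, v1⟩ := he δ r h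
    obtain ⟨t2, r2, e2, c2, s2, v2⟩ := hf (δ + 1) r1 (h.scratch s1)
    refine ⟨_, _, .seq e1 (.seq e2 (.add _ _ _ _)), ?_,
      (s1.trans s2 (by omega)).trans (Scratch.update _ _ _ _ le_rfl) le_rfl, ?_⟩
    · simp only [Expr.cost]; omega
    · simp [Expr.eval, v2, s2.low δ (by omega), v1]
  | sub e f he hf =>
    intro δ r h
    obtain ⟨t1, r1, e1, c1, s1, v1⟩ := he δ r h
    obtain ⟨t2, r2, e2, c2, s2, v2⟩ := hf (δ + 1) r1 (h.scratch s1)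
    refine ⟨_, _, .seq e1 (.seq e2 (.sub _ _ _ _)), ?_,
      (s1.trans s2 (by omega)).trans (Scratch.update _ _ _ _ le_rfl) le_rfl, ?_⟩
    · simp only [Expr.cost]; omega
    · simp [Expr.eval, v2, s2.low δ (by omega), v1]
  | get a e he =>
    intro δ r h
    obtain ⟨t1, r1, e1, c1, s1, v1⟩ := he δ r h
    refine ⟨_, _, .seq e1 (.seq (.add _ _ _ _) (.seq (.add _ _ _ _) (.seq (.add _ _ _ _)
      (.seq (.add _ _ _ _) (.seq (.const _ _ _) (.seq (.add _ _ _ _) (.load _ _ _))))))), ?_,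
      ?_, ?_⟩
    · simp only [Expr.cost]; omega
    · exact s1.trans ((Scratch.update _ _ _ _ le_rfl).trans ((Scratch.update _ _ _ _ le_rfl).trans
        ((Scratch.update _ _ _ _ le_rfl).trans ((Scratch.update _ _ _ _ le_rfl).trans
        ((Scratch.update _ _ _ _ (by omega)).trans ((Scratch.update _ _ _ _ le_rfl).trans
        (Scratch.update _ _ _ _ le_rfl) le_rfl) le_rfl) le_rfl) le_rfl) le_rfl) le_rfl) le_rfl
    · have h1 : 2 * δ ≠ 2 * (δ + 1) := by omega
      simp only [Function.update_self, Function.update_of_ne h1, v1, s1.mem, Expr.eval]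
      rw [← h.a]
      congr 1
      omega
  | cond c f g hc hf hg =>
    intro δ r h
    obtain ⟨t1, r1, e1, c1, s1, v1⟩ := hc δ r h
    by_cases h0 : c.eval s = 0
    · obtain ⟨t2, r2, e2, c2, s2, v2⟩ := hg δ r1 (h.scratch s1)
      refine ⟨_, _, .seq e1 (.ite_false _ (v1.trans h0) e2), ?_, s1.trans s2 le_rfl, ?_⟩
      · simp only [Expr.cost]; omega
      · simp [Expr.eval, h0, v2]
    · obtain ⟨t2, r2, e2, c2, s2, v2⟩ := hf δ r1 (h.scratch s1)
      refine ⟨_, _, .seq e1 (.ite_true _ (v1.trans_ne h0) e2), ?_, s1.trans s2 le_rfl, ?_⟩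
      · simp only [Expr.cost]; omega
      · simp [Expr.eval, h0, v2]

/-- The translated command simulates the command, in no more steps than the time bound records. -/
theorem Cmd.compile_correct [DecidableEq V] [DecidableEq A] (hv : Function.Injective iv)
    (ha : Function.Injective ia) (ha16 : ∀ a, ia a < 16) {c : Cmd V A} {s s' : St V A}
    (hc : Exec c s s') : ∀ r, Rep iv ia r s →
      ∃ t r', RAMExec (c.compile iv ia) r t r' ∧ Rep iv ia r' s' ∧ s.tm + t ≤ s'.tm := by
  induction hc with
  | skip s =>
    intro r h
    have R := h.scratch (Scratch.update 0 r 0 0 le_rfl)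
    exact ⟨_, _, .const _ _ _, ⟨R.v, R.a, R.inp, R.out⟩, le_rfl⟩
  | set x e s =>
    intro r h
    obtain ⟨t1, r1, e1, c1, s1, v1⟩ := e.compile_correct s 0 r h
    refine ⟨_, _, .seq e1 (.seq (.const _ _ _) (.add _ _ _ _)), ⟨fun y => ?_, fun b i => ?_, ?_,
      ?_⟩, ?_⟩
    · have h1 := (h.scratch s1).v y
      by_cases hy : y = x
      · subst hy
        simpa using v1
      · have h2 : 2 * iv y + 1 ≠ 2 * iv x + 1 := fun h => hy (hv (by omega))
        have h3 : 2 * iv y + 1 ≠ 2 := by omega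
        simp only [St.tick_v, St.setv_v, hy, if_false]
        rw [Function.update_of_ne h2, Function.update_of_ne h3, h1]
    · simpa using (h.scratch s1).a b i
    · simpa using (h.scratch s1).inp
    · simpa using (h.scratch s1).out
    · simp; omega
  | put a e f s =>
    intro r h
    obtain ⟨t1, r1, e1, c1, s1, v1⟩ := e.compile_correct s 0 r h
    have S2 := (Scratch.update 0 r1 0 (r1.reg (2 * 0) + r1.reg (2 * 0)) le_rfl)
    set r2 : RAMState := { r1 with reg := Function.update r1.reg (2 * 0) _ }
    have S3 := (Scratch.update 0 r2 0 (r2.reg (2 * 0) + r2.reg (2 * 0)) le_rfl)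
    set r3 : RAMState := { r2 with reg := Function.update r2.reg (2 * 0) _ }
    have S4 := (Scratch.update 0 r3 0 (r3.reg (2 * 0) + r3.reg (2 * 0)) le_rfl)
    set r4 : RAMState := { r3 with reg := Function.update r3.reg (2 * 0) _ }
    have S5 := (Scratch.update 0 r4 0 (r4.reg (2 * 0) + r4.reg (2 * 0)) le_rfl)
    set r5 : RAMState := { r4 with reg := Function.update r4.reg (2 * 0) _ }
    have S6 := (Scratch.update 0 r5 1 (ia a) (by omega))
    set r6 : RAMState := { r5 with reg := Function.update r5.reg (2 * 1) _ }
    have S7 := (Scratch.update 0 r6 0 (r6.reg (2 * 0) + r6.reg (2 * 1)) le_rfl)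
    set r7 : RAMState := { r6 with reg := Function.update r6.reg (2 * 0) _ }
    have S : Scratch 0 r r7 := ((((((s1.trans S2 le_rfl).trans S3 le_rfl).trans S4 le_rfl).trans
      S5 le_rfl).trans S6 le_rfl).trans S7 le_rfl)
    have h7 : r7.reg 0 = 16 * e.eval s + ia a := by
      simp [r7, r6, r5, r4, r3, r2] at v1 ⊢
      omega
    obtain ⟨t8, r8, e8, c8, s8, v8⟩ := f.compile_correct s 1 r7 (h.scratch S)
    have h8 : r8.reg 0 = 16 * e.eval s + ia a := by
      rw [← h7]; exact s8.low 0 (by omega)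
    have R8 := (h.scratch S).scratch s8
    refine ⟨_, _, .seq e1 (.seq (.add _ _ _ _) (.seq (.add _ _ _ _) (.seq (.add _ _ _ _)
      (.seq (.add _ _ _ _) (.seq (.const _ _ _) (.seq (.add _ _ _ _) (.seq e8 (.store _ _ _)))))))),
      ⟨fun y => R8.v y, fun b i => ?_, R8.inp, R8.out⟩, ?_⟩
    · have hb := R8.a b i
      simp only [St.tick_a, St.seta_a, h8]
      have v8' : r8.reg 2 = f.eval s := v8
      by_cases hba : b = a
      · subst hba
        by_cases hi : i = e.eval s
        · subst hi; simp [v8']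
        · have : 16 * i + ia b ≠ 16 * e.eval s + ia b := by omega
          simp [hi, hb]
      · have h1 : ia b ≠ ia a := fun h => hba (ha h)
        have h2 := ha16 a
        have h3 := ha16 b
        have : 16 * i + ia b ≠ 16 * e.eval s + ia a := by omega
        simp [hba, hb, this]
    · simp; omega
  | rd x s =>
    intro r h
    refine ⟨_, _, .read _ _, ⟨fun y => ?_, h.a, ?_, h.out⟩, le_rfl⟩
    · by_cases hy : y = x
      · subst hy; simp [h.inp]
      · have h2 : iv y ≠ iv x := fun h => hy (hv h)
        simp [hy, h2, h.v]
    · simp [h.inp]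
  | pr e s =>
    intro r h
    obtain ⟨t1, r1, e1, c1, s1, v1⟩ := e.compile_correct s 0 r h
    have R := h.scratch s1
    refine ⟨_, _, .seq e1 (.print _ _), ⟨R.v, R.a, R.inp, ?_⟩, ?_⟩
    · have : r1.reg 0 = e.eval s := v1
      simp [R.out, this]
    · simp; omega
  | seq _ _ h1 h2 =>
    intro r h
    obtain ⟨t1, r1, e1, R1, c1⟩ := h1 r h
    obtain ⟨t2, r2, e2, R2, c2⟩ := h2 r1 R1
    exact ⟨_, _, .seq e1 e2, R2, by omega⟩
  | @ite_true e p q s s' h0 _ h1 =>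
    intro r h
    obtain ⟨t1, r1, e1, c1, s1, v1⟩ := e.compile_correct s 0 r h
    obtain ⟨t2, r2, e2, R2, c2⟩ := h1 r1 ⟨(h.scratch s1).v, (h.scratch s1).a, (h.scratch s1).inp,
      (h.scratch s1).out⟩
    refine ⟨_, _, .seq e1 (.ite_true _ (v1.trans_ne h0) e2), R2, ?_⟩
    simp at c2; omega
  | @ite_false e p q s s' h0 _ h1 =>
    intro r h
    obtain ⟨t1, r1, e1, c1, s1, v1⟩ := e.compile_correct s 0 r h
    obtain ⟨t2, r2, e2, R2, c2⟩ := h1 r1 ⟨(h.scratch s1).v, (h.scratch s1).a, (h.scratch s1).inp,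
      (h.scratch s1).out⟩
    refine ⟨_, _, .seq e1 (.ite_false _ (v1.trans h0) e2), R2, ?_⟩
    simp at c2; omega
  | @while_done e p s h0 =>
    intro r h
    obtain ⟨t1, r1, e1, c1, s1, v1⟩ := e.compile_correct s 0 r h
    refine ⟨_, _, .seq e1 (.loop_done _ (v1.trans h0)), ⟨(h.scratch s1).v, (h.scratch s1).a,
      (h.scratch s1).inp, (h.scratch s1).out⟩, ?_⟩
    simp; omega
  | @while_step e p s s' s'' h0 _ _ h1 h2 =>
    intro r h
    obtain ⟨t1, r1, e1, c1, s1, v1⟩ := e.compile_correct s 0 r h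
    obtain ⟨t2, r2, e2, R2, c2⟩ := h1 r1 ⟨(h.scratch s1).v, (h.scratch s1).a, (h.scratch s1).inp,
      (h.scratch s1).out⟩
    obtain ⟨t3, r3, e3, R3, c3⟩ := h2 r2 R2
    cases e3 with
    | seq f1 f2 =>
      refine ⟨_, _, .seq e1 (.loop_step (v1.trans_ne h0) (.seq e2 f1) f2), R3, ?_⟩
      simp at c2; omega

end Compile

/-! #### Program logic -/

variable [DecidableEq V] [DecidableEq A]

/-- The command `c`, started in `s`, terminates in a state that satisfies `Q`. -/
def Tr (c : Cmd V A) (s : St V A) (Q : St V A → Prop) : Prop := ∃ s', Exec c s s' ∧ Q s'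

theorem Tr.mono {c : Cmd V A} {s : St V A} {Q Q' : St V A → Prop} (h : Tr c s Q)
    (hQ : ∀ s', Q s' → Q' s') : Tr c s Q' :=
  let ⟨s', h1, h2⟩ := h; ⟨s', h1, hQ s' h2⟩

theorem Tr_skip {s : St V A} {Q : St V A → Prop} (h : Q (s.tick 1)) : Tr .skip s Q :=
  ⟨_, .skip s, h⟩

theorem Tr_set {x : V} {e : Expr V A} {s : St V A} {Q : St V A → Prop}
    (h : Q ((s.setv x (e.eval s)).tick (e.cost + 2))) : Tr (.set x e) s Q :=
  ⟨_, .set x e s, h⟩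

theorem Tr_put {a : A} {e f : Expr V A} {s : St V A} {Q : St V A → Prop}
    (h : Q ((s.seta a (e.eval s) (f.eval s)).tick (e.cost + f.cost + 7))) : Tr (.put a e f) s Q :=
  ⟨_, .put a e f s, h⟩

theorem Tr_rd {x : V} {s : St V A} {Q : St V A → Prop}
    (h : Q (((s.setv x (s.inp.headD 0)).setinp s.inp.tail).tick 1)) : Tr (.rd x) s Q :=
  ⟨_, .rd x s, h⟩

theorem Tr_pr {e : Expr V A} {s : St V A} {Q : St V A → Prop}
    (h : Q ((s.print (e.eval s)).tick (e.cost + 1))) : Tr (.pr e) s Q :=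
  ⟨_, .pr e s, h⟩

theorem Tr_seq {p q : Cmd V A} {s : St V A} {Q : St V A → Prop}
    (h : Tr p s fun s' => Tr q s' Q) : Tr (.seq p q) s Q :=
  let ⟨_, h1, s'', h2, h3⟩ := h; ⟨s'', .seq h1 h2, h3⟩

theorem Tr_ite {e : Expr V A} {p q : Cmd V A} {s : St V A} {Q : St V A → Prop}
    (h1 : e.eval s ≠ 0 → Tr p (s.tick (e.cost + 1)) Q)
    (h2 : e.eval s = 0 → Tr q (s.tick (e.cost + 1)) Q) : Tr (.ite e p q) s Q := by
  by_cases h : e.eval s = 0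
  · obtain ⟨s', e1, e2⟩ := h2 h
    exact ⟨s', .ite_false h e1, e2⟩
  · obtain ⟨s', e1, e2⟩ := h1 h
    exact ⟨s', .ite_true h e1, e2⟩

/-- Every execution takes time. -/
theorem Exec.tm_lt {c : Cmd V A} {s s' : St V A} (h : Exec c s s') : s.tm < s'.tm := by
  induction h with
  | seq => omega
  | ite_true _ _ h => simp at h; omega
  | ite_false _ _ h => simp at h; omega
  | while_step _ _ _ h => simp at h; omega
  | _ => simp

/-- Loops: an invariant that bounds the time elapsed ensures termination, since every pass takes
time (`Exec.tm_lt`). -/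
theorem Tr_while {e : Expr V A} {p : Cmd V A} {Q : St V A → Prop} (Inv : St V A → Prop) (B : ℕ)
    (hB : ∀ s, Inv s → s.tm ≤ B)
    (hstep : ∀ s, Inv s → e.eval s ≠ 0 → Tr p (s.tick (e.cost + 1)) Inv)
    (hdone : ∀ s, Inv s → e.eval s = 0 → Q (s.tick (e.cost + 1)))
    {s : St V A} (h : Inv s) : Tr (.while e p) s Q := by
  induction hn : B - s.tm using Nat.strong_induction_on generalizing s with
  | _ n ih =>
    by_cases h0 : e.eval s = 0
    · exact ⟨_, .while_done h0, hdone s h h0⟩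
    · obtain ⟨s', e1, i1⟩ := hstep s h h0
      have h1 := e1.tm_lt
      have h2 := hB s' i1
      simp at h1
      obtain ⟨s'', e2, q2⟩ := ih (B - s'.tm) (by omega) i1 rfl
      exact ⟨s'', .while_step h0 e1 e2, q2⟩

namespace Cmd

/-- The scalars that a command may change. -/
def wv : Cmd V A → V → Bool
  | set x _, y => decide (y = x)
  | rd x, y => decide (y = x)
  | seq p q, y => p.wv y || q.wv y
  | ite _ p q, y => p.wv y || q.wv y
  | .while _ p, y => p.wv y
  | _, _ => false

/-- The arrays that a command may change. -/
def wa : Cmd V A → A → Bool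
  | put a _ _, b => decide (b = a)
  | seq p q, y => p.wa y || q.wa y
  | ite _ p q, y => p.wa y || q.wa y
  | .while _ p, y => p.wa y
  | _, _ => false

/-- Whether a command may read input. -/
def ri : Cmd V A → Bool
  | rd _ => true
  | seq p q => p.ri || q.ri
  | ite _ p q => p.ri || q.ri
  | .while _ p => p.ri
  | _ => false

/-- Whether a command may write output. -/
def wo : Cmd V A → Bool
  | pr _ => true
  | seq p q => p.wo || q.wo
  | ite _ p q => p.wo || q.wo
  | .while _ p => p.wo
  | _ => false

end Cmd

/-- The parts of the state that `c` does not mention as a target agree in `s` and `s'`. -/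
structure Frame (c : Cmd V A) (s s' : St V A) : Prop where
  v : ∀ x, c.wv x = false → s'.v x = s.v x
  a : ∀ b, c.wa b = false → s'.a b = s.a b
  inp : c.ri = false → s'.inp = s.inp
  out : c.wo = false → s'.out = s.out

theorem Frame.trans {c : Cmd V A} {s s' s'' : St V A} (h : Frame c s s') (h' : Frame c s' s'') :
    Frame c s s'' :=
  ⟨fun x hx => (h'.v x hx).trans (h.v x hx), fun x hx => (h'.a x hx).trans (h.a x hx),
    fun hx => (h'.inp hx).trans (h.inp hx), fun hx => (h'.out hx).trans (h.out hx)⟩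

theorem Exec.frame {c : Cmd V A} {s s' : St V A} (h : Exec c s s') : Frame c s s' := by
  induction h with
  | skip => exact ⟨fun _ _ => rfl, fun _ _ => rfl, fun _ => rfl, fun _ => rfl⟩
  | set x e s =>
    refine ⟨fun y hy => ?_, fun _ _ => rfl, fun _ => rfl, fun _ => rfl⟩
    simp only [Cmd.wv, decide_eq_false_iff_not] at hy
    simp [hy]
  | put a e f s =>
    refine ⟨fun _ _ => rfl, fun b hb => ?_, fun _ => rfl, fun _ => rfl⟩
    simp only [Cmd.wa, decide_eq_false_iff_not] at hb
    simp [hb]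
  | rd x s =>
    refine ⟨fun y hy => ?_, fun _ _ => rfl, fun h => ?_, fun _ => rfl⟩
    · simp only [Cmd.wv, decide_eq_false_iff_not] at hy
      simp [hy]
    · simp [Cmd.ri] at h
  | pr e s =>
    refine ⟨fun _ _ => rfl, fun _ _ => rfl, fun _ => rfl, fun h => ?_⟩
    simp [Cmd.wo] at h
  | seq _ _ h1 h2 =>
    exact ⟨fun x hx => by
        simp only [Cmd.wv, Bool.or_eq_false_iff] at hx
        rw [h2.v x hx.2, h1.v x hx.1],
      fun x hx => by
        simp only [Cmd.wa, Bool.or_eq_false_iff] at hx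
        rw [h2.a x hx.2, h1.a x hx.1],
      fun hx => by
        simp only [Cmd.ri, Bool.or_eq_false_iff] at hx
        rw [h2.inp hx.2, h1.inp hx.1],
      fun hx => by
        simp only [Cmd.wo, Bool.or_eq_false_iff] at hx
        rw [h2.out hx.2, h1.out hx.1]⟩
  | ite_true _ _ h =>
    exact ⟨fun x hx => by
        simp only [Cmd.wv, Bool.or_eq_false_iff] at hx
        exact h.v x hx.1,
      fun x hx => by
        simp only [Cmd.wa, Bool.or_eq_false_iff] at hx
        exact h.a x hx.1,
      fun hx => by
        simp only [Cmd.ri, Bool.or_eq_false_iff] at hx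
        exact h.inp hx.1,
      fun hx => by
        simp only [Cmd.wo, Bool.or_eq_false_iff] at hx
        exact h.out hx.1⟩
  | ite_false _ _ h =>
    exact ⟨fun x hx => by
        simp only [Cmd.wv, Bool.or_eq_false_iff] at hx
        exact h.v x hx.2,
      fun x hx => by
        simp only [Cmd.wa, Bool.or_eq_false_iff] at hx
        exact h.a x hx.2,
      fun hx => by
        simp only [Cmd.ri, Bool.or_eq_false_iff] at hx
        exact h.inp hx.2,
      fun hx => by
        simp only [Cmd.wo, Bool.or_eq_false_iff] at hx
        exact h.out hx.2⟩
  | while_done => exact ⟨fun _ _ => rfl, fun _ _ => rfl, fun _ => rfl, fun _ => rfl⟩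
  | while_step _ _ _ h1 h2 =>
    exact ⟨fun x hx => (h2.v x hx).trans (h1.v x hx), fun x hx => (h2.a x hx).trans (h1.a x hx),
      fun hx => (h2.inp hx).trans (h1.inp hx), fun hx => (h2.out hx).trans (h1.out hx)⟩

theorem Tr.frame {c : Cmd V A} {s : St V A} {Q : St V A → Prop} (h : Tr c s Q) :
    Tr c s fun s' => Q s' ∧ Frame c s s' :=
  let ⟨s', h1, h2⟩ := h; ⟨s', h1, h2, h1.frame⟩

/-- `for i := 0, …, e - 1 do p`; neither `i` nor the value of `e` may be changed by `p`. -/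
def Cmd.for (i : V) (e : Expr V A) (p : Cmd V A) : Cmd V A :=
  .seq (.set i (.lit 0)) (.while (.sub e (.var i)) (.seq p (.set i (.add (.var i) (.lit 1)))))

/-- Counting loops. The invariant `Inv` must not depend on the time elapsed; a bound `T` for the
time of one pass gives one for the loop. -/
theorem Tr_for {i : V} {e : Expr V A} {p : Cmd V A} {s : St V A} {Q : St V A → Prop}
    (n T : ℕ) (Inv : ℕ → St V A → Prop)
    (hi : p.wv i = false) (he : ∀ s', Frame (Cmd.for i e p) s s' → e.eval s' = n)
    (htick : ∀ j s' c, Inv j s' → Inv j (s'.tick c))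
    (h0 : Inv 0 (s.setv i 0))
    (hstep : ∀ j s', j < n → s'.v i = j → Frame (Cmd.for i e p) s s' → Inv j s' →
      Tr p s' fun s'' => s''.tm ≤ s'.tm + T ∧ Inv (j + 1) (s''.setv i (j + 1)))
    (hdone : ∀ s', s'.v i = n → Frame (Cmd.for i e p) s s' → Inv n s' →
      s'.tm ≤ s.tm + (n * (T + e.cost + 10) + e.cost + 10) → Q s') :
    Tr (Cmd.for i e p) s Q := by
  have hset : Frame (Cmd.for i e p) s ((s.setv i 0).tick 3) :=
    ⟨fun x hx => by
      simp only [Cmd.for, Cmd.wv, Bool.or_eq_false_iff, decide_eq_false_iff_not] at hx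
      simp [hx.1], fun _ _ => rfl, fun _ => rfl, fun _ => rfl⟩
  refine Tr_seq (Tr_set ?_)
  refine Tr_while (fun s' => ∃ j ≤ n, s'.v i = j ∧ Frame (Cmd.for i e p) s s' ∧ Inv j s' ∧
    s'.tm ≤ s.tm + (j * (T + e.cost + 10) + 3)) (s.tm + (n * (T + e.cost + 10) + 3)) ?_ ?_ ?_ ?_
  · rintro s' ⟨j, hj, -, -, -, h⟩
    have := Nat.mul_le_mul_right (T + e.cost + 10) hj
    omega
  · rintro s' ⟨j, hj, hij, hF, hI, ht⟩ h0
    simp only [Expr.eval, hij, he s' hF] at h0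
    have hF' : Frame (Cmd.for i e p) s (s'.tick ((Expr.sub e (.var i)).cost + 1)) :=
      ⟨hF.v, hF.a, hF.inp, hF.out⟩
    refine Tr_seq ((hstep j _ (by omega) (by simpa using hij) hF' (htick _ _ _ hI)).frame.mono ?_)
    rintro s'' ⟨⟨ht', hI'⟩, hF2⟩
    refine Tr_set ?_
    have hi' : s''.v i = j := by rw [hF2.v i hi]; simpa using hij
    refine ⟨j + 1, by omega, ?_, ?_, ?_, ?_⟩
    · simp [Expr.eval, hi']
    · refine hF'.trans ⟨fun x hx => ?_, fun b hb => ?_, fun h => ?_, fun h => ?_⟩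
      · simp only [Cmd.for, Cmd.wv, Bool.or_eq_false_iff, decide_eq_false_iff_not] at hx
        simp only [St.tick_v, St.setv_v, hx.1, if_false]
        exact hF2.v x hx.2.1
      · simp only [Cmd.for, Cmd.wa, Bool.or_eq_false_iff] at hb
        exact hF2.a b hb.2.1
      · simp only [Cmd.for, Cmd.ri, Bool.or_eq_false_iff] at h
        exact hF2.inp h.2.1
      · simp only [Cmd.for, Cmd.wo, Bool.or_eq_false_iff] at h
        exact hF2.out h.2.1
    · simp only [Expr.eval, hi']
      exact htick _ _ _ hI'
    · simp [Expr.cost] at ht' ⊢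
      have : (j + 1) * (T + e.cost + 10) = j * (T + e.cost + 10) + (T + e.cost + 10) := by ring
      omega
  · rintro s' ⟨j, hj, hij, hF, hI, ht⟩ h0
    simp only [Expr.eval, hij, he s' hF] at h0
    obtain rfl : j = n := by omega
    refine hdone _ (by simpa using hij) ⟨hF.v, hF.a, hF.inp, hF.out⟩ (htick _ _ _ hI) ?_
    simp [Expr.cost]
    omega
  · exact ⟨0, by omega, by simp [Expr.eval], hset, htick _ _ _ h0, by simp [Expr.cost]⟩

end TCO

/-! ### A search tree for hitting sets -/

namespace TCO

/-- The `l` values of `f` from the index `p` on. -/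
def seg (f : ℕ → ℕ) (p l : ℕ) : List ℕ := (List.range l).map fun i => f (p + i)

theorem seg_succ (f : ℕ → ℕ) (p l : ℕ) : seg f p (l + 1) = seg f p l ++ [f (p + l)] := by
  simp [seg, List.range_succ]

theorem seg_congr {f g : ℕ → ℕ} {p l : ℕ} (h : ∀ i < l, f (p + i) = g (p + i)) :
    seg f p l = seg g p l := by
  simp only [seg, List.map_inj_left, List.mem_range]
  exact h

/-- A node of the search tree, as the list of the choices on the way to it, the last one first. A
choice `(y, x)` puts the element `y` into the hitting set and keeps the element `x` out of it,
where `x = 0` means that no element is kept out. -/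
abbrev TreePath := List (ℕ × ℕ)

namespace TreePath

/-- The elements put into the hitting set. -/
def chosen (p : TreePath) : List ℕ := p.map Prod.fst

/-- The elements kept out of the hitting set; `0` is the value of unused slots. -/
def excl (p : TreePath) : List ℕ := 0 :: p.map Prod.snd

end TreePath

open TCO.TreePath

section Tree

variable (f : ℕ → ℕ) (w M : ℕ)

/-- No element of the `j`-th block is in `C`. -/
def Unhit (C : List ℕ) (j : ℕ) : Prop := ∀ e ∈ seg f (j * w) w, e ∉ C

/-- The slots of the `j`-th block whose elements are not in `Z`. -/
def live (Z : List ℕ) (j : ℕ) : List ℕ := (seg f (j * w) w).filter (· ∉ Z)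

/-- `H` meets all the `M` blocks. -/
def Hits (H : Finset ℕ) : Prop := ∀ j < M, ∃ e ∈ seg f (j * w) w, e ∈ H

/-- Some block that is still to be hit has lost a slot. -/
def Small (p : TreePath) : Prop := ∃ j < M, Unhit f w p.chosen j ∧ (live f w p.excl j).length < w

/-- The node `p` has a hitting set with at most `k` elements in its subtree. -/
structure Good (k : ℕ) (p : TreePath) (H : Finset ℕ) : Prop where
  chosen : ∀ y ∈ p.chosen, y ∈ H
  excl : ∀ z ∈ p.excl, z ∉ H
  hits : Hits f w M H
  card : H.card ≤ k

/-- Every block that contains `x` and is still to be hit contains `y`. -/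
def Dominates (p : TreePath) (x y : ℕ) : Prop :=
  ∀ j < M, Unhit f w p.chosen j → x ∈ seg f (j * w) w → y ∈ seg f (j * w) w

open Classical in
/-- The children of the node `p` when it branches on the element `x` of the block `j`. If `x` is
dominated by another live element of the block, then another live element is chosen, since that
element can replace `x` in a solution. Otherwise, either `x` is chosen, or it is excluded and
another live element is chosen. -/
noncomputable def children (p : TreePath) (j x : ℕ) : List TreePath :=
  if ∃ y ∈ live f w p.excl j, y ≠ x ∧ Dominates f w M p x y then
    ((live f w p.excl j).filter (· ≠ x)).map fun y => (y, 0) :: p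
  else ((x, 0) :: p) :: ((live f w p.excl j).filter (· ≠ x)).map fun y => (y, x) :: p

end Tree

/-- Bounds for the number of nodes in a subtree of height `k`, for nodes with and without a block
that has lost a slot, if the blocks have `W + 1` slots. -/
def nodeBound (W : ℕ) : ℕ → ℕ × ℕ
  | 0 => (1, 1)
  | k + 1 => (1 + (nodeBound W k).2 + (W - 1) * (nodeBound W k).1,
      1 + (nodeBound W k).2 + W * (nodeBound W k).1)

theorem nodeBound_le (W k : ℕ) : (nodeBound W k).1 ≤ (nodeBound W k).2 := by
  cases k with
  | zero => simp [nodeBound]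
  | succ k =>
    simp only [nodeBound]
    have := Nat.mul_le_mul_right (nodeBound W k).1 (Nat.sub_le W 1)
    omega

/-- A block that has lost a slot saves at most the fraction `1 / W` of a subtree. Hence `W` full
children, at a node with a dominated element, cost no more than one full child and `W` children with
a smaller block. -/
theorem nodeBound_key {W : ℕ} (hW : 1 ≤ W) (k : ℕ) :
    (W - 1) * (nodeBound W k).2 ≤ W * (nodeBound W k).1 := by
  obtain ⟨W, rfl⟩ : ∃ V, W = V + 1 := ⟨W - 1, by omega⟩
  cases k with
  | zero => simp [nodeBound]
  | succ k =>
    simp only [nodeBound, Nat.add_sub_cancel]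
    generalize (nodeBound (W + 1) k).1 = B
    generalize (nodeBound (W + 1) k).2 = T
    nlinarith [Nat.zero_le (W * B), Nat.zero_le (W * T)]

/-- The growth rate `W + ε` of the recursion, with `ε = 2 / W`. For both components together, the
induction needs `(nodeBound W k).1 ≤ β * X` and `(nodeBound W k).2 ≤ X` with
`X = (W + 3) * (W + ε) ^ k`, where `β` solves `1 + β * W + δ = W + ε`, and `δ * X ≥ 1` pays for the
node itself. -/
theorem nodeBound_le_pow {W : ℕ} (hW : 2 ≤ W) (k : ℕ) :
    ((nodeBound W k).2 : ℝ) ≤ (W + 3) * (W + 2 / W : ℝ) ^ k := by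
  have hW' : (2 : ℝ) ≤ W := by exact_mod_cast hW
  have hW0 : (0 : ℝ) < W := by linarith
  obtain ⟨ε, hε⟩ : ∃ ε : ℝ, ε = 2 / W := ⟨_, rfl⟩
  obtain ⟨δ, hδ⟩ : ∃ δ : ℝ, δ = 1 / (W + 3) := ⟨_, rfl⟩
  obtain ⟨β, hβ⟩ : ∃ β : ℝ, β = (W + ε - 1 - δ) / W := ⟨_, rfl⟩
  have e1 : ε * W = 2 := by rw [hε]; field_simp
  have d1 : δ * (W + 3) = 1 := by rw [hδ]; field_simp
  have b1 : β * W = W + ε - 1 - δ := by rw [hβ]; field_simp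
  have e0 : 0 < ε := by rw [hε]; positivity
  have d0 : 0 < δ := by rw [hδ]; positivity
  have e2 : ε ≤ 1 := by nlinarith
  -- the growth of the first component
  have key : 1 + (W - 1) * β + δ ≤ β * (W + ε) := by
    have : W * (1 + δ) ≤ W * (β * (1 + ε)) := by
      have : W * (β * (1 + ε)) = (W + ε - 1 - δ) * (1 + ε) := by rw [← b1]; ring
      rw [this]
      nlinarith
    have := le_of_mul_le_mul_left this hW0
    nlinarith
  have b0 : δ ≤ β := by
    have : W * δ ≤ W * β := by nlinarith
    exact le_of_mul_le_mul_left this hW0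
  have main : ∀ k : ℕ, ((nodeBound W k).1 : ℝ) ≤ (W + 3) * β * (W + ε) ^ k ∧
      ((nodeBound W k).2 : ℝ) ≤ (W + 3) * (W + ε) ^ k := by
    intro k
    induction k with
    | zero =>
      simp only [nodeBound, Nat.cast_one, pow_zero, mul_one]
      constructor <;> nlinarith
    | succ k ih =>
      obtain ⟨i1, i2⟩ := ih
      obtain ⟨X, hX⟩ : ∃ X : ℝ, X = (W + 3) * (W + ε) ^ k := ⟨_, rfl⟩
      have hX1 : 1 ≤ δ * X := by
        rw [hX, ← mul_assoc, d1, one_mul]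
        exact one_le_pow₀ (by linarith)
      have hX0 : 0 < X := by rw [hX]; positivity
      have i1' : ((nodeBound W k).1 : ℝ) ≤ β * X := by rw [hX]; linarith
      rw [← hX] at i2
      simp only [nodeBound, pow_succ]
      push_cast [Nat.cast_sub (show 1 ≤ W by omega)]
      constructor
      · have h1 : ((W : ℝ) - 1) * (nodeBound W k).1 ≤ (W - 1) * (β * X) :=
          mul_le_mul_of_nonneg_left i1' (by linarith)
        have h2 := mul_le_mul_of_nonneg_right key hX0.le
        calc _ ≤ δ * X + X + (W - 1) * (β * X) := by linarith
          _ ≤ β * (W + ε) * X := by linarith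
          _ = _ := by rw [hX]; ring
      · have h1 : (W : ℝ) * (nodeBound W k).1 ≤ W * (β * X) :=
          mul_le_mul_of_nonneg_left i1' (by linarith)
        calc _ ≤ δ * X + X + β * W * X := by linarith
          _ = (W + ε) * X := by rw [b1]; ring
          _ = _ := by rw [hX]; ring
  rw [← hε]
  exact (main k).2

section Tree

variable {f : ℕ → ℕ} {w M : ℕ}

open Classical in
variable (f w M) in
/-- A bound for the number of nodes in the subtree of `p`. -/
noncomputable def weight (k : ℕ) (p : TreePath) : ℕ :=
  if Small f w M p then (nodeBound (w - 1) (k - p.length)).1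
  else (nodeBound (w - 1) (k - p.length)).2

theorem weight_le (k : ℕ) (p : TreePath) :
    weight f w M k p ≤ (nodeBound (w - 1) (k - p.length)).2 := by
  unfold weight
  split_ifs
  · exact nodeBound_le _ _
  · exact le_rfl

theorem one_le_weight (k : ℕ) (p : TreePath) : 1 ≤ weight f w M k p := by
  unfold weight
  cases k - p.length <;> simp only [nodeBound] <;> split_ifs <;> omega

theorem sum_map_le_mul {α : Type} (l : List α) (g : α → ℕ) (b : ℕ) (h : ∀ a ∈ l, g a ≤ b) :
    (l.map g).sum ≤ l.length * b := by
  simpa using List.sum_le_card_nsmul (l.map g) b (by simpa using h)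

/-- If `y` does not dominate `x`, then to choose `y` and exclude `x` makes a block smaller. -/
theorem small_of_not_dominates {p : TreePath} {x y : ℕ} (h : ¬ Dominates f w M p x y) :
    Small f w M ((y, x) :: p) := by
  simp only [Dominates, not_forall] at h
  obtain ⟨j, hj, hu, hxj, hyj⟩ := h
  refine ⟨j, hj, fun e he => ?_, ?_⟩
  · simp only [chosen, List.map_cons, List.mem_cons, not_or]
    exact ⟨fun h => hyj (h ▸ he), hu e he⟩
  · have : (seg f (j * w) w).length = w := by simp [seg]
    rw [live]
    conv_rhs => rw [← this]
    rw [List.length_filter_lt_length_iff_exists]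
    exact ⟨x, hxj, by simp [excl]⟩

/-- The bounds for the children of a node add up to less than the one of the node. As the block has
the fewest live slots, it has lost a slot itself if the node has a block that has. -/
theorem sum_weight_children {k : ℕ} {p : TreePath} {j x : ℕ} (hw : 2 ≤ w)
    (hmin : ∀ j' < M, Unhit f w p.chosen j' →
      (live f w p.excl j).length ≤ (live f w p.excl j').length)
    (hx : x ∈ live f w p.excl j) (hk : p.length < k) :
    1 + ((children f w M p j x).map (weight f w M k)).sum ≤ weight f w M k p := by
  obtain ⟨r, hr⟩ : ∃ r, k - p.length = r + 1 := ⟨k - p.length - 1, by omega⟩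
  have hr' : ∀ a : ℕ × ℕ, k - (a :: p).length = r := fun a => by
    simp only [List.length_cons]; omega
  set o := (live f w p.excl j).filter (· ≠ x) with ho
  have hlen : o.length < (live f w p.excl j).length :=
    List.length_filter_lt_length_iff_exists.2 ⟨x, hx, by simp⟩
  have hlw : (live f w p.excl j).length ≤ w := by
    refine (List.length_filter_le _ _).trans ?_
    simp [seg]
  obtain ⟨W, rfl⟩ : ∃ V, w = V + 2 := ⟨w - 2, by omega⟩
  have hT := nodeBound_le (W + 1) r
  have hkey := nodeBound_key (W := W + 1) (by omega) r
  have hwt : ∀ a : ℕ × ℕ, weight f (W + 2) M k (a :: p) ≤ (nodeBound (W + 1) r).2 := fun a => by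
    have := weight_le (f := f) (w := W + 2) (M := M) k (a :: p)
    rwa [hr'] at this
  have hS : Small f (W + 2) M p → o.length ≤ W := by
    rintro ⟨j', hj', hu, hl⟩
    have := hmin j' hj' hu
    omega
  have hp : weight f (W + 2) M k p = 1 + (nodeBound (W + 1) r).2 +
      (if o.length ≤ W then W else W + 1) * (nodeBound (W + 1) r).1 ∨
      1 + (nodeBound (W + 1) r).2 + (W + 1) * (nodeBound (W + 1) r).1 = weight f (W + 2) M k p := by
    unfold weight
    rw [hr]
    by_cases h : Small f (W + 2) M p
    · left; simp [h, hS h, nodeBound]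
    · right; simp [h, nodeBound]
  have hp' : 1 + (nodeBound (W + 1) r).2 + o.length * (nodeBound (W + 1) r).1 ≤
      weight f (W + 2) M k p := by
    have h1 : o.length * (nodeBound (W + 1) r).1 ≤ (W + 1) * (nodeBound (W + 1) r).1 :=
      Nat.mul_le_mul_right _ (by omega)
    rcases hp with hp | hp
    · split_ifs at hp with h
      · have := Nat.mul_le_mul_right (nodeBound (W + 1) r).1 h
        omega
      · omega
    · omega
  unfold children
  rw [← ho]
  split_ifs with hd
  · rw [List.map_map]
    have h1 : (o.map (weight f (W + 2) M k ∘ fun y => (y, 0) :: p)).sum ≤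
        o.length * (nodeBound (W + 1) r).2 := sum_map_le_mul _ _ _ fun y _ => hwt _
    have h2 : o.length * (nodeBound (W + 1) r).2 ≤
        (nodeBound (W + 1) r).2 + o.length * (nodeBound (W + 1) r).1 := by
      simp only [Nat.add_sub_cancel] at hkey
      have h3 : o.length ≤ W + 1 := by omega
      generalize (nodeBound (W + 1) r).1 = B at *
      generalize (nodeBound (W + 1) r).2 = T at *
      generalize o.length = l at *
      -- With `T = B + D`, it remains to show `l * D ≤ B + D`; the worst case is `l = W + 1`.
      obtain ⟨D, rfl⟩ : ∃ D, T = B + D := ⟨T - B, by omega⟩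
      have h4 : W * D ≤ B := by nlinarith
      have h5 : l * D ≤ (W + 1) * D := Nat.mul_le_mul_right _ h3
      nlinarith
    omega
  · push Not at hd
    rw [List.map_cons, List.sum_cons, List.map_map]
    have h1 : (o.map (weight f (W + 2) M k ∘ fun y => (y, x) :: p)).sum ≤
        o.length * (nodeBound (W + 1) r).1 := by
      refine sum_map_le_mul _ _ _ fun y hy => ?_
      rw [ho, List.mem_filter] at hy
      have hs := small_of_not_dominates (hd y hy.1 (by simpa using hy.2))
      simp only [Function.comp, weight, hs, if_true, hr']
      exact le_rfl
    have := hwt (x, 0)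
    omega

/-- No solution is lost by branching: if `y` dominates `x` and `x` is the only element of the block
in the solution, then `x` can be replaced by `y`. -/
theorem exists_good_child {k : ℕ} {p : TreePath} {j x : ℕ} {H : Finset ℕ} (hH : Good f w M k p H)
    (hj : j < M) (hu : Unhit f w p.chosen j) (hx : x ∈ live f w p.excl j) :
    ∃ c ∈ children f w M p j x, ∃ H', Good f w M k c H' := by
  have hx0 : x ∉ p.excl := by simpa using (List.mem_filter.1 hx).2
  have hxj : x ∈ seg f (j * w) w := (List.mem_filter.1 hx).1
  have h0 : 0 ∉ H := hH.excl 0 (by simp [excl])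
  have hcons : ∀ (y z : ℕ) (H' : Finset ℕ), (∀ y ∈ p.chosen, y ∈ H') → (∀ z ∈ p.excl, z ∉ H') →
      Hits f w M H' → H'.card ≤ k → y ∈ H' → z ∉ H' → Good f w M k ((y, z) :: p) H' := by
    intro y z H' h1 h2 h3 h4 h5 h6
    refine ⟨?_, ?_, h3, h4⟩
    · intro a ha
      rcases List.mem_cons.1 ha with rfl | ha
      · exact h5
      · exact h1 a ha
    · simp only [excl, List.map_cons, List.mem_cons] at h2 ⊢
      rintro a (rfl | rfl | h)
      · exact h2 _ (.inl rfl)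
      · exact h6
      · exact h2 _ (.inr h)
  obtain ⟨e, hej, heH⟩ := hH.hits j hj
  have helive : e ∈ live f w p.excl j :=
    List.mem_filter.2 ⟨hej, by simpa using fun h => hH.excl e h heH⟩
  unfold children
  split_ifs with hd
  · by_cases hex : ∃ e ∈ live f w p.excl j, e ≠ x ∧ e ∈ H
    · obtain ⟨e, he1, he2, he3⟩ := hex
      exact ⟨_, List.mem_map.2 ⟨e, List.mem_filter.2 ⟨he1, by simpa using he2⟩, rfl⟩, H,
        hcons _ _ _ hH.chosen hH.excl hH.hits hH.card he3 h0⟩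
    · -- Only `x` hits the block, and `y` can take its place.
      push Not at hex
      obtain ⟨y, hy1, hy2, hy3⟩ := hd
      have hxH : x ∈ H := by
        by_contra h
        exact hex e helive (fun h' => h (h' ▸ heH)) heH
      have hy0 : y ∉ p.excl := by simpa using (List.mem_filter.1 hy1).2
      have hxc : x ∉ p.chosen := hu x hxj
      have hch : ∀ c ∈ p.chosen, c ∈ insert y (H.erase x) := fun c hc =>
        Finset.mem_insert_of_mem (Finset.mem_erase.2 ⟨fun h => hxc (h ▸ hc), hH.chosen c hc⟩)
      refine ⟨_, List.mem_map.2 ⟨y, List.mem_filter.2 ⟨hy1, by simpa using hy2⟩, rfl⟩,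
        insert y (H.erase x), hcons _ _ _ hch ?_ ?_ ?_ (Finset.mem_insert_self _ _) ?_⟩
      · intro z hz h
        rcases Finset.mem_insert.1 h with rfl | h
        · exact hy0 hz
        · exact hH.excl z hz (Finset.mem_of_mem_erase h)
      · intro j' hj'
        by_cases hu' : Unhit f w p.chosen j'
        · by_cases hxj' : x ∈ seg f (j' * w) w
          · exact ⟨y, hy3 j' hj' hu' hxj', Finset.mem_insert_self _ _⟩
          · obtain ⟨a, ha1, ha2⟩ := hH.hits j' hj'
            exact ⟨a, ha1, Finset.mem_insert_of_mem
              (Finset.mem_erase.2 ⟨fun h => hxj' (h ▸ ha1), ha2⟩)⟩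
        · simp only [Unhit, not_forall, not_not] at hu'
          obtain ⟨a, ha1, ha2⟩ := hu'
          exact ⟨a, ha1, hch a ha2⟩
      · refine (Finset.card_insert_le _ _).trans ?_
        rw [Finset.card_erase_add_one hxH]
        exact hH.card
      · intro h
        rcases Finset.mem_insert.1 h with rfl | h
        · exact hy0 (by simp [excl])
        · exact h0 (Finset.mem_of_mem_erase h)
  · by_cases hxH : x ∈ H
    · exact ⟨_, List.mem_cons_self, H, hcons _ _ _ hH.chosen hH.excl hH.hits hH.card hxH h0⟩
    · exact ⟨_, List.mem_cons_of_mem _ (List.mem_map.2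
        ⟨e, List.mem_filter.2 ⟨helive, by simpa using fun h : e = x => hxH (h ▸ heH)⟩, rfl⟩), H,
        hcons _ _ _ hH.chosen hH.excl hH.hits hH.card heH hxH⟩

/-- A child chooses a new element of the block. -/
theorem children_cons {p c : TreePath} {j x : ℕ} (hx : x ∈ live f w p.excl j)
    (hc : c ∈ children f w M p j x) :
    ∃ y z, c = (y, z) :: p ∧ y ∈ live f w p.excl j := by
  unfold children at hc
  split_ifs at hc
  · obtain ⟨y, hy, rfl⟩ := List.mem_map.1 hc
    exact ⟨y, 0, rfl, (List.mem_filter.1 hy).1⟩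
  · rcases List.mem_cons.1 hc with rfl | hc
    · exact ⟨x, 0, rfl, hx⟩
    · obtain ⟨y, hy, rfl⟩ := List.mem_map.1 hc
      exact ⟨y, x, rfl, (List.mem_filter.1 hy).1⟩

end Tree

end TCO

/-! ### The search program -/

namespace TCO

open TCO.TreePath

/-- The scalar variables of the program. The input numbers are `n`, `m`, `k`; there are `M` blocks,
and the nodes of the search tree are numbered in the order of their creation, with `cur` the one
being treated and `free` the next number; `st` is the current stamp. -/
inductive Var where
  | n | m | k | K | t | go | s | sum | u | N | M | wp | b | p | i | j | c | free | cur | found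
  | st | x | y | z | hit | cnt | hx | hy | ptr | bs | bp | dom | dy | e
  deriving DecidableEq

/-- The arrays of the program. `PW` holds the powers of two, `B` the current topic, `SEEN` the marks
of the topics read, `CUT` the slots of the blocks one after the other, `D1` and `D2` the users of an
element, `SI` and `SJ` a fixed table of pairs of indices. A node of the search tree has its pair
`(Y, Z)`, its parent `PAR` and its depth `DEP`. `CH` and `EX` hold the stamps of the elements chosen
and excluded. -/
inductive Arr where
  | PW | B | SEEN | CUT | D1 | D2 | SI | SJ | Y | Z | PAR | DEP | CH | EX
  deriving DecidableEq

/-- Commands of the program. -/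
abbrev Com := Cmd Var Arr

/-- States of the program. -/
abbrev Sta := St Var Arr

section Programs

open Var Arr TCO.Expr Cmd

/-- Scan the block at `ptr`: is it hit, how many slots are live, does it contain `x`, or `y`? -/
def scan (w : ℕ) : Com :=
  .seq (set hit (lit 0)) <| .seq (set cnt (lit 0)) <| .seq (set hx (lit 0)) <|
  .seq (set hy (lit 0)) <|
  Cmd.for c (lit w) <|
    .seq (set e (get CUT (add (var ptr) (var c)))) <|
    .seq (set hit (cond (ne (get CH (var e)) (var st)) (var hit) (lit 1))) <|
    .seq (set cnt (cond (ne (get EX (var e)) (var st)) (add (var cnt) (lit 1)) (var cnt))) <|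
    .seq (set hx (cond (ne (var e) (var x)) (var hx) (lit 1)))
      (set hy (cond (ne (var e) (var y)) (var hy) (lit 1)))

/-- Stamp the elements chosen and those excluded on the way to the node `cur`. Each node uses its
own stamp, so nothing has to be reset. -/
def mark : Com :=
  .seq (set p (var cur)) <|
  Cmd.for i (get DEP (var cur)) <|
    .seq (put CH (get Y (var p)) (var st)) <|
    .seq (put EX (get Z (var p)) (var st))
      (set p (get PAR (var p)))

/-- Look for a block that is not hit, with as few live slots as possible: its address is `bp` and
the number of its live slots is `bs`, with `bs = w + 1` if all blocks are hit. -/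
def select (w : ℕ) : Com :=
  .seq (set ptr (lit 0)) <| .seq (set bs (lit (w + 1))) <| .seq (set bp (lit 0)) <|
  Cmd.for j (var M) <|
    .seq (scan w) <|
    .seq (set e (cond (var hit) (lit 0) (sub (var bs) (var cnt)))) <|
    .seq (set bp (cond (var e) (var ptr) (var bp))) <|
    .seq (set bs (cond (var e) (var cnt) (var bs)))
      (set ptr (add (var ptr) (lit w)))

/-- Take for `x` an element of a live slot of the block at `bp`. -/
def pick (w : ℕ) : Com :=
  .seq (set x (lit 0)) <|
  Cmd.for i (lit w) <|
    .seq (set e (get CUT (add (var bp) (var i))))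
      (set x (cond (ne (get EX (var e)) (var st)) (var e) (var x)))

/-- Does the element `y` dominate `x`? -/
def domCheck (w : ℕ) : Com :=
  .seq (set ptr (lit 0)) <| .seq (set dy (lit 1)) <|
  Cmd.for j (var M) <|
    .seq (scan w) <|
    .seq (set dy (cond (var hit) (var dy) (cond (var hx) (cond (var hy) (var dy) (lit 0))
      (var dy))))
      (set ptr (add (var ptr) (lit w)))

/-- Is `x` dominated by another live element of the block at `bp`? -/
def domSearch (w : ℕ) : Com :=
  .seq (set dom (lit 0)) <|
  Cmd.for i (lit w) <|
    .seq (set y (get CUT (add (var bp) (var i)))) <|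
    .seq (domCheck w)
      (set dom (cond (ne (get EX (var y)) (var st)) (cond (ne (var y) (var x))
        (cond (var dy) (lit 1) (var dom)) (var dom)) (var dom)))

/-- Append a child of the node `cur` to the queue. -/
def push (ey ez : Expr Var Arr) : Com :=
  .seq (put Y (var free) ey) <| .seq (put Z (var free) ez) <|
  .seq (put PAR (var free) (var cur)) <|
  .seq (put DEP (var free) (add (get DEP (var cur)) (lit 1)))
    (set free (add (var free) (lit 1)))

/-- Append children for the live elements of the block at `bp` other than `x`. -/
def pushOthers (w : ℕ) : Com :=
  Cmd.for i (lit w) <|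
    .seq (set y (get CUT (add (var bp) (var i)))) <|
    ite (cond (ne (get EX (var y)) (var st)) (ne (var y) (var x)) (lit 0))
      (push (var y) (var z)) skip

/-- Append all the children of the node `cur`. -/
def branch (w : ℕ) : Com :=
  .seq (pick w) <| .seq (domSearch w) <|
  .seq (ite (var dom) (set z (lit 0)) (.seq (set z (var x)) (push (var x) (lit 0))))
    (pushOthers w)

/-- Print the hitting set of the node `cur`. -/
def output : Com :=
  .seq (set found (lit 1)) <| .seq (pr (lit 1)) <| .seq (set p (var cur)) <|
  Cmd.for i (get DEP (var cur)) <|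
    .seq (pr (get D1 (get Y (var p)))) <|
    .seq (pr (get D2 (get Y (var p))))
      (set p (get PAR (var p)))

/-- Treat the node `cur`: output its elements if all blocks are hit, and append its children if its
block has a live slot and the depth is less than `k`. The element `0` of unused slots is stamped as
excluded. -/
def process (w : ℕ) : Com :=
  .seq (set st (add (var cur) (lit 1))) <| .seq (put EX (lit 0) (var st)) <|
  .seq mark <| .seq (select w) <|
  ite (sub (lit (w + 1)) (var bs))
    (ite (cond (var bs) (sub (var k) (get DEP (var cur))) (lit 0)) (branch w) skip)
    output

/-- Breadth-first search for a hitting set. -/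
def search (w : ℕ) : Com :=
  .seq (set free (lit 1)) <| .seq (set cur (lit 0)) <| .seq (set found (lit 0)) <|
  .seq (set go (lit 1)) <|
  .seq (.while (var go) <| .seq (process w) <| .seq (set cur (add (var cur) (lit 1)))
    (set go (cond (var found) (lit 0) (sub (var free) (var cur))))) <|
  ite (var found) skip (pr (lit 0))

end Programs

/-- The node `q` of the tree kept in the arrays `Y`, `Z`, `PAR`, `DEP` is the node `p`. -/
def IsPath (a : Arr → ℕ → ℕ) : ℕ → TreePath → Prop
  | q, [] => a .DEP q = 0
  | q, yz :: p => a .Y q = yz.1 ∧ a .Z q = yz.2 ∧ a .DEP q = p.length + 1 ∧ a .PAR q < q ∧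
      IsPath a (a .PAR q) p

theorem IsPath.dep {a : Arr → ℕ → ℕ} {q : ℕ} {p : TreePath} (h : IsPath a q p) :
    a .DEP q = p.length := by
  cases p with
  | nil => exact h
  | cons yz p => exact h.2.2.1

theorem IsPath.congr {a b : Arr → ℕ → ℕ} {p : TreePath} : ∀ {q : ℕ}, IsPath a q p →
    (∀ i ≤ q, a .Y i = b .Y i ∧ a .Z i = b .Z i ∧ a .PAR i = b .PAR i ∧ a .DEP i = b .DEP i) →
    IsPath b q p := by
  induction p with
  | nil =>
    intro q h hab
    have := (hab q le_rfl).2.2.2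
    simp only [IsPath] at h ⊢
    omega
  | cons yz p ih =>
    intro q h hab
    obtain ⟨h1, h2, h3, h4, h5⟩ := h
    obtain ⟨e1, e2, e3, e4⟩ := hab q le_rfl
    refine ⟨e1 ▸ h1, e2 ▸ h2, e4 ▸ h3, e3 ▸ h4, ?_⟩
    rw [← e3]
    exact ih h5 fun i hi => hab i (by omega)

/-- The arrays hold the family of the `M` blocks of `f`, and the stamps of the node `p`. -/
structure Env (f : ℕ → ℕ) (M : ℕ) (p : TreePath) (s : Sta) : Prop where
  cut : s.a .CUT = f
  M : s.v .M = M
  ch : ∀ e, s.a .CH e = s.v .st ↔ e ∈ p.chosen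
  ex : ∀ e, s.a .EX e = s.v .st ↔ e ∈ p.excl

variable {f : ℕ → ℕ} {M w : ℕ} {p : TreePath}

theorem Env.congr {s s' : Sta} (h : Env f M p s) (h1 : s'.a .CUT = s.a .CUT)
    (h2 : s'.v .M = s.v .M) (h3 : s'.a .CH = s.a .CH) (h4 : s'.a .EX = s.a .EX)
    (h5 : s'.v .st = s.v .st) : Env f M p s' :=
  ⟨h1.trans h.cut, h2.trans h.M, by rw [h3, h5]; exact h.ch, by rw [h4, h5]; exact h.ex⟩

theorem Env.frame {c : Com} {s s' : Sta} (hF : Frame c s s') (h : Env f M p s)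
    (h1 : c.wa .CUT = false := by rfl) (h2 : c.wv .M = false := by rfl)
    (h3 : c.wa .CH = false := by rfl) (h4 : c.wa .EX = false := by rfl)
    (h5 : c.wv .st = false := by rfl) : Env f M p s' :=
  h.congr (hF.a _ h1) (hF.v _ h2) (hF.a _ h3) (hF.a _ h4) (hF.v _ h5)

/-- A bound for the time of `scan`. -/
def scanTime (w : ℕ) : ℕ := w * 200 + 100

theorem scan_spec {s : Sta} {Q : Sta → Prop} (hE : Env f M p s)
    (h : ∀ s', Frame (scan w) s s' →
      (s'.v .hit = 0 ↔ ∀ e ∈ seg f (s.v .ptr) w, e ∉ p.chosen) →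
      s'.v .cnt = ((seg f (s.v .ptr) w).filter (· ∉ p.excl)).length →
      (s'.v .hx = 0 ↔ s.v .x ∉ seg f (s.v .ptr) w) →
      (s'.v .hy = 0 ↔ s.v .y ∉ seg f (s.v .ptr) w) →
      s'.tm ≤ s.tm + scanTime w → Q s') : Tr (scan w) s Q := by
  have : Tr (scan w) s fun s' => (s'.v .hit = 0 ↔ ∀ e ∈ seg f (s.v .ptr) w, e ∉ p.chosen) ∧
      s'.v .cnt = ((seg f (s.v .ptr) w).filter (· ∉ p.excl)).length ∧
      (s'.v .hx = 0 ↔ s.v .x ∉ seg f (s.v .ptr) w) ∧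
      (s'.v .hy = 0 ↔ s.v .y ∉ seg f (s.v .ptr) w) ∧ s'.tm ≤ s.tm + scanTime w := by
    unfold scan
    iterate 4 with_reducible refine Tr_seq (Tr_set ?_)
    refine Tr_for w 120 (fun l s' => (s'.v .hit = 0 ↔ ∀ e ∈ seg f (s.v .ptr) l, e ∉ p.chosen) ∧
      s'.v .cnt = ((seg f (s.v .ptr) l).filter (· ∉ p.excl)).length ∧
      (s'.v .hx = 0 ↔ s.v .x ∉ seg f (s.v .ptr) l) ∧
      (s'.v .hy = 0 ↔ s.v .y ∉ seg f (s.v .ptr) l)) rfl (fun _ _ => rfl) (fun _ _ _ h => h)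
      ?_ ?_ ?_
    · simp [seg, Expr.eval]
    · rintro l s' hl hc hF ⟨i1, i2, i3, i4⟩
      have f1 : s'.v .ptr = s.v .ptr := by simpa using hF.v .ptr rfl
      have f2 : s'.v .x = s.v .x := by simpa using hF.v .x rfl
      have f3 : s'.v .y = s.v .y := by simpa using hF.v .y rfl
      have hE' : Env f M p s' := Env.frame hF (hE.congr rfl rfl rfl rfl rfl)
      iterate 4 with_reducible refine Tr_seq (Tr_set ?_)
      refine Tr_set ?_
      simp only [Expr.eval, St.tick_a, St.tick_v, St.setv_v, St.setv_a, Expr.eval_ne_eq_zero,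
        reduceCtorEq, if_false, if_true, hE'.cut, hE'.ch, hE'.ex, f1, f2, f3, hc, St.tick_tm,
        St.setv_tm, seg_succ, List.filter_append, List.length_append, List.mem_append]
      refine ⟨?_, ?_, ?_, ?_, ?_⟩
      · simp [Expr.cost, Expr.ne]
      · split_ifs with h1
        · simp [h1]
        · rw [i1]; simp [or_imp, forall_and, h1]
      · split_ifs with h1
        · simp [h1, i2]
        · simp [h1, i2]
      · split_ifs with h1
        · simp [h1]
        · rw [i3]; simp [Ne.symm h1]
      · split_ifs with h1
        · simp [h1]
        · rw [i4]; simp [Ne.symm h1]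
    · rintro s' - - ⟨i1, i2, i3, i4⟩ ht
      refine ⟨i1, i2, i3, i4, ?_⟩
      simp [Expr.cost] at ht
      simp only [scanTime]
      omega
  exact this.frame.mono fun s' ⟨⟨h1, h2, h3, h4, h5⟩, hF⟩ => h s' hF h1 h2 h3 h4 h5

end TCO

/-! ### Blocks and domination in the search program -/

namespace TCO

open TCO.TreePath

variable {f : ℕ → ℕ} {M w : ℕ} {p : TreePath}

/-- The stamp must be new, except that `0` bears it already. -/
theorem mark_spec {s : Sta} {Q : Sta → Prop} (hp : IsPath s.a (s.v .cur) p)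
    (hcut : s.a .CUT = f) (hM : s.v .M = M) (hch : ∀ e, s.a .CH e < s.v .st)
    (hex : ∀ e, s.a .EX e ≤ s.v .st) (hex0 : ∀ e, s.a .EX e = s.v .st ↔ e = 0)
    (h : ∀ s', Frame mark s s' → Env f M p s' → (∀ e, s'.a .CH e ≤ s.v .st) →
      (∀ e, s'.a .EX e ≤ s.v .st) → s'.tm ≤ s.tm + (p.length * 200 + 100) → Q s') :
    Tr mark s Q := by
  have : Tr mark s fun s' => Env f M p s' ∧ (∀ e, s'.a .CH e ≤ s.v .st) ∧
      (∀ e, s'.a .EX e ≤ s.v .st) ∧ s'.tm ≤ s.tm + (p.length * 200 + 100) := by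
    unfold mark
    with_reducible refine Tr_seq (Tr_set ?_)
    refine Tr_for p.length 120 (fun l s' => IsPath s.a (s'.v .p) (p.drop l) ∧
      (∀ e, s'.a .CH e = s.v .st ↔ e ∈ chosen (p.take l)) ∧
      (∀ e, s'.a .EX e = s.v .st ↔ e ∈ excl (p.take l)) ∧ (∀ e, s'.a .CH e ≤ s.v .st) ∧
      (∀ e, s'.a .EX e ≤ s.v .st)) rfl (fun s' hF => ?_) (fun _ _ _ h => h) ?_ ?_ ?_
    · have f1 : s'.v .cur = s.v .cur := by simpa using hF.v .cur rfl
      have f2 : s'.a .DEP = s.a .DEP := by simpa using hF.a .DEP rfl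
      simp only [Expr.eval, f1, f2]
      exact hp.dep
    · refine ⟨by simpa [Expr.eval] using hp, fun e => ?_, fun e => ?_, fun e => (hch e).le, hex⟩
      · simpa [chosen] using (hch e).ne
      · simpa [excl] using hex0 e
    · rintro l s' hl hc hF ⟨i1, i2, i3, i4, i5⟩
      have f1 : s'.v .st = s.v .st := by simpa using hF.v .st rfl
      have f2 : s'.a .Y = s.a .Y := by simpa using hF.a .Y rfl
      have f3 : s'.a .Z = s.a .Z := by simpa using hF.a .Z rfl
      have f4 : s'.a .PAR = s.a .PAR := by simpa using hF.a .PAR rfl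
      rw [List.drop_eq_getElem_cons hl] at i1
      obtain ⟨j1, j2, -, -, j3⟩ := i1
      with_reducible refine Tr_seq (Tr_put (Tr_seq (Tr_put (Tr_set ?_))))
      refine ⟨by simp [Expr.cost], ?_⟩
      simp only [Expr.eval, St.tick_a, St.tick_v, St.setv_v, St.setv_a, St.seta_v, St.seta_a,
        reduceCtorEq, if_false, if_true, f1, f2, f3, f4, j1, j2, Function.update_apply]
      refine ⟨j3, fun e => ?_, fun e => ?_, fun e => ?_, fun e => ?_⟩
      · rw [List.take_succ_eq_append_getElem hl]
        simp only [chosen, List.map_append, List.mem_append, List.map_cons, List.map_nil,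
          List.mem_singleton] at i2 ⊢
        split_ifs with h1
        · simp [h1]
        · simp [h1, i2]
      · rw [List.take_succ_eq_append_getElem hl]
        simp only [excl, List.map_append, List.mem_append, List.map_cons, List.map_nil,
          List.mem_cons] at i3 ⊢
        split_ifs with h1
        · simp [h1]
        · simp [h1, i3]
      · split_ifs
        · exact le_rfl
        · exact i4 e
      · split_ifs
        · exact le_rfl
        · exact i5 e
    · rintro s' - hF ⟨-, i2, i3, i4, i5⟩ ht
      have f1 : s'.v .st = s.v .st := by simpa using hF.v .st rfl
      have f2 : s'.v .M = s.v .M := by simpa using hF.v .M rfl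
      have f3 : s'.a .CUT = s.a .CUT := by simpa using hF.a .CUT rfl
      simp only [List.take_length] at i2 i3
      refine ⟨⟨f3.trans hcut, f2.trans hM, by rwa [f1], by rwa [f1]⟩, i4, i5, ?_⟩
      simp [Expr.cost] at ht
      omega
  exact this.frame.mono fun s' ⟨⟨h1, h2, h3, h4⟩, hF⟩ => h s' hF h1 h2 h3 h4

/-- A bound for the time of `select`. -/
def selectTime (w M : ℕ) : ℕ := M * (scanTime w + 200) + 100

theorem length_live_le (f : ℕ → ℕ) (w : ℕ) (Z : List ℕ) (j : ℕ) :
    (live f w Z j).length ≤ w := by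
  refine (List.length_filter_le _ _).trans ?_
  simp [seg]

variable (f w p) in
/-- What is known about `bp` and `bs` when the first `l` blocks have been looked at. -/
def Selected (l bp bs : ℕ) : Prop :=
  (bs = w + 1 ∧ ∀ j < l, ¬ Unhit f w p.chosen j) ∨
    ∃ j < l, Unhit f w p.chosen j ∧ bp = j * w ∧ bs = (live f w p.excl j).length ∧
      ∀ j' < l, Unhit f w p.chosen j' → bs ≤ (live f w p.excl j').length

instance (f : ℕ → ℕ) (w : ℕ) (C : List ℕ) (j : ℕ) : Decidable (Unhit f w C j) :=
  inferInstanceAs (Decidable (∀ e ∈ seg f (j * w) w, e ∉ C))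

theorem Selected.succ {l bp bs : ℕ} (h : Selected f w p l bp bs) :
    Selected f w p (l + 1)
      (if Unhit f w p.chosen l ∧ (live f w p.excl l).length < bs then l * w else bp)
      (if Unhit f w p.chosen l ∧ (live f w p.excl l).length < bs
        then (live f w p.excl l).length else bs) := by
  have hl := length_live_le f w p.excl l
  split_ifs with h1
  · refine .inr ⟨l, by omega, h1.1, rfl, rfl, fun j' hj' hu => ?_⟩
    rcases h with ⟨hb, h⟩ | ⟨j, hj, hu', hp, hb, h⟩
    · obtain rfl | hj' := Nat.eq_or_lt_of_le (Nat.le_of_lt_succ hj')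
      · exact le_rfl
      · exact absurd hu (h j' hj')
    · obtain rfl | hj' := Nat.eq_or_lt_of_le (Nat.le_of_lt_succ hj')
      · exact le_rfl
      · exact h1.2.le.trans (h j' hj' hu)
  · rcases h with ⟨hb, h⟩ | ⟨j, hj, hu', hp, hb, h⟩
    · refine .inl ⟨hb, fun j' hj' hu => ?_⟩
      obtain rfl | hj' := Nat.eq_or_lt_of_le (Nat.le_of_lt_succ hj')
      · exact h1 ⟨hu, by omega⟩
      · exact h j' hj' hu
    · refine .inr ⟨j, by omega, hu', hp, hb, fun j' hj' hu => ?_⟩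
      obtain rfl | hj' := Nat.eq_or_lt_of_le (Nat.le_of_lt_succ hj')
      · by_contra h2
        exact h1 ⟨hu, by omega⟩
      · exact h j' hj' hu

theorem select_spec {s : Sta} {Q : Sta → Prop} (hE : Env f M p s)
    (h : ∀ s', Frame (select w) s s' → Selected f w p M (s'.v .bp) (s'.v .bs) →
      s'.tm ≤ s.tm + selectTime w M → Q s') : Tr (select w) s Q := by
  have : Tr (select w) s fun s' => Selected f w p M (s'.v .bp) (s'.v .bs) ∧
      s'.tm ≤ s.tm + selectTime w M := by
    unfold select
    iterate 3 with_reducible refine Tr_seq (Tr_set ?_)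
    refine Tr_for M (scanTime w + 120) (fun l s' => s'.v .ptr = l * w ∧
      Selected f w p l (s'.v .bp) (s'.v .bs)) rfl (fun s' hF => ?_) (fun _ _ _ h => h) ?_ ?_ ?_
    · have f1 : s'.v .M = s.v .M := by simpa using hF.v .M rfl
      simp only [Expr.eval, f1, hE.M]
    · simp [Expr.eval, Selected]
    · rintro l s' hl hc hF ⟨i1, i2⟩
      have hE' : Env f M p s' := Env.frame hF (hE.congr rfl rfl rfl rfl rfl)
      refine Tr_seq (scan_spec hE' ?_)
      rintro s1 hF1 j1 j2 - - ht
      have f1 : s1.v .ptr = l * w := (hF1.v .ptr rfl).trans i1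
      have f2 : s1.v .bs = s'.v .bs := hF1.v .bs rfl
      have f3 : s1.v .bp = s'.v .bp := hF1.v .bp rfl
      rw [i1] at j1 j2
      change _ ↔ Unhit f w p.chosen l at j1
      change _ = (live f w p.excl l).length at j2
      iterate 3 with_reducible refine Tr_seq (Tr_set ?_)
      refine Tr_set ⟨?_, ?_, ?_⟩
      · simp [Expr.cost]; omega
      · simp [Expr.eval, f1]; ring
      · have key : ((if s1.v .hit = 0 then s'.v .bs - (live f w p.excl l).length else 0) = 0) ↔
            ¬ (Unhit f w p.chosen l ∧ (live f w p.excl l).length < s'.v .bs) := by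
          rw [← j1]
          split_ifs with h1
          · simp [h1, Nat.sub_eq_zero_iff_le]
          · simp [h1]
        simp only [Expr.eval, St.tick_v, St.setv_v, reduceCtorEq, if_false, if_true, f1, f2, f3, j2,
          key, ite_not]
        exact i2.succ
    · rintro s' - - ⟨-, i2⟩ ht
      refine ⟨i2, ?_⟩
      simp [Expr.cost] at ht
      simp only [selectTime]
      have e1 : M * (scanTime w + 200) = M * (scanTime w + 120 + 2 + 10) + M * 68 := by ring
      omega
  exact this.frame.mono fun s' ⟨⟨h1, h2⟩, hF⟩ => h s' hF h1 h2

theorem pick_spec {s : Sta} {Q : Sta → Prop} (hE : Env f M p s) {j : ℕ} (hbp : s.v .bp = j * w)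
    (hl : 0 < (live f w p.excl j).length)
    (h : ∀ s', Frame (pick w) s s' → s'.v .x ∈ live f w p.excl j →
      s'.tm ≤ s.tm + (w * 200 + 100) → Q s') : Tr (pick w) s Q := by
  have : Tr (pick w) s fun s' => s'.v .x ∈ live f w p.excl j ∧
      s'.tm ≤ s.tm + (w * 200 + 100) := by
    unfold pick
    with_reducible refine Tr_seq (Tr_set ?_)
    refine Tr_for w 120 (fun l s' => (seg f (j * w) l).filter (· ∉ p.excl) ≠ [] →
      s'.v .x ∈ (seg f (j * w) l).filter (· ∉ p.excl)) rfl (fun s' hF => rfl)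
      (fun _ _ _ h => h) ?_ ?_ ?_
    · simp [seg]
    · rintro l s' hl hc hF i1
      have hE' : Env f M p s' := Env.frame hF (hE.congr rfl rfl rfl rfl rfl)
      have f1 : s'.v .bp = j * w := by simpa [hbp] using hF.v .bp rfl
      with_reducible refine Tr_seq (Tr_set (Tr_set ⟨?_, ?_⟩))
      · simp [Expr.cost, Expr.ne]
      · simp only [Expr.eval, St.tick_a, St.tick_v, St.setv_v, St.setv_a, Expr.eval_ne_eq_zero,
          reduceCtorEq, if_false, if_true, hE'.cut, hE'.ex, f1, hc, seg_succ, List.filter_append,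
          List.mem_append]
        split_ifs with h1
        · simpa [h1] using i1
        · simp [h1]
    · rintro s' - - i1 ht
      refine ⟨i1 (List.ne_nil_of_length_pos hl), ?_⟩
      simp [Expr.cost] at ht
      omega
  exact this.frame.mono fun s' ⟨⟨h1, h2⟩, hF⟩ => h s' hF h1 h2

theorem domCheck_spec {s : Sta} {Q : Sta → Prop} (hE : Env f M p s)
    (h : ∀ s', Frame (domCheck w) s s' →
      (s'.v .dy ≠ 0 ↔ Dominates f w M p (s.v .x) (s.v .y)) →
      s'.tm ≤ s.tm + selectTime w M → Q s') : Tr (domCheck w) s Q := by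
  have : Tr (domCheck w) s fun s' => (s'.v .dy ≠ 0 ↔ Dominates f w M p (s.v .x) (s.v .y)) ∧
      s'.tm ≤ s.tm + selectTime w M := by
    unfold domCheck
    iterate 2 with_reducible refine Tr_seq (Tr_set ?_)
    refine Tr_for M (scanTime w + 120) (fun l s' => s'.v .ptr = l * w ∧
      (s'.v .dy ≠ 0 ↔ Dominates f w l p (s.v .x) (s.v .y))) rfl (fun s' hF => ?_)
      (fun _ _ _ h => h) ?_ ?_ ?_
    · have f1 : s'.v .M = s.v .M := by simpa using hF.v .M rfl
      simp only [Expr.eval, f1, hE.M]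
    · simp [Expr.eval, Dominates]
    · rintro l s' hl hc hF ⟨i1, i2⟩
      have hE' : Env f M p s' := Env.frame hF (hE.congr rfl rfl rfl rfl rfl)
      have g1 : s'.v .x = s.v .x := by simpa using hF.v .x rfl
      have g2 : s'.v .y = s.v .y := by simpa using hF.v .y rfl
      refine Tr_seq (scan_spec hE' ?_)
      rintro s1 hF1 j1 - j3 j4 ht
      have f1 : s1.v .ptr = l * w := (hF1.v .ptr rfl).trans i1
      have f2 : s1.v .dy = s'.v .dy := hF1.v .dy rfl
      rw [i1] at j1 j3 j4
      rw [g1] at j3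
      rw [g2] at j4
      change _ ↔ Unhit f w p.chosen l at j1
      with_reducible refine Tr_seq (Tr_set (Tr_set ⟨?_, ?_, ?_⟩))
      · simp [Expr.cost]; omega
      · simp [Expr.eval, f1]; ring
      · have key : Dominates f w (l + 1) p (s.v .x) (s.v .y) ↔
            Dominates f w l p (s.v .x) (s.v .y) ∧ (Unhit f w p.chosen l →
              s.v .x ∈ seg f (l * w) w → s.v .y ∈ seg f (l * w) w) := by
          simp only [Dominates, Nat.lt_succ_iff_lt_or_eq, or_imp, forall_and, forall_eq]
        rw [key, ← i2, ← j1]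
        simp only [Expr.eval, St.tick_v, St.setv_v, reduceCtorEq, if_false, if_true, f2]
        split_ifs with h1 h2 h3
        · simp [j3.1 h2]
        · simp [h1, j4.1 h3, not_not.1 (mt j3.2 h2)]
        · simp [not_not.1 (mt j4.2 h3)]
        · simp [h1]
    · rintro s' - - ⟨-, i2⟩ ht
      refine ⟨i2, ?_⟩
      simp [Expr.cost] at ht
      simp only [selectTime]
      have e1 : M * (scanTime w + 200) = M * (scanTime w + 120 + 2 + 10) + M * 68 := by ring
      omega
  exact this.frame.mono fun s' ⟨⟨h1, h2⟩, hF⟩ => h s' hF h1 h2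

/-- A bound for the time of `domSearch`. -/
def domTime (w M : ℕ) : ℕ := w * (selectTime w M + 200) + 100

theorem domSearch_spec {s : Sta} {Q : Sta → Prop} (hE : Env f M p s) {j : ℕ}
    (hbp : s.v .bp = j * w)
    (h : ∀ s', Frame (domSearch w) s s' →
      (s'.v .dom ≠ 0 ↔ ∃ y ∈ live f w p.excl j, y ≠ s.v .x ∧ Dominates f w M p (s.v .x) y) →
      s'.tm ≤ s.tm + domTime w M → Q s') : Tr (domSearch w) s Q := by
  have : Tr (domSearch w) s fun s' =>
      (s'.v .dom ≠ 0 ↔ ∃ y ∈ live f w p.excl j, y ≠ s.v .x ∧ Dominates f w M p (s.v .x) y) ∧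
      s'.tm ≤ s.tm + domTime w M := by
    unfold domSearch
    with_reducible refine Tr_seq (Tr_set ?_)
    refine Tr_for w (selectTime w M + 120) (fun l s' => s'.v .dom ≠ 0 ↔
      ∃ y ∈ (seg f (j * w) l).filter (· ∉ p.excl), y ≠ s.v .x ∧ Dominates f w M p (s.v .x) y)
      rfl (fun s' hF => rfl) (fun _ _ _ h => h) ?_ ?_ ?_
    · simp [Expr.eval, seg]
    · rintro l s' hl hc hF i1
      have hE' : Env f M p s' := Env.frame hF (hE.congr rfl rfl rfl rfl rfl)
      have f1 : s'.v .bp = j * w := by simpa [hbp] using hF.v .bp rfl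
      have f2 : s'.v .x = s.v .x := by simpa using hF.v .x rfl
      with_reducible refine Tr_seq (Tr_set (Tr_seq ?_))
      simp only [Expr.eval, Expr.cost, hE'.cut, f1, hc]
      refine domCheck_spec (hE'.congr rfl rfl rfl rfl rfl) fun s1 hF1 j1 ht => ?_
      have hE2 : Env f M p s1 := Env.frame hF1 (hE'.congr rfl rfl rfl rfl rfl)
      have g1 : s1.v .y = f (j * w + l) := by simpa using hF1.v .y rfl
      have g2 : s1.v .x = s.v .x := by simpa [f2] using hF1.v .x rfl
      have g3 : s1.v .dom = s'.v .dom := by simpa using hF1.v .dom rfl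
      simp only [St.tick_v, St.setv_v, reduceCtorEq, if_false, if_true, f2] at j1
      refine Tr_set ⟨?_, ?_⟩
      · simp [Expr.cost, Expr.ne] at ht ⊢; omega
      · simp only [Expr.eval, St.tick_v, St.setv_v, reduceCtorEq, if_false, if_true, g1, g2, g3,
          Expr.eval_ne_eq_zero, hE2.ex, seg_succ, List.filter_append, List.mem_append, or_and_right,
          exists_or]
        rw [← i1]
        split_ifs with h1 h2 h3
        · simp [h1]
        · simp [h2]
        · have := mt j1.2 (not_not.2 h3)
          simp [this]
        · simp [h1, h2, j1.1 h3]
    · rintro s' - - i1 ht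
      refine ⟨i1, ?_⟩
      simp [Expr.cost] at ht
      simp only [domTime]
      have e1 : w * (selectTime w M + 200) = w * (selectTime w M + 120 + 1 + 10) + w * 69 := by ring
      omega
  exact this.frame.mono fun s' ⟨⟨h1, h2⟩, hF⟩ => h s' hF h1 h2

end TCO

/-! ### The queue of nodes -/

namespace TCO

open TCO.TreePath

variable {f : ℕ → ℕ} {w M : ℕ} {p : TreePath}

/-- The nodes `cur, …, free - 1` kept in the arrays are those in the list `L`. -/
structure Queue (a : Arr → ℕ → ℕ) (cur free : ℕ) (L : List TreePath) : Prop where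
  free : free = cur + L.length
  path : ∀ i (h : i < L.length), IsPath a (cur + i) L[i]

theorem Queue.head {a : Arr → ℕ → ℕ} {cur free : ℕ} {L : List TreePath}
    (h : Queue a cur free (p :: L)) : IsPath a cur p := by
  exact h.path 0 (by simp)

theorem Queue.tail {a : Arr → ℕ → ℕ} {cur free : ℕ} {L : List TreePath}
    (h : Queue a cur free (p :: L)) : Queue a (cur + 1) free L := by
  refine ⟨by rw [h.free, List.length_cons]; omega, fun i hi => ?_⟩
  have := h.path (i + 1) (by simpa using hi)
  rw [Nat.add_assoc, Nat.add_comm 1]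
  exact this

theorem Queue.congr {a b : Arr → ℕ → ℕ} {cur free : ℕ} {L : List TreePath}
    (h : Queue a cur free L) (h1 : b .Y = a .Y) (h2 : b .Z = a .Z) (h3 : b .PAR = a .PAR)
    (h4 : b .DEP = a .DEP) : Queue b cur free L :=
  ⟨h.free, fun i hi => (h.path i hi).congr fun j _ => by rw [h1, h2, h3, h4]; simp⟩

theorem push_spec {ey ez : Expr Var Arr} {yv zv : ℕ} {s : Sta} {Q : Sta → Prop}
    {L : List TreePath} (hQ : Queue s.a (s.v .cur) (s.v .free) (p :: L))
    (hy : ∀ s' : Sta, s'.v = s.v → ey.eval s' = yv) (hz : ∀ s' : Sta, s'.v = s.v → ez.eval s' = zv)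
    (h : ∀ s', Frame (push ey ez) s s' →
      Queue s'.a (s'.v .cur) (s'.v .free) (p :: L ++ [(yv, zv) :: p]) →
      s'.tm ≤ s.tm + (ey.cost + ez.cost + 100) → Q s') : Tr (push ey ez) s Q := by
  have : Tr (push ey ez) s fun s' =>
      Queue s'.a (s'.v .cur) (s'.v .free) (p :: L ++ [(yv, zv) :: p]) ∧
      s'.tm ≤ s.tm + (ey.cost + ez.cost + 100) := by
    unfold push
    with_reducible refine Tr_seq (Tr_put (Tr_seq (Tr_put (Tr_seq (Tr_put (Tr_seq (Tr_put
      (Tr_set ⟨?_, ?_⟩))))))))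
    · have hd := hQ.head.dep
      have hlt : s.v .cur < s.v .free := by rw [hQ.free, List.length_cons]; omega
      rw [hy s rfl, hz (St.tick (St.seta s Arr.Y _ yv) _) rfl]
      simp only [Expr.eval, St.tick_a, St.tick_v, St.setv_v, St.setv_a, St.seta_v,
        reduceCtorEq, if_false, if_true]
      set a' := St.a _
      have ha : ∀ i < s.v .free, s.a .Y i = a' .Y i ∧ s.a .Z i = a' .Z i ∧
          s.a .PAR i = a' .PAR i ∧ s.a .DEP i = a' .DEP i := by
        intro i hi
        have : i ≠ s.v .free := by omega
        simp [a', this]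
      have hlen := hQ.free
      refine ⟨by simp [hlen]; omega, fun i hi => ?_⟩
      by_cases h1 : i < (p :: L).length
      · rw [List.getElem_append_left h1]
        exact (hQ.path i h1).congr fun j hj => ha j (by omega)
      · have h2 : i = (p :: L).length := by
          simp only [List.length_append, List.length_singleton] at hi
          omega
        subst h2
        rw [← hlen]
        have e1 : (p :: L ++ [(yv, zv) :: p])[(p :: L).length] = (yv, zv) :: p := by
          rw [List.getElem_append_right le_rfl]; simp
        rw [e1]
        refine ⟨by simp [a'], by simp [a'], by simp [a', hd], by simpa [a'] using hlt, ?_⟩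
        have : a' .PAR (s.v .free) = s.v .cur := by simp [a']
        rw [this]
        exact hQ.head.congr fun j hj => ha j (by omega)
    · simp [Expr.cost]; omega
  exact this.frame.mono fun s' ⟨⟨h1, h2⟩, hF⟩ => h s' hF h1 h2

theorem pushOthers_spec {s : Sta} {Q : Sta → Prop} (hE : Env f M p s) {j : ℕ}
    (hbp : s.v .bp = j * w) {L : List TreePath}
    (hQ : Queue s.a (s.v .cur) (s.v .free) (p :: L))
    (h : ∀ s', Frame (pushOthers w) s s' → Queue s'.a (s'.v .cur) (s'.v .free) (p :: L ++
        ((live f w p.excl j).filter (· ≠ s.v .x)).map fun y => (y, s.v .z) :: p) →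
      s'.tm ≤ s.tm + (w * 300 + 100) → Q s') : Tr (pushOthers w) s Q := by
  have : Tr (pushOthers w) s fun s' => Queue s'.a (s'.v .cur) (s'.v .free) (p :: L ++
        ((live f w p.excl j).filter (· ≠ s.v .x)).map fun y => (y, s.v .z) :: p) ∧
      s'.tm ≤ s.tm + (w * 300 + 100) := by
    unfold pushOthers
    refine Tr_for w 200 (fun l s' => Queue s'.a (s'.v .cur) (s'.v .free) (p :: L ++
        (((seg f (j * w) l).filter (· ∉ p.excl)).filter (· ≠ s.v .x)).map
          fun y => (y, s.v .z) :: p)) rfl (fun s' hF => rfl) (fun _ _ _ h => h) ?_ ?_ ?_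
    · simpa [seg] using hQ
    · rintro l s' hl hc hF i1
      have hE' : Env f M p s' := Env.frame hF hE
      have f1 : s'.v .bp = j * w := by simpa [hbp] using hF.v .bp rfl
      have f2 : s'.v .x = s.v .x := by simpa using hF.v .x rfl
      have f3 : s'.v .z = s.v .z := by simpa using hF.v .z rfl
      with_reducible refine Tr_seq (Tr_set (Tr_ite (fun h0 => ?_) fun h0 => ?_))
      · simp only [Expr.eval, St.tick_a, St.tick_v, St.setv_v, St.setv_a,
          Expr.eval_ne_eq_zero, ne_eq, reduceCtorEq, if_false, if_true, hE'.cut, hE'.ex, f1, f2, hc,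
          ite_eq_left_iff, not_forall] at h0
        obtain ⟨h2, h1⟩ := h0
        refine push_spec (yv := f (j * w + l)) (zv := s.v .z) i1 (fun s1 h1 => ?_) (fun s1 h1 => ?_)
          fun s1 hF1 j1 ht => ⟨?_, ?_⟩
        · simp [Expr.eval, h1, hE'.cut, f1, hc]
        · simp [Expr.eval, h1, f3]
        · simp [Expr.cost, Expr.ne] at ht ⊢; omega
        · simpa [seg_succ, h1, h2] using j1
      · refine Tr_skip ⟨?_, ?_⟩
        · simp [Expr.cost, Expr.ne]
        · have h1 : f (j * w + l) ∉ p.excl → f (j * w + l) = s.v .x := by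
            intro h1
            simp only [Expr.eval, St.tick_a, St.tick_v, St.setv_v, St.setv_a,
              Expr.eval_ne_eq_zero, reduceCtorEq, if_false, if_true, hE'.cut, hE'.ex, f1,
              hc, h1] at h0
            simpa [f2] using h0
          by_cases h2 : f (j * w + l) ∈ p.excl
          · simpa [seg_succ, h2] using i1
          · simpa [seg_succ, h1 h2] using i1
    · rintro s' - - i1 ht
      refine ⟨i1, ?_⟩
      simp [Expr.cost] at ht
      omega
  exact this.frame.mono fun s' ⟨⟨h1, h2⟩, hF⟩ => h s' hF h1 h2

/-- A bound for the time of `branch`. -/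
def branchTime (w M : ℕ) : ℕ := domTime w M + w * 500 + 600

theorem branch_spec {s : Sta} {Q : Sta → Prop} (hE : Env f M p s) {j : ℕ}
    (hbp : s.v .bp = j * w) (hl : 0 < (live f w p.excl j).length) {L : List TreePath}
    (hQ : Queue s.a (s.v .cur) (s.v .free) (p :: L))
    (h : ∀ s' x, Frame (branch w) s s' → x ∈ live f w p.excl j →
      Queue s'.a (s'.v .cur) (s'.v .free) (p :: L ++ children f w M p j x) →
      s'.tm ≤ s.tm + branchTime w M → Q s') : Tr (branch w) s Q := by
  have : Tr (branch w) s fun s' => ∃ x ∈ live f w p.excl j,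
      Queue s'.a (s'.v .cur) (s'.v .free) (p :: L ++ children f w M p j x) ∧
      s'.tm ≤ s.tm + branchTime w M := by
    unfold branch
    refine Tr_seq (pick_spec hE hbp hl fun s1 hF1 hx t1 => ?_)
    have hE1 := Env.frame hF1 hE
    have hbp1 := (hF1.v .bp rfl).trans hbp
    have hQ1 : Queue s1.a (s1.v .cur) (s1.v .free) (p :: L) := by
      rw [hF1.v .cur rfl, hF1.v .free rfl]
      exact hQ.congr (hF1.a _ rfl) (hF1.a _ rfl) (hF1.a _ rfl) (hF1.a _ rfl)
    refine Tr_seq (domSearch_spec hE1 hbp1 fun s2 hF2 hd t2 => ?_)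
    have hE2 := Env.frame hF2 hE1
    have hbp2 := (hF2.v .bp rfl).trans hbp1
    have hx2 := hF2.v .x rfl
    have hQ2 : Queue s2.a (s2.v .cur) (s2.v .free) (p :: L) := by
      rw [hF2.v .cur rfl, hF2.v .free rfl]
      exact hQ1.congr (hF2.a _ rfl) (hF2.a _ rfl) (hF2.a _ rfl) (hF2.a _ rfl)
    with_reducible refine Tr_seq (Tr_ite (fun h0 => ?_) fun h0 => ?_)
    · refine Tr_set (pushOthers_spec (hE2.congr rfl rfl rfl rfl rfl) (j := j)
        (by simpa using hbp2) (L := L) (by simpa using hQ2) fun s3 hF3 hQ3 t3 =>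
        ⟨s1.v .x, hx, ?_, ?_⟩)
      · rw [children, if_pos (hd.1 h0)]
        simpa [hx2, Expr.eval] using hQ3
      · simp [Expr.cost] at t3
        simp only [branchTime]
        omega
    · with_reducible refine Tr_seq (Tr_set ?_)
      refine push_spec (yv := s1.v .x) (zv := 0) (L := L) (by simpa using hQ2)
        (fun s3 h3 => ?_) (fun s3 h3 => rfl) fun s3 hF3 hQ3 t3 => ?_
      · simp [Expr.eval, h3, hx2]
      have hE3 := Env.frame hF3 (hE2.congr rfl rfl rfl rfl rfl)
      have hbp3 : s3.v .bp = j * w := by simpa [hbp2] using hF3.v .bp rfl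
      have hx3 : s3.v .x = s1.v .x := by simpa [hx2] using hF3.v .x rfl
      have hz3 : s3.v .z = s1.v .x := by simpa [hx2, Expr.eval] using hF3.v .z rfl
      refine pushOthers_spec hE3 hbp3 (L := L ++ [(s1.v .x, 0) :: p]) (by simpa using hQ3)
        fun s4 hF4 hQ4 t4 => ⟨s1.v .x, hx, ?_, ?_⟩
      · rw [children, if_neg (fun h => hd.2 h h0)]
        simpa [hx3, hz3] using hQ4
      · simp [Expr.cost] at t3
        simp only [branchTime]
        omega
  exact this.frame.mono fun s' ⟨⟨x, h1, h2, h3⟩, hF⟩ => h s' x hF h1 h2 h3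

/-- The output for the elements chosen at a node. -/
def outWord (d1 d2 : ℕ → ℕ) (p : TreePath) : List ℕ :=
  1 :: p.chosen.flatMap fun y => [d1 y, d2 y]

theorem output_spec {s : Sta} {Q : Sta → Prop} (hp : IsPath s.a (s.v .cur) p)
    (h : ∀ s', Frame output s s' → s'.v .found = 1 →
      s'.out = s.out ++ outWord (s.a .D1) (s.a .D2) p →
      s'.tm ≤ s.tm + (p.length * 200 + 100) → Q s') : Tr output s Q := by
  have : Tr output s fun s' => s'.v .found = 1 ∧
      s'.out = s.out ++ outWord (s.a .D1) (s.a .D2) p ∧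
      s'.tm ≤ s.tm + (p.length * 200 + 100) := by
    unfold output
    with_reducible refine Tr_seq (Tr_set (Tr_seq (Tr_pr (Tr_seq (Tr_set ?_)))))
    refine Tr_for p.length 120 (fun l s' => IsPath s.a (s'.v .p) (p.drop l) ∧
      s'.out = s.out ++ outWord (s.a .D1) (s.a .D2) (p.take l)) rfl (fun s' hF => ?_)
      (fun _ _ _ h => h) ?_ ?_ ?_
    · have f1 : s'.v .cur = s.v .cur := by simpa using hF.v .cur rfl
      have f2 : s'.a .DEP = s.a .DEP := by simpa using hF.a .DEP rfl
      simp only [Expr.eval, f1, f2]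
      exact hp.dep
    · refine ⟨by simpa [Expr.eval] using hp, by simp [outWord, Expr.eval, chosen]⟩
    · rintro l s' hl hc hF ⟨i1, i2⟩
      have f1 : s'.a = s.a := by
        funext b
        simpa using hF.a b rfl
      rw [List.drop_eq_getElem_cons hl] at i1
      obtain ⟨j1, j2, -, -, j3⟩ := i1
      with_reducible refine Tr_seq (Tr_pr (Tr_seq (Tr_pr (Tr_set ?_))))
      refine ⟨by simp [Expr.cost], ?_⟩
      simp only [Expr.eval, St.tick_a, St.tick_v, St.setv_v, St.print_v, St.print_a,
        St.setv_out, St.tick_out, St.print_out, reduceCtorEq, if_false, if_true, f1, j1]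
      refine ⟨j3, ?_⟩
      rw [List.take_succ_eq_append_getElem hl, i2]
      simp only [outWord, chosen, List.map_append, List.map_cons, List.map_nil,
        List.flatMap_append, List.flatMap_cons, List.flatMap_nil, List.cons_append,
        List.append_assoc, List.append_nil, List.nil_append]
    · rintro s' - hF ⟨-, i2⟩ ht
      refine ⟨by simpa [Expr.eval] using hF.v .found rfl, by simpa using i2, ?_⟩
      simp [Expr.cost] at ht
      omega
  exact this.frame.mono fun s' ⟨⟨h1, h2, h3⟩, hF⟩ => h s' hF h1 h2 h3

variable (f w M) in
/-- The elements chosen at the node `p` are distinct elements of the blocks. -/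
structure NodeOk (k : ℕ) (p : TreePath) : Prop where
  nodup : p.chosen.Nodup
  mem : ∀ y ∈ p.chosen, y ≠ 0 ∧ ∃ j < M, y ∈ seg f (j * w) w
  length : p.length ≤ k

/-- A bound for the time of `process`. -/
def processTime (w M k : ℕ) : ℕ :=
  k * 400 + selectTime w M + branchTime w M + 400

variable (f w M) in
/-- What is required of the nodes `ch` that are to replace the node `p` in the queue: they are
covered by the bound for `p`, and one of them has a solution in its subtree if `p` has. -/
structure Replaces (k : ℕ) (p : TreePath) (ch : List TreePath) : Prop where
  weight : 1 + (ch.map (weight f w M k)).sum ≤ weight f w M k p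
  good : ∀ H, Good f w M k p H → ∃ c ∈ ch, ∃ H', Good f w M k c H'
  ok : ∀ c ∈ ch, NodeOk f w M k c

/-- A node with a block that cannot be hit any more has no solution in its subtree. -/
theorem replaces_nil {k j : ℕ} (hp : NodeOk f w M k p) (hj : j < M)
    (hu : Unhit f w p.chosen j) (h : live f w p.excl j = [] ∨ k ≤ p.length) :
    Replaces f w M k p [] := by
  refine ⟨by simpa using one_le_weight k p, fun H hH => ?_, by simp⟩
  obtain ⟨e, he, heH⟩ := hH.hits j hj
  exfalso
  rcases h with h | h
  · have : e ∈ live f w p.excl j :=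
      List.mem_filter.2 ⟨he, by simpa using fun h => hH.excl e h heH⟩
    simp [h] at this
  · have h1 : insert e p.chosen.toFinset ⊆ H := by
      intro a ha
      rcases Finset.mem_insert.1 ha with rfl | ha
      · exact heH
      · exact hH.chosen a (List.mem_toFinset.1 ha)
    have h2 := (Finset.card_le_card h1).trans hH.card
    rw [Finset.card_insert_of_notMem (by simpa using hu e he),
      List.toFinset_card_of_nodup hp.nodup] at h2
    simp only [chosen, List.length_map] at h2
    omega

theorem replaces_children {k j x : ℕ} (hw : 2 ≤ w) (hp : NodeOk f w M k p) (hj : j < M)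
    (hu : Unhit f w p.chosen j)
    (hmin : ∀ j' < M, Unhit f w p.chosen j' →
      (live f w p.excl j).length ≤ (live f w p.excl j').length)
    (hx : x ∈ live f w p.excl j) (hk : p.length < k) :
    Replaces f w M k p (children f w M p j x) := by
  refine ⟨sum_weight_children hw hmin hx hk, fun H hH => exists_good_child hH hj hu hx,
    fun c hc => ?_⟩
  obtain ⟨y, z, rfl, hy⟩ := children_cons hx hc
  obtain ⟨hy1, hy2⟩ := List.mem_filter.1 hy
  have hy0 : y ≠ 0 := by
    rintro rfl
    simp [excl] at hy2
  refine ⟨List.nodup_cons.2 ⟨hu y hy1, hp.nodup⟩, fun a ha => ?_, hk⟩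
  rcases List.mem_cons.1 ha with rfl | ha
  · exact ⟨hy0, j, hj, hy1⟩
  · exact hp.mem a ha

/-- A step of the search: the node is either a solution, or replaced by its children. -/
theorem process_spec {s : Sta} {Q : Sta → Prop} {k : ℕ} {L : List TreePath} (hw : 2 ≤ w)
    (hcut : s.a .CUT = f) (hM : s.v .M = M) (hk : s.v .k = k)
    (hch : ∀ e, s.a .CH e ≤ s.v .cur) (hex : ∀ e, s.a .EX e ≤ s.v .cur)
    (hQ : Queue s.a (s.v .cur) (s.v .free) (p :: L)) (hp : NodeOk f w M k p)
    (h : ∀ s', Frame (process w) s s' → (∀ e, s'.a .CH e ≤ s.v .cur + 1) →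
      (∀ e, s'.a .EX e ≤ s.v .cur + 1) → s'.tm ≤ s.tm + processTime w M k →
      ((s'.v .found = 1 ∧ s'.out = s.out ++ outWord (s.a .D1) (s.a .D2) p ∧
          Hits f w M p.chosen.toFinset) ∨
        (s'.v .found = s.v .found ∧ s'.out = s.out ∧ ∃ ch, Replaces f w M k p ch ∧
          Queue s'.a (s'.v .cur) (s'.v .free) (p :: L ++ ch))) → Q s') :
    Tr (process w) s Q := by
  have : Tr (process w) s fun s' => (∀ e, s'.a .CH e ≤ s.v .cur + 1) ∧
      (∀ e, s'.a .EX e ≤ s.v .cur + 1) ∧ s'.tm ≤ s.tm + processTime w M k ∧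
      ((s'.v .found = 1 ∧ s'.out = s.out ++ outWord (s.a .D1) (s.a .D2) p ∧
          Hits f w M p.chosen.toFinset) ∨
        (s'.v .found = s.v .found ∧ s'.out = s.out ∧ ∃ ch, Replaces f w M k p ch ∧
          Queue s'.a (s'.v .cur) (s'.v .free) (p :: L ++ ch))) := by
    have hlen := hp.length
    unfold process
    with_reducible refine Tr_seq (Tr_set (Tr_seq (Tr_put (Tr_seq ?_))))
    refine mark_spec (f := f) (M := M) (p := p) ?_ (by simpa using hcut) (by simpa using hM)
      (fun e => ?_) (fun e => ?_) (fun e => ?_) fun s1 hF1 hE1 hch1 hex1 t1 => ?_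
    · refine hQ.head.congr fun i hi => ?_
      simp
    · simpa [Expr.eval, Nat.lt_succ_iff] using hch e
    · have := hex e
      simp only [Expr.eval, St.tick_a, St.tick_v, St.setv_v, St.setv_a, St.seta_v, St.seta_a,
        if_true, Function.update_apply]
      split_ifs <;> omega
    · have := hex e
      simp only [Expr.eval, St.tick_a, St.tick_v, St.setv_v, St.setv_a, St.seta_v, St.seta_a,
        if_true, Function.update_apply]
      split_ifs with h1
      · simp [h1]
      · simp only [h1, iff_false]; omega
    simp only [Expr.eval, St.tick_v, St.setv_v, St.seta_v, if_true, Expr.cost, St.tick_tm,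
      St.setv_tm, St.seta_tm] at hch1 hex1 t1
    have c1 : s1.v .cur = s.v .cur := by simpa using hF1.v .cur rfl
    have r1 : s1.v .free = s.v .free := by simpa using hF1.v .free rfl
    have k1 : s1.v .k = k := by simpa [hk] using hF1.v .k rfl
    have n1 : s1.v .found = s.v .found := by simpa using hF1.v .found rfl
    have o1 : s1.out = s.out := by simpa using hF1.out rfl
    have a1 : ∀ b, b ≠ .CH → b ≠ .EX → s1.a b = s.a b := by
      intro b hb hb'
      have := hF1.a b (by cases b <;> first | rfl | exact absurd rfl hb | exact absurd rfl hb')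
      simpa [hb'] using this
    refine Tr_seq (select_spec hE1 fun s2 hF2 hsel t2 => ?_)
    have hE2 := Env.frame hF2 hE1
    have c2 : s2.v .cur = s.v .cur := (hF2.v .cur rfl).trans c1
    have r2 : s2.v .free = s.v .free := (hF2.v .free rfl).trans r1
    have k2 : s2.v .k = k := (hF2.v .k rfl).trans k1
    have n2 : s2.v .found = s.v .found := (hF2.v .found rfl).trans n1
    have o2 : s2.out = s.out := (hF2.out rfl).trans o1
    have a2 : s2.a = s1.a := funext fun b => hF2.a b rfl
    have hQ2 : Queue s2.a (s2.v .cur) (s2.v .free) (p :: L) := by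
      rw [c2, r2]
      refine hQ.congr ?_ ?_ ?_ ?_ <;> rw [a2, a1 _ (by decide) (by decide)]
    have d2 : s2.a .DEP (s2.v .cur) = p.length := hQ2.head.dep
    have hch2 : ∀ e, s2.a .CH e ≤ s.v .cur + 1 := by rw [a2]; exact hch1
    have hex2 : ∀ e, s2.a .EX e ≤ s.v .cur + 1 := by rw [a2]; exact hex1
    have hl := fun j => length_live_le f w p.excl j
    with_reducible refine Tr_ite (fun h0 => ?_) fun h0 => ?_
    · rcases hsel with ⟨hb, -⟩ | ⟨j, hj, hu, hbp, hb, hmin⟩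
      · simp [Expr.eval, hb] at h0
      have hmin' : ∀ j' < M, Unhit f w p.chosen j' →
          (live f w p.excl j).length ≤ (live f w p.excl j').length := by
        intro j' h1 h2
        rw [← hb]
        exact hmin j' h1 h2
      with_reducible refine Tr_ite (fun h1 => ?_) fun h1 => ?_
      · simp only [Expr.eval, St.tick_v, St.tick_a, k2, d2] at h1
        split_ifs at h1 with h2
        · exact absurd rfl h1
        refine branch_spec (hE2.congr rfl rfl rfl rfl rfl) (j := j) (by simpa using hbp)
          (by omega) (L := L) (by simpa using hQ2) fun s3 x hF3 hx hQ3 t3 => ?_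
        refine ⟨?_, ?_, ?_, .inr ⟨?_, ?_, _, replaces_children hw hp hj hu hmin' hx (by omega),
          hQ3⟩⟩
        · rw [hF3.a .CH rfl]; exact hch2
        · rw [hF3.a .EX rfl]; exact hex2
        · simp [Expr.cost] at t3
          simp only [processTime]
          omega
        · simpa [n2] using hF3.v .found rfl
        · simpa [o2] using hF3.out rfl
      · simp only [Expr.eval, St.tick_v, St.tick_a, k2, d2] at h1
        refine Tr_skip ⟨hch2, hex2, ?_, .inr ⟨n2, o2, [], replaces_nil hp hj hu ?_, ?_⟩⟩
        · simp [Expr.cost]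
          simp only [processTime]
          omega
        · split_ifs at h1 with h2
          · exact .inl (List.eq_nil_of_length_eq_zero (hb ▸ h2))
          · exact .inr (by omega)
        · simpa using hQ2
    · simp only [Expr.eval] at h0
      refine output_spec (p := p) (by simpa using hQ2.head) fun s3 hF3 hf ho t3 => ?_
      refine ⟨?_, ?_, ?_, .inl ⟨hf, ?_, ?_⟩⟩
      · rw [hF3.a .CH rfl]; exact hch2
      · rw [hF3.a .EX rfl]; exact hex2
      · simp [Expr.cost] at t3
        simp only [processTime]
        omega
      · rw [ho]
        simp [o2, a2, a1]
      · rcases hsel with ⟨-, hs⟩ | ⟨j, hj, hu, hbp, hb, hmin⟩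
        · intro j hj
          have := hs j hj
          simp only [Unhit, not_forall, not_not] at this
          obtain ⟨e, h1, h2⟩ := this
          exact ⟨e, h1, List.mem_toFinset.2 h2⟩
        · have := hl j
          omega
  exact this.frame.mono fun s' ⟨⟨h1, h2, h3, h4⟩, hF⟩ => h s' hF h1 h2 h3 h4

/-- The search finds a hitting set with at most `k` elements if there is one. In the invariant, the
time elapsed plus `R` times the bounds for the subtrees of the nodes in the queue stays below `B`.
-/
theorem search_spec {s : Sta} {Q : Sta → Prop} {k : ℕ} (hw : 2 ≤ w)
    (hcut : s.a .CUT = f) (hM : s.v .M = M) (hk : s.v .k = k) (hdep : s.a .DEP 0 = 0)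
    (hch : ∀ e, s.a .CH e = 0) (hex : ∀ e, s.a .EX e = 0)
    (h : ∀ s', s'.tm ≤ s.tm + ((processTime w M k + 100) * (nodeBound (w - 1) k).2 + 100) →
      ((∃ p, NodeOk f w M k p ∧ Hits f w M p.chosen.toFinset ∧
          s'.out = s.out ++ outWord (s.a .D1) (s.a .D2) p) ∨
        (s'.out = s.out ++ [0] ∧ ¬ ∃ H : Finset ℕ, 0 ∉ H ∧ Hits f w M H ∧ H.card ≤ k)) →
      Q s') :
    Tr (search w) s Q := by
  unfold search
  with_reducible refine Tr_seq (Tr_set (Tr_seq (Tr_set (Tr_seq (Tr_set (Tr_seq (Tr_set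
    (Tr_seq ?_))))))))
  set body : Com := .seq (process w) _ with hbody
  set R := processTime w M k + 100 with hR
  set B := s.tm + (R * (nodeBound (w - 1) k).2 + 20) with hB
  refine Tr_while (fun s' => Frame body s s' ∧
    ((s'.v .found = 0 ∧ s'.out = s.out ∧ ∃ L, Queue s'.a (s'.v .cur) (s'.v .free) L ∧
        (s'.v .go = 0 ↔ L = []) ∧ (∀ e, s'.a .CH e ≤ s'.v .cur) ∧ (∀ e, s'.a .EX e ≤ s'.v .cur) ∧
        (∀ p ∈ L, NodeOk f w M k p) ∧
        ((∃ H : Finset ℕ, 0 ∉ H ∧ Hits f w M H ∧ H.card ≤ k) →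
          ∃ p ∈ L, ∃ H, Good f w M k p H) ∧
        s'.tm + R * (L.map (weight f w M k)).sum ≤ B) ∨
      (s'.v .found = 1 ∧ s'.v .go = 0 ∧ s'.tm ≤ B ∧ ∃ p, NodeOk f w M k p ∧
        Hits f w M p.chosen.toFinset ∧
        s'.out = s.out ++ outWord (s.a .D1) (s.a .D2) p))) B ?_ ?_ ?_ ?_
  · rintro s' ⟨-, ⟨-, -, L, -, -, -, -, -, -, h⟩ | ⟨-, -, h, -⟩⟩ <;> omega
  · rintro s1 ⟨hF, ⟨hf, ho, L, hQ, hgo, hc, he, hok, hgood, ht⟩ | ⟨-, hgo, -⟩⟩ h0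
    swap
    · exact absurd hgo h0
    cases L with
    | nil => exact absurd (hgo.2 rfl) h0
    | cons p L =>
      have hF1 : Frame body s1 (s1.tick ((Expr.var Var.go : Expr Var Arr).cost + 1)) :=
        ⟨fun _ _ => rfl, fun _ _ => rfl, fun _ => rfl, fun _ => rfl⟩
      suffices hmain : Tr body (s1.tick ((Expr.var Var.go : Expr Var Arr).cost + 1)) fun s' =>
          ((s'.v .found = 0 ∧ s'.out = s.out ∧ ∃ L, Queue s'.a (s'.v .cur) (s'.v .free) L ∧
            (s'.v .go = 0 ↔ L = []) ∧ (∀ e, s'.a .CH e ≤ s'.v .cur) ∧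
            (∀ e, s'.a .EX e ≤ s'.v .cur) ∧ (∀ p ∈ L, NodeOk f w M k p) ∧
            ((∃ H : Finset ℕ, 0 ∉ H ∧ Hits f w M H ∧ H.card ≤ k) →
              ∃ p ∈ L, ∃ H, Good f w M k p H) ∧
            s'.tm + R * (L.map (weight f w M k)).sum ≤ B) ∨
          (s'.v .found = 1 ∧ s'.v .go = 0 ∧ s'.tm ≤ B ∧ ∃ p, NodeOk f w M k p ∧
            Hits f w M p.chosen.toFinset ∧
            s'.out = s.out ++ outWord (s.a .D1) (s.a .D2) p)) from
        hmain.frame.mono fun s' ⟨h1, h2⟩ => ⟨hF.trans (hF1.trans h2), h1⟩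
      have hcut1 : s1.a .CUT = f := (hF.a _ rfl).trans hcut
      have hM1 : s1.v .M = M := (hF.v _ rfl).trans hM
      have hk1 : s1.v .k = k := (hF.v _ rfl).trans hk
      have hD1 : s1.a .D1 = s.a .D1 := hF.a _ rfl
      have hD2 : s1.a .D2 = s.a .D2 := hF.a _ rfl
      rw [hbody]
      refine Tr_seq (process_spec (p := p) (L := L) hw (by simpa using hcut1) (by simpa using hM1)
        (by simpa using hk1) (by simpa using hc) (by simpa using he) (by simpa using hQ)
        (hok p (by simp)) fun s2 hF2 hc2 he2 ht2 hcase => ?_)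
      have c2 : s2.v .cur = s1.v .cur := by simpa using hF2.v .cur rfl
      simp only [St.tick_v, St.tick_a, St.tick_out, St.tick_tm, Expr.cost, hD1, hD2]
        at hc2 he2 ht2 hcase
      have hsum : R * (List.map (weight f w M k) (p :: L)).sum =
          R * weight f w M k p + R * (L.map (weight f w M k)).sum := by
        rw [List.map_cons, List.sum_cons, mul_add]
      rw [hsum] at ht
      with_reducible refine Tr_seq (Tr_set (Tr_set ?_))
      rcases hcase with ⟨hf2, ho2, hh2⟩ | ⟨hf2, ho2, ch, hch2, hQ2⟩
      · have hw1 := Nat.mul_le_mul_left R (one_le_weight (f := f) (w := w) (M := M) k p)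
        refine .inr ⟨by simpa using hf2, by simp [Expr.eval, hf2], ?_, p, hok p (by simp), hh2, ?_⟩
        · simp [Expr.cost]
          omega
        · simp [ho2, ho]
      · have hw1 := Nat.mul_le_mul_left R hch2.weight
        rw [mul_add] at hw1
        have hQ3 := Queue.tail (L := L ++ ch) hQ2
        have hfree := hQ3.free
        rw [List.length_append] at hfree
        refine .inl ⟨by simpa [hf] using hf2, by simpa [ho] using ho2, L ++ ch, ?_, ?_, ?_, ?_, ?_,
          ?_, ?_⟩
        · simpa [Expr.eval] using hQ3
        · simp only [Expr.eval, St.tick_v, St.setv_v, reduceCtorEq, if_false, if_true, hf2, hf]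
          rw [List.append_eq_nil_iff, ← List.length_eq_zero_iff, ← List.length_eq_zero_iff]
          omega
        · simpa [Expr.eval, c2] using hc2
        · simpa [Expr.eval, c2] using he2
        · intro q hq
          rcases List.mem_append.1 hq with hq | hq
          · exact hok q (by simp [hq])
          · exact hch2.ok q hq
        · intro hH
          obtain ⟨q, hq, H, hH⟩ := hgood hH
          rcases List.mem_cons.1 hq with rfl | hq
          · obtain ⟨c, hc, hH'⟩ := hch2.good H hH
            exact ⟨c, List.mem_append_right _ hc, hH'⟩
          · exact ⟨q, List.mem_append_left _ hq, H, hH⟩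
        · rw [List.map_append, List.sum_append, mul_add]
          simp [Expr.cost]
          omega
  · rintro s1 ⟨-, ⟨hf, ho, L, hQ, hgo, -, -, -, hgood, ht⟩ | ⟨hf, hgo, ht, hres⟩⟩ h0
    · refine Tr_ite (fun h1 => absurd hf h1) fun _ => Tr_pr (h _ ?_ (.inr ⟨?_, fun hH => ?_⟩))
      · simp [Expr.cost]
        omega
      · simp [Expr.eval, ho]
      · obtain ⟨q, hq, -⟩ := hgood hH
        rw [hgo.1 h0] at hq
        simp at hq
    · refine Tr_ite (fun _ => Tr_skip (h _ ?_ (.inl hres))) fun h1 => ?_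
      · simp [Expr.cost]
        omega
      · simp [Expr.eval, hf] at h1
  · -- The queue starts with the root, and every hitting set is in its subtree.
    refine ⟨⟨fun v hx => ?_, fun _ _ => rfl, fun _ => rfl, fun _ => rfl⟩, .inl ⟨by simp [Expr.eval],
      rfl, [[]], ⟨by simp [Expr.eval], fun i hi => ?_⟩, by simp [Expr.eval], ?_, ?_, ?_, ?_, ?_⟩⟩
    · simp only [St.tick_v, St.setv_v]
      rw [if_neg, if_neg, if_neg, if_neg] <;> rintro rfl <;>
        exact absurd (show true = false from hx) (by decide)
    · obtain rfl : i = 0 := by simpa using hi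
      simpa [IsPath, Expr.eval] using hdep
    · simp [hch]
    · simp [hex]
    · intro p hp
      obtain rfl : p = [] := by simpa using hp
      exact ⟨by simp [chosen], by simp [chosen], by simp⟩
    · rintro ⟨H, h1, h2, h3⟩
      exact ⟨[], by simp, H, by simp [chosen], by simpa [excl] using h1, h2, h3⟩
    · have := Nat.mul_le_mul_left R (weight_le (f := f) (w := w) (M := M) k [])
      simp only [List.length_nil, Nat.sub_zero] at this
      simp [Expr.cost]
      omega

end TCO

/-! ### Reading the input -/

namespace TCO

section Programs

open Var Arr TCO.Expr Cmd

/-- Table of the powers of two. -/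
def powers : Com :=
  .seq (set b (lit 1)) <|
  Cmd.for i (var n) <| .seq (put PW (var i) (var b)) (set b (add (var b) (var b)))

/-- `K := (2 k + 1) ^ d`, by repeated addition. -/
def capacity (d : ℕ) : Com :=
  .seq (set K (lit 1)) <|
  Cmd.for i (lit d) <|
    .seq (set b (lit 0)) <|
    .seq (Cmd.for j (add (add (var k) (var k)) (lit 1)) (set b (add (var b) (var K))))
      (set K (var b))

/-- Write the list `l` into the array `a`, from the index `o` on. -/
def table (a : Arr) : List ℕ → ℕ → Com
  | [], _ => skip
  | val :: l, o => .seq (put a (lit o) (lit val)) (table a l (o + 1))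

/-- Read the next topic. The array `B` gets its users, with repetitions of the last one to fill it
up to length `d`; `sum` gets the sum of the powers `2 ^ u` over the users `u`. -/
def readTopic (d : ℕ) : Com :=
  .seq (rd Var.s) <| .seq (set sum (lit 0)) <| .seq (set u (lit 0)) <|
  Cmd.for i (lit d) <|
    .seq (ite (sub (var Var.s) (var i))
      (.seq (rd u) (set sum (add (var sum) (get PW (var u))))) skip)
      (put B (var i) (var u))

/-- Append `l` slots, for the pairs of users in `B` whose indices are in the arrays `SI`, `SJ`. -/
def emit (l : ℕ) : Com :=
  Cmd.for i (lit l) <|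
    .seq (set x (get B (get SI (var i)))) <|
    .seq (set y (get B (get SJ (var i)))) <|
    .seq (set e (cond (ne (var x) (var y)) (add (get PW (var x)) (get PW (var y))) (lit 0))) <|
    .seq (put CUT (var wp) (var e)) <|
    .seq (put D1 (var e) (var x)) <|
    .seq (put D2 (var e) (var y))
      (set wp (add (var wp) (lit 1)))

/-- Treat the next topic; if it has two users and is new, append `l` slots, in `q` blocks. The mark
for a set of users is kept in the entry of `SEEN` at the sum of their powers of two. -/
def topicStep (d l q : ℕ) : Com :=
  .seq (readTopic d) <|
  .seq (ite (cond (get SEEN (var sum)) (lit 0) (sub (var Var.s) (lit 1)))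
    (.seq (put SEEN (var sum) (lit 1)) <| .seq (set N (add (var N) (lit 1))) <|
      .seq (set M (add (var M) (lit q))) (emit l)) skip) <|
  .seq (set t (add (var t) (lit 1)))
    (set go (cond (sub (var N) (var K)) (lit 0) (sub (var m) (var t))))

/-- Read the topics, until there are more than `K` different ones with two users. -/
def readAll (d l q : ℕ) : Com :=
  .seq (set t (lit 0)) <| .seq (set N (lit 0)) <| .seq (set M (lit 0)) <|
  .seq (set wp (lit 0)) <| .seq (set go (var m)) <|
  .while (var go) (topicStep d l q)

end Programs

theorem powers_spec {s : Sta} {Q : Sta → Prop}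
    (h : ∀ s', Frame powers s s' → (∀ i < s.v .n, s'.a .PW i = 2 ^ i) →
      s'.tm ≤ s.tm + (s.v .n * 100 + 100) → Q s') : Tr powers s Q := by
  have : Tr powers s fun s' => (∀ i < s.v .n, s'.a .PW i = 2 ^ i) ∧
      s'.tm ≤ s.tm + (s.v .n * 100 + 100) := by
    unfold powers
    with_reducible refine Tr_seq (Tr_set ?_)
    refine Tr_for (s.v .n) 50 (fun l s' => s'.v .b = 2 ^ l ∧ ∀ i < l, s'.a .PW i = 2 ^ i) rfl
      (fun s' hF => ?_) (fun _ _ _ h => h) ?_ ?_ ?_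
    · simpa [Expr.eval] using hF.v .n rfl
    · simp [Expr.eval]
    · rintro l s' hl hc hF ⟨i1, i2⟩
      with_reducible refine Tr_seq (Tr_put (Tr_set ⟨?_, ?_, fun i hi => ?_⟩))
      · simp [Expr.cost]
      · simp [Expr.eval, i1, pow_succ]; ring
      · simp only [Expr.eval, St.tick_v, St.tick_a, St.setv_a, St.seta_a, if_true, hc, i1,
          Function.update_apply]
        split_ifs with h1
        · rw [h1]
        · exact i2 i (by omega)
    · rintro s' - - ⟨-, i2⟩ ht
      refine ⟨i2, ?_⟩
      simp [Expr.cost] at ht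
      omega
  exact this.frame.mono fun s' ⟨⟨h1, h2⟩, hF⟩ => h s' hF h1 h2

theorem capacity_spec {s : Sta} {Q : Sta → Prop} {d : ℕ}
    (h : ∀ s', Frame (capacity d) s s' → s'.v .K = (2 * s.v .k + 1) ^ d →
      s'.tm ≤ s.tm + (d * ((2 * s.v .k + 1) * 40 + 100) + 100) → Q s') : Tr (capacity d) s Q := by
  have : Tr (capacity d) s fun s' => s'.v .K = (2 * s.v .k + 1) ^ d ∧
      s'.tm ≤ s.tm + (d * ((2 * s.v .k + 1) * 40 + 100) + 100) := by
    unfold capacity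
    with_reducible refine Tr_seq (Tr_set ?_)
    refine Tr_for d ((2 * s.v .k + 1) * 40 + 80) (fun l s' => s'.v .K = (2 * s.v .k + 1) ^ l) rfl
      (fun s' hF => rfl) (fun _ _ _ h => h) ?_ ?_ ?_
    · simp [Expr.eval]
    · rintro l s' hl hc hF i1
      have f1 : s'.v .k = s.v .k := by simpa using hF.v .k rfl
      with_reducible refine Tr_seq (Tr_set (Tr_seq ?_))
      refine Tr_for (2 * s.v .k + 1) 10 (fun l' s'' => s''.v .b = l' * (2 * s.v .k + 1) ^ l) rfl
        (fun s'' hF' => ?_) (fun _ _ _ h => h) ?_ ?_ ?_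
      · have : s''.v .k = s.v .k := by simpa [f1] using hF'.v .k rfl
        simp only [Expr.eval, this]
        omega
      · simp [Expr.eval]
      · intro l' s'' hl' hc' hF' j1
        have : s''.v .K = (2 * s.v .k + 1) ^ l := by simpa [i1] using hF'.v .K rfl
        refine Tr_set ⟨by simp [Expr.cost], ?_⟩
        simp [Expr.eval, j1, this]
        ring
      · rintro s'' - hF' j1 ht
        refine Tr_set ⟨?_, ?_⟩
        · simp [Expr.cost] at ht ⊢
          omega
        · simp [Expr.eval, j1, pow_succ]
          ring
    · rintro s' - - i1 ht
      refine ⟨i1, ?_⟩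
      simp [Expr.cost] at ht
      have : d * ((2 * s.v .k + 1) * 40 + 100) = d * ((2 * s.v .k + 1) * 40 + 80 + 1 + 10) +
        d * 9 := by ring
      omega
  exact this.frame.mono fun s' ⟨⟨h1, h2⟩, hF⟩ => h s' hF h1 h2

theorem table_spec {a : Arr} {l : List ℕ} {o : ℕ} {s : Sta} {Q : Sta → Prop}
    (h : ∀ s' : Sta, s'.v = s.v → s'.inp = s.inp → s'.out = s.out → (∀ b, b ≠ a → s'.a b = s.a b) →
      (∀ i < o, s'.a a i = s.a a i) → (∀ i (h : i < l.length), s'.a a (o + i) = l[i]) →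
      s'.tm ≤ s.tm + (l.length * 10 + 1) → Q s') : Tr (table a l o) s Q := by
  induction l generalizing o s Q with
  | nil => exact Tr_skip (h _ rfl rfl rfl (fun _ _ => rfl) (fun _ _ => rfl) (by simp) (by simp))
  | cons x l ih =>
    unfold table
    refine Tr_seq (Tr_put (ih fun s' h1 h2 h3 h4 h5 h6 h7 => h s' ?_ ?_ ?_ ?_ ?_ ?_ ?_))
    · simpa using h1
    · simpa using h2
    · simpa using h3
    · intro b hb
      simpa [hb] using h4 b hb
    · intro i hi
      have := h5 i (by omega)
      simpa [Expr.eval, hi.ne] using this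
    · intro i hi
      cases i with
      | zero => simpa [Expr.eval] using h5 o (by omega)
      | succ i =>
        have := h6 i (by simpa using hi)
        rw [Nat.add_assoc, Nat.add_comm 1] at this
        simpa using this
    · simp [Expr.cost] at h7 ⊢
      omega

theorem readTopic_spec {d : ℕ} {l rest : List ℕ} {s : Sta} {Q : Sta → Prop} (hd : l.length ≤ d)
    (hinp : s.inp = l.length :: (l ++ rest)) (hPW : ∀ u ∈ l, s.a .PW u = 2 ^ u)
    (h : ∀ s', Frame (readTopic d) s s' → s'.inp = rest → s'.v .s = l.length →
      s'.v .sum = (l.map (2 ^ ·)).sum →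
      (l ≠ [] → (∀ i < d, s'.a .B i ∈ l) ∧ ∀ u ∈ l, ∃ i < d, s'.a .B i = u) →
      s'.tm ≤ s.tm + (d * 100 + 100) → Q s') : Tr (readTopic d) s Q := by
  have : Tr (readTopic d) s fun s' => s'.inp = rest ∧ s'.v .s = l.length ∧
      s'.v .sum = (l.map (2 ^ ·)).sum ∧
      (l ≠ [] → (∀ i < d, s'.a .B i ∈ l) ∧ ∀ u ∈ l, ∃ i < d, s'.a .B i = u) ∧
      s'.tm ≤ s.tm + (d * 100 + 100) := by
    unfold readTopic
    with_reducible refine Tr_seq (Tr_rd (Tr_seq (Tr_set (Tr_seq (Tr_set ?_)))))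
    refine Tr_for d 60 (fun j s' => s'.inp = l.drop j ++ rest ∧
      s'.v .sum = ((l.take j).map (2 ^ ·)).sum ∧
      (∀ i (h : i < l.length), i < j → s'.a .B i = l[i]) ∧
      (l ≠ [] → (∀ i < j, s'.a .B i ∈ l) ∧ (0 < j → s'.v .u ∈ l))) rfl
      (fun s' hF => rfl) (fun _ _ _ h => h) ?_ ?_ ?_
    · simp [Expr.eval, hinp]
    · rintro j s' hj hc hF ⟨i1, i2, i3, i4⟩
      have f1 : s'.v .s = l.length := by simpa [hinp] using hF.v .s rfl
      have f2 : s'.a .PW = s.a .PW := by simpa using hF.a .PW rfl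
      with_reducible refine Tr_seq (Tr_ite (fun h0 => ?_) fun h0 => ?_)
      · have hjl : j < l.length := by
          simp only [Expr.eval, f1, hc] at h0
          omega
        have hne : l ≠ [] := List.ne_nil_of_length_pos (by omega)
        rw [List.drop_eq_getElem_cons hjl, List.cons_append] at i1
        with_reducible refine Tr_seq (Tr_rd (Tr_set (Tr_put ⟨?_, ?_⟩)))
        · simp [Expr.cost]
        · simp only [Expr.eval, St.tick_a, St.tick_v, St.setv_v, St.setv_a, St.seta_v, St.seta_a,
            St.setinp_v, St.setinp_a, St.setinp_inp, St.tick_inp, St.setv_inp, St.seta_inp,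
            reduceCtorEq, if_false, if_true, f2, hc, i1, List.tail_cons, List.headD_cons,
            Function.update_apply, hPW _ (List.getElem_mem hjl)]
          refine ⟨trivial, ?_, fun i hi hij => ?_, fun _ => ⟨fun i hi => ?_, fun _ => ?_⟩⟩
          · rw [List.take_succ_eq_append_getElem hjl, i2, List.map_append, List.sum_append]
            simp
          · split_ifs with h1
            · subst h1; rfl
            · exact i3 i hi (by omega)
          · split_ifs with h1
            · exact List.getElem_mem hjl
            · exact (i4 hne).1 i (by omega)
          · exact List.getElem_mem hjl
      · have hjl : l.length ≤ j := by
          simp only [Expr.eval, f1, hc] at h0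
          omega
        with_reducible refine Tr_skip (Tr_put ⟨?_, ?_⟩)
        · simp [Expr.cost]
        · simp only [Expr.eval, St.tick_a, St.tick_v, St.setv_v, St.setv_a, St.seta_v, St.seta_a,
            St.tick_inp, St.setv_inp, St.seta_inp,
            reduceCtorEq, if_false, if_true, hc, i1, i2, Function.update_apply]
          refine ⟨?_, ?_, fun i hi hij => ?_, fun hne => ?_⟩
          · rw [List.drop_eq_nil_of_le hjl, List.drop_eq_nil_of_le (by omega)]
          · rw [List.take_of_length_le hjl, List.take_of_length_le (by omega)]
          · rw [if_neg (by omega)]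
            exact i3 i hi (by omega)
          · have hu := (i4 hne).2 (by have := List.length_pos_of_ne_nil hne; omega)
            refine ⟨fun i hi => ?_, fun _ => hu⟩
            split_ifs with h1
            · exact hu
            · exact (i4 hne).1 i (by omega)
    · rintro s' - hF ⟨i1, i2, i3, i4⟩ ht
      have f1 : s'.v .s = l.length := by simpa [hinp] using hF.v .s rfl
      rw [List.drop_eq_nil_of_le hd] at i1
      rw [List.take_of_length_le hd] at i2
      refine ⟨i1, f1, i2, fun hne => ⟨(i4 hne).1, fun u hu => ?_⟩, ?_⟩
      · obtain ⟨i, hi, rfl⟩ := List.getElem_of_mem hu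
        exact ⟨i, by omega, i3 i hi (by omega)⟩
      · simp [Expr.cost] at ht
        omega
  exact this.frame.mono fun s' ⟨⟨h1, h2, h3, h4, h5⟩, hF⟩ => h s' hF h1 h2 h3 h4 h5

/-- The element for the pair of users with the indices `q` in the list `B`: the number
`2 ^ u + 2 ^ v` for two different users `u`, `v`, and `0` if they are equal. -/
def slotVal (B : ℕ → ℕ) (q : ℕ × ℕ) : ℕ := if B q.1 = B q.2 then 0 else 2 ^ B q.1 + 2 ^ B q.2

/-- The arrays `d1` and `d2` hold the two users below `n` for the element `e`. -/
def Decodes (n : ℕ) (d1 d2 : ℕ → ℕ) (e : ℕ) : Prop :=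
  d1 e < n ∧ d2 e < n ∧ d1 e ≠ d2 e ∧ e = 2 ^ d1 e + 2 ^ d2 e

theorem emit_spec {n : ℕ} {L : List (ℕ × ℕ)} {s : Sta} {Q : Sta → Prop}
    (hPW : ∀ u < n, s.a .PW u = 2 ^ u)
    (hI : ∀ i (h : i < L.length), s.a .SI i = L[i].1)
    (hJ : ∀ i (h : i < L.length), s.a .SJ i = L[i].2)
    (hB : ∀ q ∈ L, s.a .B q.1 < n ∧ s.a .B q.2 < n)
    (h : ∀ s', Frame (emit L.length) s s' → s'.v .wp = s.v .wp + L.length →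
      seg (s'.a .CUT) (s.v .wp) L.length = L.map (slotVal (s.a .B)) →
      (∀ i < s.v .wp, s'.a .CUT i = s.a .CUT i) →
      (∀ e, e ≠ 0 → (Decodes n (s.a .D1) (s.a .D2) e ∨ e ∈ L.map (slotVal (s.a .B))) →
        Decodes n (s'.a .D1) (s'.a .D2) e) →
      s'.tm ≤ s.tm + (L.length * 200 + 100) → Q s') : Tr (emit L.length) s Q := by
  have : Tr (emit L.length) s fun s' => s'.v .wp = s.v .wp + L.length ∧
      seg (s'.a .CUT) (s.v .wp) L.length = L.map (slotVal (s.a .B)) ∧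
      (∀ i < s.v .wp, s'.a .CUT i = s.a .CUT i) ∧
      (∀ e, e ≠ 0 → (Decodes n (s.a .D1) (s.a .D2) e ∨ e ∈ L.map (slotVal (s.a .B))) →
        Decodes n (s'.a .D1) (s'.a .D2) e) ∧
      s'.tm ≤ s.tm + (L.length * 200 + 100) := by
    unfold emit
    refine Tr_for L.length 150 (fun l s' => s'.v .wp = s.v .wp + l ∧
      seg (s'.a .CUT) (s.v .wp) l = (L.take l).map (slotVal (s.a .B)) ∧
      (∀ i < s.v .wp, s'.a .CUT i = s.a .CUT i) ∧
      (∀ e, e ≠ 0 → (Decodes n (s.a .D1) (s.a .D2) e ∨ e ∈ (L.take l).map (slotVal (s.a .B))) →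
        Decodes n (s'.a .D1) (s'.a .D2) e)) rfl
      (fun s' hF => rfl) (fun _ _ _ h => h) ?_ ?_ ?_
    · simp [seg]
    · rintro l s' hl hc hF ⟨i1, i2, i3, i4⟩
      have f1 : s'.a .PW = s.a .PW := hF.a .PW rfl
      have f2 : s'.a .SI = s.a .SI := hF.a .SI rfl
      have f3 : s'.a .SJ = s.a .SJ := hF.a .SJ rfl
      have f4 : s'.a .B = s.a .B := hF.a .B rfl
      obtain ⟨b1, b2⟩ := hB L[l] (List.getElem_mem hl)
      have hval : (if s.a .B L[l].1 = s.a .B L[l].2 then 0 else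
          s.a .PW (s.a .B L[l].1) + s.a .PW (s.a .B L[l].2)) = slotVal (s.a .B) L[l] := by
        rw [slotVal, hPW _ b1, hPW _ b2]
      with_reducible refine Tr_seq (Tr_set (Tr_seq (Tr_set (Tr_seq (Tr_set (Tr_seq (Tr_put (Tr_seq
        (Tr_put (Tr_seq (Tr_put (Tr_set ⟨?_, ?_⟩))))))))))))
      · simp [Expr.cost, Expr.ne]
      · simp only [Expr.eval, St.tick_a, St.tick_v, St.setv_v, St.setv_a, St.seta_v, St.seta_a,
          reduceCtorEq, if_false, if_true, f1, f2, f3, f4, hc, hI l hl, hJ l hl,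
          Expr.eval_ne_eq_zero, hval, i1]
        refine ⟨by ring, ?_, fun i hi => ?_, fun e he hor => ?_⟩
        · rw [seg_succ, List.take_succ_eq_append_getElem hl, List.map_append, ← i2]
          congr 1
          · exact seg_congr fun i hi => by simp [hi.ne]
          · simp
        · rw [Function.update_of_ne (by omega)]
          exact i3 i hi
        · by_cases h1 : e = slotVal (s.a .B) L[l]
          · subst h1
            simp only [Decodes, Function.update_self]
            have hne : s.a .B L[l].1 ≠ s.a .B L[l].2 := fun h => he (by simp [slotVal, h])
            exact ⟨b1, b2, hne, by simp [slotVal, hne]⟩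
          · rw [List.take_succ_eq_append_getElem hl] at hor
            simp only [List.map_append, List.mem_append, List.map_cons, List.map_nil,
              List.mem_singleton, h1, or_false] at hor
            have := i4 e he hor
            simpa [Decodes, h1] using this
    · rintro s' - hF ⟨i1, i2, i3, i4⟩ ht
      rw [List.take_length] at i2 i4
      refine ⟨i1, i2, i3, i4, ?_⟩
      simp [Expr.cost] at ht
      omega
  exact this.frame.mono fun s' ⟨⟨h1, h2, h3, h4, h5⟩, hF⟩ => h s' hF h1 h2 h3 h4 h5

end TCO

/-! ### Cuts of topics as blocks -/

namespace TCO

/-- The edge set with the element set `H`, where the edge `{u, v}` is the element `2 ^ u + 2 ^ v`,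
connects the users in `U`: every cut of `U` is crossed. -/
def Crosses (H U : Finset ℕ) : Prop :=
  ∀ A ⊆ U, A.Nonempty → A ≠ U → ∃ u ∈ A, ∃ v ∈ U \ A, 2 ^ u + 2 ^ v ∈ H

/-- The nonempty proper subsets of the indices below `d`. -/
noncomputable def masks (d : ℕ) : List (Finset ℕ) :=
  ((Finset.range d).powerset.filter fun A => A.Nonempty ∧ A ≠ Finset.range d).toList

theorem mem_masks {d : ℕ} {A : Finset ℕ} :
    A ∈ masks d ↔ A ⊆ Finset.range d ∧ A.Nonempty ∧ A ≠ Finset.range d := by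
  simp [masks]

/-- The pairs of indices that belong to the cut of the mask `A`, filled up to `w` pairs by the
pair `(0, 0)`, which stands for an unused slot. -/
noncomputable def maskBlock (d w : ℕ) (A : Finset ℕ) : List (ℕ × ℕ) :=
  (A ×ˢ (Finset.range d \ A)).toList ++
    List.replicate (w - (A ×ˢ (Finset.range d \ A)).card) (0, 0)

/-- The pairs of indices for all the cuts. -/
noncomputable def slots (d w : ℕ) : List (ℕ × ℕ) := (masks d).flatMap (maskBlock d w)

/-- The number of edges across a cut is largest if the cut is balanced. -/
theorem cut_card_le (d a : ℕ) : a * (d - a) ≤ d / 2 * ((d + 1) / 2) := by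
  rcases le_total a d with h | h
  · obtain ⟨b, rfl⟩ := Nat.exists_eq_add_of_le h
    rw [Nat.add_sub_cancel_left]
    obtain ⟨c, hc⟩ := Nat.even_or_odd' (a + b)
    rcases hc with hc | hc
    · have e1 : (a + b) / 2 = c := by omega
      have e2 : (a + b + 1) / 2 = c := by omega
      rw [e1, e2]
      zify at hc ⊢
      nlinarith [sq_nonneg ((a : ℤ) - b)]
    · have e1 : (a + b) / 2 = c := by omega
      have e2 : (a + b + 1) / 2 = c + 1 := by omega
      rw [e1, e2]
      obtain h1 | h1 : a + 1 ≤ b ∨ b + 1 ≤ a := by omega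
      · obtain ⟨e, rfl⟩ := Nat.exists_eq_add_of_le h1
        obtain rfl : c = a + e.div2 := by rw [Nat.div2_val]; omega
        obtain ⟨g, rfl⟩ : ∃ g, e = 2 * g := ⟨e / 2, by omega⟩
        have : (2 * g).div2 = g := by rw [Nat.div2_val]; omega
        rw [this]
        nlinarith [Nat.zero_le (g * g)]
      · obtain ⟨e, rfl⟩ := Nat.exists_eq_add_of_le h1
        obtain rfl : c = b + e.div2 := by rw [Nat.div2_val]; omega
        obtain ⟨g, rfl⟩ : ∃ g, e = 2 * g := ⟨e / 2, by omega⟩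
        have : (2 * g).div2 = g := by rw [Nat.div2_val]; omega
        rw [this]
        nlinarith [Nat.zero_le (g * g)]
  · rw [Nat.sub_eq_zero_of_le h]
    simp

theorem length_maskBlock {d w : ℕ} (hw : d / 2 * ((d + 1) / 2) ≤ w) {A : Finset ℕ}
    (hA : A ∈ masks d) : (maskBlock d w A).length = w := by
  have h1 : (A ×ˢ (Finset.range d \ A)).card ≤ w := by
    rw [Finset.card_product, Finset.card_sdiff_of_subset (mem_masks.1 hA).1, Finset.card_range]
    exact (cut_card_le d _).trans hw
  simp only [maskBlock, List.length_append, Finset.length_toList, List.length_replicate]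
  omega

theorem mem_maskBlock {d w : ℕ} {A : Finset ℕ} {q : ℕ × ℕ} (h : q ∈ maskBlock d w A) :
    (q.1 ∈ A ∧ q.2 ∈ Finset.range d \ A) ∨ q = (0, 0) := by
  rcases List.mem_append.1 h with h | h
  · left; simpa using h
  · exact .inr (List.eq_of_mem_replicate h)

theorem lt_of_mem_slots {d w : ℕ} (hd : 1 ≤ d) {q : ℕ × ℕ} (h : q ∈ slots d w) :
    q.1 < d ∧ q.2 < d := by
  obtain ⟨A, hA, hq⟩ := List.mem_flatMap.1 h
  rcases mem_maskBlock hq with h | rfl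
  · exact ⟨Finset.mem_range.1 ((mem_masks.1 hA).1 h.1), by simpa using (Finset.mem_sdiff.1 h.2).1⟩
  · exact ⟨hd, hd⟩

theorem slotVal_of_ne {B : ℕ → ℕ} {i j : ℕ} (h : B i ≠ B j) :
    slotVal B (i, j) = 2 ^ B i + 2 ^ B j := by simp [slotVal, h]

section Cuts

variable {d w : ℕ} {B : ℕ → ℕ} {U H : Finset ℕ}

/-- If the blocks of all the masks are hit, then so are all cuts. The list `B` may name a user
several times; the cut given by `A'` is that of the mask of all indices of users in `A'`. -/
theorem crosses_of_hit (hB2 : ∀ u ∈ U, ∃ i < d, B i = u) (h0 : 0 ∉ H)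
    (hB1 : ∀ i < d, B i ∈ U)
    (h : ∀ A ∈ masks d, ∃ e ∈ (maskBlock d w A).map (slotVal B), e ∈ H) : Crosses H U := by
  intro A' hA' hne hne'
  have hss : ∃ v ∈ U, v ∉ A' := by
    by_contra hc
    push Not at hc
    exact hne' (Finset.Subset.antisymm hA' hc)
  obtain ⟨v, hv, hvA⟩ := hss
  obtain ⟨u, hu⟩ := hne
  obtain ⟨i, hi, rfl⟩ := hB2 u (hA' hu)
  obtain ⟨j, hj, rfl⟩ := hB2 v hv
  have hmask : (Finset.range d).filter (fun i => B i ∈ A') ∈ masks d := by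
    refine mem_masks.2 ⟨Finset.filter_subset _ _, ⟨i, by simp [hi, hu]⟩, fun h => hvA ?_⟩
    have : j ∈ Finset.range d := by simpa using hj
    rw [← h] at this
    exact (Finset.mem_filter.1 this).2
  obtain ⟨e, he, heH⟩ := h _ hmask
  obtain ⟨⟨i', j'⟩, hq, rfl⟩ := List.mem_map.1 he
  rcases mem_maskBlock hq with ⟨h1, h2⟩ | h1
  · simp only [Finset.mem_filter, Finset.mem_range, Finset.mem_sdiff, not_and] at h1 h2
    have hj' := h2.2 h2.1
    have hij : B i' ≠ B j' := fun h => hj' (h ▸ h1.2)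
    rw [slotVal_of_ne hij] at heH
    exact ⟨_, h1.2, _, Finset.mem_sdiff.2 ⟨hB1 _ h2.1, hj'⟩, heH⟩
  · rw [h1] at heH
    exact absurd (by simpa [slotVal] using heH) h0

/-- Two sets that cover `U` are joined by an edge, even if they overlap. -/
theorem Crosses.exists_edge (h : Crosses H U) {a b : Finset ℕ} (hab : a ∪ b = U)
    (ha : a.Nonempty) (hb : b.Nonempty) (hU : 2 ≤ U.card) :
    ∃ u ∈ a, ∃ v ∈ b, u ≠ v ∧ 2 ^ u + 2 ^ v ∈ H := by
  have haU : a ⊆ U := hab ▸ Finset.subset_union_left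
  have hbU : b ⊆ U := hab ▸ Finset.subset_union_right
  by_cases h1 : a = U
  · by_cases h2 : b = U
    · obtain ⟨u, hu⟩ := ha
      obtain ⟨u', hu', v, hv, huv⟩ := h {u} (by simpa using haU hu) ⟨u, by simp⟩ (fun h => by
        rw [← h] at hU
        simp at hU)
      obtain rfl : u' = u := by simpa using hu'
      obtain ⟨hv1, hv2⟩ := Finset.mem_sdiff.1 hv
      exact ⟨u', hu, v, h2 ▸ hv1, fun h => hv2 (by simp [h]), huv⟩
    · obtain ⟨u, hu, v, hv, huv⟩ := h b hbU hb h2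
      obtain ⟨hv1, hv2⟩ := Finset.mem_sdiff.1 hv
      exact ⟨v, h1 ▸ hv1, u, hu, fun h => hv2 (h ▸ hu), by rwa [add_comm]⟩
  · obtain ⟨u, hu, v, hv, huv⟩ := h a haU ha h1
    obtain ⟨hv1, hv2⟩ := Finset.mem_sdiff.1 hv
    refine ⟨u, hu, v, ?_, fun h => hv2 (h ▸ hu), huv⟩
    rw [← hab, Finset.mem_union] at hv1
    exact hv1.resolve_left hv2

/-- Every mask has a hit block, even if it separates indices of the same user: the edges that join
`B '' A` and `B '' Aᶜ` suffice, although these sets may overlap. -/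
theorem Crosses.hit (h : Crosses H U) (hB1 : ∀ i < d, B i ∈ U)
    (hB2 : ∀ u ∈ U, ∃ i < d, B i = u) (hU : 2 ≤ U.card) {A : Finset ℕ} (hA : A ∈ masks d) :
    ∃ e ∈ (maskBlock d w A).map (slotVal B), e ∈ H := by
  obtain ⟨hA1, hA2, hA3⟩ := mem_masks.1 hA
  have hne : (Finset.range d \ A).Nonempty := by
    rw [Finset.sdiff_nonempty]
    exact fun h => hA3 (Finset.Subset.antisymm hA1 h)
  have hun : A.image B ∪ (Finset.range d \ A).image B = U := by
    rw [← Finset.image_union, Finset.union_sdiff_of_subset hA1]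
    ext u
    simp only [Finset.mem_image, Finset.mem_range]
    exact ⟨fun ⟨i, hi, h⟩ => h ▸ hB1 i hi, fun hu => hB2 u hu⟩
  obtain ⟨u, hu, v, hv, huv, hH⟩ := h.exists_edge hun (hA2.image B) (hne.image B) hU
  obtain ⟨i, hi, rfl⟩ := Finset.mem_image.1 hu
  obtain ⟨j, hj, rfl⟩ := Finset.mem_image.1 hv
  refine ⟨_, List.mem_map.2 ⟨(i, j), List.mem_append_left _ ?_, rfl⟩, ?_⟩
  · simpa using ⟨hi, by simpa using hj⟩
  · rwa [slotVal_of_ne huv]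

end Cuts

theorem seg_add (f : ℕ → ℕ) (p a b : ℕ) : seg f p (a + b) = seg f p a ++ seg f (p + a) b := by
  induction b with
  | zero => simp [seg]
  | succ b ih => rw [← Nat.add_assoc, seg_succ, ih, seg_succ, List.append_assoc, Nat.add_assoc]

@[simp] theorem length_seg (f : ℕ → ℕ) (p l : ℕ) : (seg f p l).length = l := by simp [seg]

/-- A segment that lists blocks of length `w` consists of these blocks. -/
theorem seg_flatMap {α : Type} {f : ℕ → ℕ} {w : ℕ} {l : List α} {g : α → List ℕ}
    (hg : ∀ a ∈ l, (g a).length = w) : ∀ {p : ℕ}, seg f p (l.flatMap g).length = l.flatMap g →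
      ∀ i (h : i < l.length), seg f (p + i * w) w = g l[i] := by
  induction l with
  | nil => intro p _ i h; simp at h
  | cons a l ih =>
    intro p hp i h
    have ha : (g a).length = w := hg a (by simp)
    rw [List.flatMap_cons, List.length_append, seg_add] at hp
    obtain ⟨h1, h2⟩ := List.append_inj hp (by simp)
    cases i with
    | zero => simpa [ha] using h1
    | succ i =>
      rw [ha] at h2
      have := ih (fun a h => hg a (by simp [h])) h2 i (by simpa using h)
      rw [List.getElem_cons_succ, ← this]
      congr 1
      ring

/-! ### The family of blocks for a list of topics -/

/-- The different sets of users of topics with at least two users. -/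
def distinctSet (L : List (List ℕ)) : Finset (Finset ℕ) :=
  ((L.filter (2 ≤ ·.length)).map List.toFinset).toFinset

theorem mem_distinctSet {L : List (List ℕ)} {S : Finset ℕ} :
    S ∈ distinctSet L ↔ ∃ l ∈ L, 2 ≤ l.length ∧ l.toFinset = S := by
  simp [distinctSet, and_assoc]

theorem distinctSet_append (L : List (List ℕ)) (l : List ℕ) :
    distinctSet (L ++ [l]) =
      if 2 ≤ l.length then insert l.toFinset (distinctSet L) else distinctSet L := by
  ext S
  split_ifs with h
  · rw [Finset.mem_insert, mem_distinctSet, mem_distinctSet]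
    constructor
    · rintro ⟨l', hl', h1, rfl⟩
      rcases List.mem_append.1 hl' with h2 | h2
      · exact .inr ⟨l', h2, h1, rfl⟩
      · rw [List.mem_singleton.1 h2]; exact .inl rfl
    · rintro (rfl | ⟨l', h1, h2, rfl⟩)
      · exact ⟨l, by simp, h, rfl⟩
      · exact ⟨l', by simp [h1], h2, rfl⟩
  · rw [mem_distinctSet, mem_distinctSet]
    constructor
    · rintro ⟨l', hl', h1, rfl⟩
      rcases List.mem_append.1 hl' with h2 | h2
      · exact ⟨l', h2, h1, rfl⟩
      · rw [List.mem_singleton.1 h2] at h1; exact absurd h1 h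
    · rintro ⟨l', h1, h2, rfl⟩
      exact ⟨l', by simp [h1], h2, rfl⟩

/-- The `M` blocks of `f` represent the cuts of the topics in `L`: the sets that hit all blocks are
those that connect all topics. The arrays `d1`, `d2` decode their elements. -/
structure Family (n w M : ℕ) (f d1 d2 : ℕ → ℕ) (L : List (List ℕ)) : Prop where
  complete : ∀ l ∈ L, 2 ≤ l.length → ∀ H : Finset ℕ, 0 ∉ H → Hits f w M H → Crosses H l.toFinset
  sound : ∀ j < M, ∃ l ∈ L, 2 ≤ l.length ∧ ∀ H : Finset ℕ, Crosses H l.toFinset →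
    ∃ e ∈ seg f (j * w) w, e ∈ H
  decodes : ∀ j < M, ∀ e ∈ seg f (j * w) w, e ≠ 0 → Decodes n d1 d2 e

/-- A repeated topic, or one without cuts, needs no blocks. -/
theorem Family.append_old {n w M : ℕ} {f d1 d2 : ℕ → ℕ} {L : List (List ℕ)} {l : List ℕ}
    (h : Family n w M f d1 d2 L) (hl : 2 ≤ l.length → l.toFinset ∈ distinctSet L) :
    Family n w M f d1 d2 (L ++ [l]) := by
  refine ⟨fun l' hl' h2 => ?_, fun j hj => ?_, h.decodes⟩
  · rcases List.mem_append.1 hl' with h3 | h3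
    · exact h.complete l' h3 h2
    · obtain rfl := List.mem_singleton.1 h3
      obtain ⟨l1, h4, h5, h6⟩ := mem_distinctSet.1 (hl h2)
      rw [← h6]
      exact h.complete l1 h4 h5
  · obtain ⟨l', h1, h2⟩ := h.sound j hj
    exact ⟨l', by simp [h1], h2⟩

theorem Family.append_new {n d w M : ℕ} {f f' d1 d2 d1' d2' B : ℕ → ℕ} {L : List (List ℕ)}
    {l : List ℕ} (h : Family n w M f d1 d2 L) (hl : 2 ≤ l.length) (hnd : l.Nodup)
    (hw : d / 2 * ((d + 1) / 2) ≤ w) (hB1 : ∀ i < d, B i ∈ l) (hB2 : ∀ u ∈ l, ∃ i < d, B i = u)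
    (hseg : seg f' (M * w) (slots d w).length = (slots d w).map (slotVal B))
    (hlow : ∀ i < M * w, f' i = f i)
    (hdec : ∀ e, e ≠ 0 → (Decodes n d1 d2 e ∨ e ∈ (slots d w).map (slotVal B)) →
      Decodes n d1' d2' e) :
    Family n w (M + (masks d).length) f' d1' d2' (L ++ [l]) := by
  have hB1' : ∀ i < d, B i ∈ l.toFinset := fun i hi => List.mem_toFinset.2 (hB1 i hi)
  have hB2' : ∀ u ∈ l.toFinset, ∃ i < d, B i = u := fun u hu => hB2 u (List.mem_toFinset.1 hu)
  have hU : 2 ≤ l.toFinset.card := by rwa [List.toFinset_card_of_nodup hnd]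
  have hold : ∀ j < M, seg f' (j * w) w = seg f (j * w) w := by
    intro j hj
    refine seg_congr fun i hi => hlow _ ?_
    have := Nat.mul_le_mul_right w (show j + 1 ≤ M from hj)
    rw [add_mul] at this
    omega
  have hnew : ∀ i (h : i < (masks d).length), seg f' ((M + i) * w) w =
      (maskBlock d w (masks d)[i]).map (slotVal B) := by
    intro i hi
    rw [add_mul]
    have e1 : (slots d w).map (slotVal B) =
        (masks d).flatMap fun A => (maskBlock d w A).map (slotVal B) := by
      rw [slots, List.map_flatMap]
    refine seg_flatMap (g := fun A => (maskBlock d w A).map (slotVal B))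
      (fun A hA => ?_) ?_ i hi
    · rw [List.length_map, length_maskBlock hw hA]
    · rw [← e1, List.length_map, hseg]
  have hcase : ∀ j < M + (masks d).length, j < M ∨ ∃ i, i < (masks d).length ∧ j = M + i :=
    fun j hj => by
      by_cases h1 : j < M
      · exact .inl h1
      · exact .inr ⟨j - M, by omega, by omega⟩
  refine ⟨fun l' hl' h2 H h0 hH => ?_, fun j hj => ?_, fun j hj e he he0 => ?_⟩
  · rcases List.mem_append.1 hl' with h3 | h3
    · refine h.complete l' h3 h2 H h0 fun j hj => ?_
      rw [← hold j hj]
      exact hH j (by omega)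
    · obtain rfl := List.mem_singleton.1 h3
      refine crosses_of_hit (w := w) hB2' h0 hB1' fun A hA => ?_
      obtain ⟨i, hi, rfl⟩ := List.getElem_of_mem hA
      rw [← hnew i hi]
      exact hH (M + i) (by omega)
  · rcases hcase j hj with h1 | ⟨i, hi, rfl⟩
    · obtain ⟨l', h3, h4⟩ := h.sound j h1
      rw [hold j h1]
      exact ⟨l', by simp [h3], h4⟩
    · refine ⟨l, by simp, hl, fun H hH => ?_⟩
      rw [hnew i hi]
      exact hH.hit hB1' hB2' hU (List.getElem_mem hi)
  · rcases hcase j hj with h1 | ⟨i, hi, rfl⟩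
    · rw [hold j h1] at he
      exact hdec e he0 (.inl (h.decodes j h1 e he he0))
    · rw [hnew i hi] at he
      refine hdec e he0 (.inr ?_)
      obtain ⟨q, hq, rfl⟩ := List.mem_map.1 he
      exact List.mem_map.2 ⟨q, List.mem_flatMap.2 ⟨_, List.getElem_mem hi, hq⟩, rfl⟩

/-- The part of the input that describes the topics. -/
def encodeTopics (L : List (List ℕ)) : List ℕ := L.flatMap fun l => l.length :: l

/-- The numbers that `readAll` relies on. -/
structure Tables (n d w K : ℕ) (T : List (List ℕ)) (s : Sta) : Prop where
  vm : s.v .m = T.length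
  vK : s.v .K = K
  PW : ∀ u < n, s.a .PW u = 2 ^ u
  SI : ∀ i (h : i < (slots d w).length), s.a .SI i = (slots d w)[i].1
  SJ : ∀ i (h : i < (slots d w).length), s.a .SJ i = (slots d w)[i].2

theorem Tables.congr {n d w K : ℕ} {T : List (List ℕ)} {s s' : Sta} (h : Tables n d w K T s)
    (h1 : s'.v .m = s.v .m) (h2 : s'.v .K = s.v .K) (h3 : s'.a .PW = s.a .PW)
    (h4 : s'.a .SI = s.a .SI) (h5 : s'.a .SJ = s.a .SJ) : Tables n d w K T s' :=
  ⟨h1.trans h.vm, h2.trans h.vK, by rw [h3]; exact h.PW, by rw [h4]; exact h.SI,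
    by rw [h5]; exact h.SJ⟩

/-- The state when `t` topics have been read. By `prev`, reading goes on only while the number of
different topics is at most `K`. -/
structure ReadInv (n d w K : ℕ) (T : List (List ℕ)) (t : ℕ) (s : Sta) : Prop where
  le : t ≤ T.length
  vt : s.v .t = t
  inp : s.inp = encodeTopics (T.drop t)
  vN : s.v .N = (distinctSet (T.take t)).card
  vM : s.v .M = s.v .N * (masks d).length
  vwp : s.v .wp = s.v .M * w
  seen : ∀ S : Finset ℕ, s.a .SEEN (∑ i ∈ S, 2 ^ i) ≠ 0 ↔ S ∈ distinctSet (T.take t)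
  fam : Family n w (s.v .M) (s.a .CUT) (s.a .D1) (s.a .D2) (T.take t)
  go : s.v .go ≠ 0 ↔ s.v .N ≤ K ∧ t < T.length
  prev : t = 0 ∨ (distinctSet (T.take (t - 1))).card ≤ K

/-- A bound for the time of `topicStep`. -/
def topicTime (d l : ℕ) : ℕ := d * 100 + l * 200 + 400

theorem slots_length {d w : ℕ} (hw : d / 2 * ((d + 1) / 2) ≤ w) :
    (slots d w).length = (masks d).length * w := by
  rw [slots, List.length_flatMap]
  have : (masks d).map (fun A => (maskBlock d w A).length) = (masks d).map fun _ => w :=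
    List.map_congr_left fun A hA => length_maskBlock hw hA
  rw [this]
  simp

theorem topicStep_spec {n d w K t : ℕ} {T : List (List ℕ)} {s : Sta} {Q : Sta → Prop}
    (hd : 1 ≤ d) (hw : d / 2 * ((d + 1) / 2) ≤ w)
    (hT : ∀ l ∈ T, l.Nodup ∧ l.length ≤ d ∧ ∀ u ∈ l, u < n) (hs : Tables n d w K T s)
    (hI : ReadInv n d w K T t s) (hgo : s.v .go ≠ 0)
    (h : ∀ s', Frame (topicStep d (slots d w).length (masks d).length) s s' →
      ReadInv n d w K T (t + 1) s' → s'.tm ≤ s.tm + topicTime d (slots d w).length → Q s') :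
    Tr (topicStep d (slots d w).length (masks d).length) s Q := by
  have : Tr (topicStep d (slots d w).length (masks d).length) s fun s' =>
      ReadInv n d w K T (t + 1) s' ∧ s'.tm ≤ s.tm + topicTime d (slots d w).length := by
    obtain ⟨hNK, ht⟩ := hI.go.1 hgo
    obtain ⟨hnd, hld, hln⟩ := hT T[t] (List.getElem_mem ht)
    have htake := List.take_succ_eq_append_getElem ht
    have hinp : s.inp = T[t].length :: (T[t] ++ encodeTopics (T.drop (t + 1))) := by
      rw [hI.inp, List.drop_eq_getElem_cons ht, encodeTopics, List.flatMap_cons]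
      rfl
    generalize T[t] = l at *
    have hsum : (l.map (2 ^ ·)).sum = ∑ i ∈ l.toFinset, 2 ^ i :=
      (List.sum_toFinset _ hnd).symm
    unfold topicStep
    refine Tr_seq (readTopic_spec hld hinp (fun u hu => hs.PW u (hln u hu))
      fun s1 hF1 i1 l1 m1 b1 t1 => ?_)
    rw [hsum] at m1
    have hs1 : Tables n d w K T s1 := hs.congr (hF1.v _ rfl) (hF1.v _ rfl) (hF1.a _ rfl)
      (hF1.a _ rfl) (hF1.a _ rfl)
    have eN : s1.v .N = s.v .N := hF1.v _ rfl
    have eM : s1.v .M = s.v .M := hF1.v _ rfl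
    have ewp : s1.v .wp = s.v .wp := hF1.v _ rfl
    have et : s1.v .t = t := (hF1.v _ rfl).trans hI.vt
    have eC : s1.a .CUT = s.a .CUT := hF1.a _ rfl
    have e1 : s1.a .D1 = s.a .D1 := hF1.a _ rfl
    have e2 : s1.a .D2 = s.a .D2 := hF1.a _ rfl
    have eS : s1.a .SEEN = s.a .SEEN := hF1.a _ rfl
    have hprev : t + 1 = 0 ∨ (distinctSet (T.take (t + 1 - 1))).card ≤ K :=
      .inr (by rw [Nat.add_sub_cancel, ← hI.vN]; exact hNK)
    have hgo' : ∀ N : ℕ, (if N - K = 0 then T.length - (t + 1) else 0) ≠ 0 ↔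
        N ≤ K ∧ t + 1 < T.length := by
      intro N
      split_ifs <;> omega
    have hcond : (Expr.cond (.get .SEEN (.var .sum)) (.lit 0)
        (.sub (.var .s) (.lit 1)) : Expr Var Arr).eval s1 ≠ 0 ↔
        2 ≤ l.length ∧ l.toFinset ∉ distinctSet (T.take t) := by
      rw [← hI.seen]
      simp only [Expr.eval, m1, eS, l1]
      split_ifs with h1
      · simp only [h1]; omega
      · simp [h1]
    with_reducible refine Tr_seq (Tr_ite (fun h0 => ?_) fun h0 => ?_)
    · obtain ⟨h2, h3⟩ := hcond.1 h0
      obtain ⟨b1, b2⟩ := b1 (List.ne_nil_of_length_pos (by omega))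
      with_reducible refine Tr_seq (Tr_put (Tr_seq (Tr_set (Tr_seq (Tr_set ?_)))))
      refine emit_spec (n := n) (by simpa using hs1.PW) (by simpa using hs1.SI)
        (by simpa using hs1.SJ) ?_ fun s2 hF2 w2 c2 l2 d2 t2 => ?_
      · intro q hq
        obtain ⟨q1, q2⟩ := lt_of_mem_slots hd hq
        simpa using ⟨hln _ (b1 _ q1), hln _ (b1 _ q2)⟩
      simp only [Expr.eval, St.tick_a, St.tick_v, St.setv_v, St.setv_a, St.seta_v, St.seta_a,
        reduceCtorEq, if_false, ewp, eC, e1, e2] at w2 c2 l2 d2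
      have N2 : s2.v .N = s.v .N + 1 := by simpa [Expr.eval, eN] using hF2.v .N rfl
      have M2 : s2.v .M = s.v .M + (masks d).length := by
        simpa [Expr.eval, eM] using hF2.v .M rfl
      have T2 : s2.v .t = t := by simpa [et] using hF2.v .t rfl
      have K2 : s2.v .K = K := by simpa [hs1.vK] using hF2.v .K rfl
      have m2 : s2.v .m = T.length := by simpa [hs1.vm] using hF2.v .m rfl
      have I2 : s2.inp = encodeTopics (T.drop (t + 1)) := by simpa [i1] using hF2.inp rfl
      have S2 : s2.a .SEEN = Function.update (s.a .SEEN) (∑ i ∈ l.toFinset, 2 ^ i) 1 := by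
        simpa [Expr.eval, eS, m1] using hF2.a .SEEN rfl
      have hds : distinctSet (T.take (t + 1)) = insert l.toFinset (distinctSet (T.take t)) := by
        rw [htake, distinctSet_append, if_pos h2]
      with_reducible refine Tr_seq (Tr_set (Tr_set
        ⟨⟨Nat.succ_le_of_lt ht, ?_, ?_, ?_, ?_, ?_, ?_, ?_, ?_, hprev⟩, ?_⟩))
      · simp [Expr.eval, T2]
      · simpa using I2
      · simp [N2, hds, Finset.card_insert_of_notMem h3, hI.vN]
      · simp [N2, M2, hI.vM, add_mul]
      · simp [M2, w2, hI.vwp, add_mul, slots_length hw]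
      · -- Sums of powers of two determine the exponents, so the marks of different topics differ.
        intro S
        rw [hds, Finset.mem_insert, ← hI.seen]
        simp only [St.tick_a, St.setv_a, S2, Function.update_apply]
        have h5 : ∑ i ∈ S, 2 ^ i = ∑ i ∈ l.toFinset, 2 ^ i ↔ S = l.toFinset :=
          (Finset.geomSum_injective (le_refl 2)).eq_iff
        by_cases h6 : S = l.toFinset
        · simp [h6]
        · simp [h5, h6]
      · rw [htake]
        rw [hI.vwp] at c2 l2
        simpa [M2] using hI.fam.append_new h2 hnd hw b1 b2 c2 l2 d2
      · simpa [Expr.eval, K2, m2, T2] using hgo' (s2.v .N)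
      · simp [Expr.cost, topicTime] at t2 ⊢
        omega
    · have h1 : 2 ≤ l.length → l.toFinset ∈ distinctSet (T.take t) := by
        intro h2
        by_contra h3
        exact hcond.2 ⟨h2, h3⟩ h0
      have hds : distinctSet (T.take (t + 1)) = distinctSet (T.take t) := by
        rw [htake, distinctSet_append]
        split_ifs with h2
        · exact Finset.insert_eq_self.2 (h1 h2)
        · rfl
      with_reducible refine Tr_skip (Tr_seq (Tr_set (Tr_set
        ⟨⟨Nat.succ_le_of_lt ht, ?_, ?_, ?_, ?_, ?_, ?_, ?_, ?_, hprev⟩, ?_⟩)))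
      · simp [Expr.eval, et]
      · simpa using i1
      · simp [eN, hds, hI.vN]
      · simp [eM, eN, hI.vM]
      · simp [eM, ewp, hI.vwp]
      · simpa [hds, eS] using hI.seen
      · rw [htake]
        simpa [eM, eC, e1, e2] using hI.fam.append_old h1
      · simpa [Expr.eval, hs1.vK, hs1.vm, et] using hgo' (s1.v .N)
      · simp [Expr.cost, topicTime] at t1 ⊢
        omega
  exact this.frame.mono fun s' ⟨⟨h1, h2⟩, hF⟩ => h s' hF h1 h2

theorem readAll_spec {n d w K : ℕ} {T : List (List ℕ)} {s : Sta} {Q : Sta → Prop}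
    (hd : 1 ≤ d) (hw : d / 2 * ((d + 1) / 2) ≤ w)
    (hT : ∀ l ∈ T, l.Nodup ∧ l.length ≤ d ∧ ∀ u ∈ l, u < n) (hs : Tables n d w K T s)
    (hinp : s.inp = encodeTopics T) (hseen : ∀ i, s.a .SEEN i = 0)
    (h : ∀ s' t, Frame (readAll d (slots d w).length (masks d).length) s s' →
      ReadInv n d w K T t s' → (t = T.length ∨ K < s'.v .N) →
      s'.tm ≤ s.tm + (t * (topicTime d (slots d w).length + 10) + 40) → Q s') :
    Tr (readAll d (slots d w).length (masks d).length) s Q := by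
  have : Tr (readAll d (slots d w).length (masks d).length) s fun s' => ∃ t,
      ReadInv n d w K T t s' ∧ (t = T.length ∨ K < s'.v .N) ∧
      s'.tm ≤ s.tm + (t * (topicTime d (slots d w).length + 10) + 40) := by
    unfold readAll
    with_reducible refine Tr_seq (Tr_set (Tr_seq (Tr_set (Tr_seq (Tr_set (Tr_seq (Tr_set
      (Tr_seq (Tr_set ?_)))))))))
    refine Tr_while (fun s' => ∃ t, ReadInv n d w K T t s' ∧ Tables n d w K T s' ∧
      s'.tm ≤ s.tm + (t * (topicTime d (slots d w).length + 10) + 30))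
      (s.tm + (T.length * (topicTime d (slots d w).length + 10) + 30)) ?_ ?_ ?_ ?_
    · rintro s' ⟨t, hI, -, ht⟩
      have := Nat.mul_le_mul_right (topicTime d (slots d w).length + 10) hI.le
      omega
    · rintro s1 ⟨t, hI, hs1, ht⟩ h0
      refine topicStep_spec hd hw hT (hs1.congr rfl rfl rfl rfl rfl)
        (⟨hI.le, hI.vt, hI.inp, hI.vN, hI.vM, hI.vwp, hI.seen, hI.fam, hI.go, hI.prev⟩) h0
        fun s2 hF2 hI2 ht2 => ⟨t + 1, hI2, ?_, ?_⟩
      · exact hs1.congr (hF2.v _ rfl) (hF2.v _ rfl) (hF2.a _ rfl) (hF2.a _ rfl) (hF2.a _ rfl)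
      · simp [Expr.cost] at ht2
        have : (t + 1) * (topicTime d (slots d w).length + 10) =
          t * (topicTime d (slots d w).length + 10) + topicTime d (slots d w).length + 10 := by ring
        omega
    · rintro s1 ⟨t, hI, hs1, ht⟩ h0
      refine ⟨t, ⟨hI.le, hI.vt, hI.inp, hI.vN, hI.vM, hI.vwp, hI.seen, hI.fam, hI.go, hI.prev⟩,
        ?_, ?_⟩
      · by_contra hc
        push Not at hc
        have := hI.le
        exact hI.go.2 ⟨hc.2, by omega⟩ h0
      · simp [Expr.cost]
        omega
    · refine ⟨0, ⟨Nat.zero_le _, ?_, ?_, ?_, ?_, ?_, ?_, ?_, ?_, .inl rfl⟩,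
        hs.congr rfl rfl rfl rfl rfl, ?_⟩
      · simp [Expr.eval]
      · simpa using hinp
      · simp [Expr.eval, distinctSet]
      · simp [Expr.eval]
      · simp [Expr.eval]
      · simp [hseen, distinctSet]
      · exact ⟨by simp, by simp [Expr.eval], by simp [Expr.eval]⟩
      · simp [Expr.eval, hs.vm, Nat.pos_iff_ne_zero]
      · simp [Expr.cost]
  exact this.frame.mono fun s' ⟨⟨t, h1, h2, h3⟩, hF⟩ => h s' t hF h1 h2 h3

end TCO

/-! ### The whole program -/

namespace TCO

open TCO.TreePath

/-- The program for topics with at most `d` users, with blocks of `w` slots. -/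
noncomputable def mainProg (d w : ℕ) : Com :=
  .seq (.rd .n) <| .seq (.rd .m) <| .seq (.rd .k) <| .seq powers <| .seq (capacity d) <|
  .seq (table .SI ((slots d w).map Prod.fst) 0) <| .seq (table .SJ ((slots d w).map Prod.snd) 0) <|
  .seq (readAll d (slots d w).length (masks d).length) <|
  .ite (.sub (.var .N) (.var .K)) (.pr (.lit 0)) (search w)

/-- A bound for the time of the program, if `t` topics are read. -/
noncomputable def mainTime (d w n k t : ℕ) : ℕ :=
  (n * 100 + 100) + (d * ((2 * k + 1) * 40 + 100) + 100) + 2 * ((slots d w).length * 10 + 1) +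
  (t * (topicTime d (slots d w).length + 10) + 40) +
  ((processTime w ((2 * k + 1) ^ d * (masks d).length) k + 100) * (nodeBound (w - 1) k).2 + 100) +
  100

theorem processTime_mono {w M M' : ℕ} (h : M ≤ M') (k : ℕ) :
    processTime w M k ≤ processTime w M' k := by
  have h1 : selectTime w M ≤ selectTime w M' := by
    simp only [selectTime]
    have := Nat.mul_le_mul_right (scanTime w + 200) h
    omega
  have h2 : domTime w M ≤ domTime w M' := by
    simp only [domTime]
    have := Nat.mul_le_mul_left w (Nat.add_le_add_right h1 200)
    omega
  simp only [processTime, branchTime]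
  omega

/-- The initial state. -/
def initSta (input : List ℕ) : Sta := ⟨fun _ => 0, fun _ _ => 0, input, [], 0⟩

/-- The program reads `t` topics, and either finds too many different ones or searches the family of
their cuts. -/
theorem mainProg_spec {n d w k : ℕ} {T : List (List ℕ)} (hd : 1 ≤ d)
    (hw : d / 2 * ((d + 1) / 2) ≤ w) (hw2 : 2 ≤ w)
    (hT : ∀ l ∈ T, l.Nodup ∧ l.length ≤ d ∧ ∀ u ∈ l, u < n) :
    Tr (mainProg d w) (initSta (n :: T.length :: k :: encodeTopics T)) fun s =>
      (∃ t ≤ T.length, (t = 0 ∨ (distinctSet (T.take (t - 1))).card ≤ (2 * k + 1) ^ d) ∧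
        s.tm ≤ mainTime d w n k t) ∧
      ((s.out = [0] ∧ (2 * k + 1) ^ d < (distinctSet T).card) ∨
        ∃ f d1 d2 M, Family n w M f d1 d2 T ∧
          ((∃ p, NodeOk f w M k p ∧ Hits f w M p.chosen.toFinset ∧ s.out = outWord d1 d2 p) ∨
            (s.out = [0] ∧ ¬ ∃ H : Finset ℕ, 0 ∉ H ∧ Hits f w M H ∧ H.card ≤ k))) := by
  unfold mainProg
  with_reducible refine Tr_seq (Tr_rd (Tr_seq (Tr_rd (Tr_seq (Tr_rd (Tr_seq ?_))))))
  refine powers_spec fun s1 hF1 p1 t1 => Tr_seq (capacity_spec fun s2 hF2 K2 t2 => ?_)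
  simp only [initSta, St.tick_v, St.setinp_v, St.setv_v, St.setinp_inp, St.tick_inp, reduceCtorEq,
    if_false, if_true, List.headD_cons, List.tail_cons, St.tick_tm, St.setinp_tm, St.setv_tm]
    at p1 t1
  have n1 : s1.v .n = n := by simpa [initSta] using hF1.v .n rfl
  have m1 : s1.v .m = T.length := by simpa [initSta] using hF1.v .m rfl
  have k1 : s1.v .k = k := by simpa [initSta] using hF1.v .k rfl
  have i1 : s1.inp = encodeTopics T := by simpa [initSta] using hF1.inp rfl
  have o1 : s1.out = [] := by simpa [initSta] using hF1.out rfl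
  have a1 : ∀ b, b ≠ .PW → ∀ i, s1.a b i = 0 := by
    intro b hb i
    have := hF1.a b (by cases b <;> first | rfl | exact absurd rfl hb)
    simp [this, initSta]
  rw [k1] at K2 t2
  have a2 : s2.a = s1.a := funext fun b => hF2.a b rfl
  refine Tr_seq (table_spec fun s3 v3 i3 o3 b3 _ c3 t3 => ?_)
  refine Tr_seq (table_spec fun s4 v4 i4 o4 b4 _ c4 t4 => ?_)
  have v42 : s4.v = s2.v := v4.trans v3
  have i42 : s4.inp = encodeTopics T := by rw [i4, i3, hF2.inp rfl, i1]
  have o42 : s4.out = [] := by rw [o4, o3, hF2.out rfl, o1]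
  have k4 : s4.v .k = k := by rw [v42, hF2.v _ rfl, k1]
  have a4 : ∀ b, b ≠ .SI → b ≠ .SJ → b ≠ .PW → ∀ i, s4.a b i = 0 := by
    intro b h1 h2 h3 i
    rw [b4 b h2, b3 b h1, a2, a1 b h3]
  have hTab : Tables n d w ((2 * k + 1) ^ d) T s4 := by
    refine ⟨?_, ?_, ?_, ?_, ?_⟩
    · rw [v42, hF2.v _ rfl, m1]
    · rw [v42, K2]
    · rw [b4 _ (by decide), b3 _ (by decide), a2]
      exact p1
    · intro i hi
      rw [b4 _ (by decide)]
      have := c3 i (by simpa using hi)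
      rw [List.getElem_map] at this
      simpa using this
    · intro i hi
      have := c4 i (by simpa using hi)
      rw [List.getElem_map] at this
      simpa using this
  refine Tr_seq (readAll_spec hd hw hT hTab i42 (a4 _ (by decide) (by decide) (by decide))
    fun s5 t hF5 hI hcase t5 => ?_)
  have k5 : s5.v .k = k := (hF5.v _ rfl).trans k4
  have K5 : s5.v .K = (2 * k + 1) ^ d := (hF5.v _ rfl).trans hTab.vK
  have o5 : s5.out = [] := (hF5.out rfl).trans o42
  have z5 : ∀ b, b = .DEP ∨ b = .CH ∨ b = .EX → ∀ i, s5.a b i = 0 := by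
    rintro b (rfl | rfl | rfl) i <;> rw [hF5.a _ rfl, a4 _ (by decide) (by decide) (by decide)]
  simp only [List.length_map] at t3 t4
  have ht5 : s5.tm ≤ (n * 100 + 100) + (d * ((2 * k + 1) * 40 + 100) + 100) +
      2 * ((slots d w).length * 10 + 1) + (t * (topicTime d (slots d w).length + 10) + 40) + 3 := by
    omega
  refine Tr_ite (fun h0 => Tr_pr ⟨⟨t, hI.le, hI.prev, ?_⟩, .inl ⟨?_, ?_⟩⟩) fun h0 =>
    search_spec (f := s5.a .CUT) (M := s5.v .M) (k := k) hw2 (by simp) (by simp) (by simpa using k5)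
      (by simpa using z5 .DEP (.inl rfl) 0) (by simpa using z5 .CH (.inr (.inl rfl)))
      (by simpa using z5 .EX (.inr (.inr rfl))) fun s6 t6 hres =>
        ⟨⟨t, hI.le, hI.prev, ?_⟩, .inr ⟨s5.a .CUT, s5.a .D1, s5.a .D2, s5.v .M, ?_, ?_⟩⟩
  · simp [Expr.cost, mainTime]
    omega
  · simp [o5, Expr.eval]
  · simp only [Expr.eval, K5, hI.vN] at h0
    refine lt_of_lt_of_le (show _ < (distinctSet (T.take t)).card by omega) (Finset.card_le_card ?_)
    intro S hS
    obtain ⟨l, hl, h1, h2⟩ := mem_distinctSet.1 hS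
    exact mem_distinctSet.2 ⟨l, List.mem_of_mem_take hl, h1, h2⟩
  · simp only [Expr.eval, K5] at h0
    have h1 : s5.v .M ≤ (2 * k + 1) ^ d * (masks d).length := by
      rw [hI.vM]
      exact Nat.mul_le_mul_right _ (by omega)
    have h2 := Nat.mul_le_mul_right (nodeBound (w - 1) k).2
      (Nat.add_le_add_right (processTime_mono (w := w) h1 k) 100)
    simp [Expr.cost] at t6
    simp only [mainTime]
    omega
  · simp only [Expr.eval, K5] at h0
    have : t = T.length := by
      rcases hcase with h | h
      · exact h
      · omega
    have hfam := hI.fam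
    rwa [this, List.take_length] at hfam
  · simpa [o5] using hres

/-- Few topics are read: apart from the repeated ones, they are different topics with two users,
or have at most one user. -/
theorem topics_read_le {n K t : ℕ} {T : List (List ℕ)} (hT : ∀ l ∈ T, ∀ u ∈ l, u < n)
    (ht : t ≤ T.length) (hprev : t = 0 ∨ (distinctSet (T.take (t - 1))).card ≤ K) :
    t ≤ (T.length - (T.map List.toFinset).toFinset.card) + K + n + 2 := by
  rcases hprev with rfl | hprev
  · omega
  set T1 := T.take (t - 1) with hT1
  set T2 := T.drop (t - 1) with hT2
  have hlen1 : T1.length = t - 1 := by rw [hT1, List.length_take]; omega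
  have hlen2 : T2.length = T.length - (t - 1) := by rw [hT2, List.length_drop]
  have hT12 : T = T1 ++ T2 := (List.take_append_drop _ _).symm
  have h1 : (T.map List.toFinset).toFinset.card ≤
      (T1.map List.toFinset).toFinset.card + T2.length := by
    rw [hT12, List.map_append, List.toFinset_append]
    refine (Finset.card_union_le _ _).trans (Nat.add_le_add_left ?_ _)
    simpa using List.toFinset_card_le (T2.map List.toFinset)
  have h2 : (T1.map List.toFinset).toFinset ⊆
      distinctSet T1 ∪ insert ∅ ((Finset.range n).image fun u => {u}) := by
    intro S hS
    obtain ⟨l, hl, rfl⟩ := List.mem_map.1 (List.mem_toFinset.1 hS)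
    by_cases h : 2 ≤ l.length
    · exact Finset.mem_union_left _ (mem_distinctSet.2 ⟨l, hl, h, rfl⟩)
    · refine Finset.mem_union_right _ ?_
      match l, h with
      | [], _ => simp
      | [u], _ =>
        have := hT [u] (List.mem_of_mem_take hl) u (by simp)
        simp [this]
      | _ :: _ :: _, h => simp at h
  have h3 : (T1.map List.toFinset).toFinset.card ≤ K + (n + 1) := by
    refine (Finset.card_le_card h2).trans
      ((Finset.card_union_le _ _).trans (Nat.add_le_add hprev ?_))
    refine (Finset.card_insert_le _ _).trans (Nat.add_le_add_right ?_ 1)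
    simpa using Finset.card_image_le (s := Finset.range n) (f := fun u => ({u} : Finset ℕ))
  omega

/-! ### Topic-connected overlays as hitting sets -/

section Overlay

variable (I : TCOInstance)

/-- The element that represents an edge: the sum of the powers of two of its end points. -/
def edgeId {n : ℕ} (e : Sym2 (Fin n)) : ℕ :=
  Sym2.lift ⟨fun u v => 2 ^ u.val + 2 ^ v.val, fun _ _ => add_comm _ _⟩ e

@[simp] theorem edgeId_mk {n : ℕ} (u v : Fin n) : edgeId s(u, v) = 2 ^ u.val + 2 ^ v.val := rfl

theorem edgeId_inj {n : ℕ} {e e' : Sym2 (Fin n)} (h : ¬ e.IsDiag) (h' : ¬ e'.IsDiag)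
    (heq : edgeId e = edgeId e') : e = e' := by
  induction e with | _ a b
  induction e' with | _ c d
  simp only [Sym2.mk_isDiag_iff] at h h'
  have hab : a.val ≠ b.val := fun e => h (Fin.ext e)
  have hcd : c.val ≠ d.val := fun e => h' (Fin.ext e)
  have h1 : ({a.val, b.val} : Finset ℕ) = {c.val, d.val} := by
    apply Finset.geomSum_injective (le_refl 2)
    simpa [Finset.sum_pair hab, Finset.sum_pair hcd] using heq
  have h2 : a.val = c.val ∨ a.val = d.val := by
    have : a.val ∈ ({c.val, d.val} : Finset ℕ) := h1 ▸ Finset.mem_insert_self _ _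
    simpa using this
  have h3 : b.val = c.val ∨ b.val = d.val := by
    have : b.val ∈ ({c.val, d.val} : Finset ℕ) := h1 ▸ by simp
    simpa using this
  rw [Sym2.eq_iff]
  simp only [Fin.ext_iff]
  omega

/-- A topic is connected if and only if every cut of its users is crossed by an edge. -/
theorem topicConnected_iff (E : Finset (Sym2 (Fin I.n))) (t : Fin I.m) :
    I.TopicConnected E t ↔ ∀ A ⊆ I.users t, A.Nonempty → A ≠ I.users t →
      ∃ u ∈ A, ∃ v ∈ I.users t \ A, s(u, v) ∈ E := by
  classical
  constructor
  · intro h A hA ⟨a, ha⟩ hne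
    obtain ⟨b, hb, hbA⟩ : ∃ b ∈ I.users t, b ∉ A := by
      by_contra hc
      push Not at hc
      exact hne (Finset.Subset.antisymm hA hc)
    obtain ⟨p⟩ := h ⟨a, by simpa using hA ha⟩ ⟨b, by simpa using hb⟩
    obtain ⟨d, -, h1, h2⟩ := p.exists_boundary_dart {x | x.1 ∈ A} ha hbA
    have h3 := d.adj
    simp only [SimpleGraph.comap_adj, SimpleGraph.fromEdgeSet_adj, Function.Embedding.subtype_apply]
      at h3
    exact ⟨d.fst.1, h1, d.snd.1, Finset.mem_sdiff.2 ⟨d.snd.2, h2⟩, by simpa using h3.1⟩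
  · intro h x y
    by_contra hxy
    -- Otherwise the vertices that are reachable from `x` form a cut that is not crossed.
    let A := (I.users t).filter fun z => ∃ hz : z ∈ (I.users t : Set (Fin I.n)),
      ((SimpleGraph.fromEdgeSet (E : Set (Sym2 (Fin I.n)))).induce
        (I.users t : Set (Fin I.n))).Reachable x ⟨z, hz⟩
    obtain ⟨u, hu, v, hv, huv⟩ := h A (Finset.filter_subset _ _)
      ⟨x.1, Finset.mem_filter.2 ⟨x.2, x.2, SimpleGraph.Reachable.refl _⟩⟩
      (fun hA => by
        have : y.1 ∈ A := by rw [hA]; exact y.2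
        obtain ⟨-, _, h1⟩ := Finset.mem_filter.1 this
        exact hxy h1)
    obtain ⟨hv1, hv2⟩ := Finset.mem_sdiff.1 hv
    obtain ⟨-, hu1, hu2⟩ := Finset.mem_filter.1 hu
    refine hv2 (Finset.mem_filter.2
      ⟨hv1, by simpa using hv1, hu2.trans (SimpleGraph.Adj.reachable ?_)⟩)
    simp only [SimpleGraph.comap_adj, SimpleGraph.fromEdgeSet_adj, Function.Embedding.subtype_apply]
    exact ⟨by simpa using huv, fun h => hv2 (h ▸ hu)⟩

/-- The users of a topic, as a list of numbers. -/
def topicList (t : Fin I.m) : List ℕ := ((I.users t).sort (· ≤ ·)).map Fin.val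

/-- The topics, as lists of numbers. -/
def topicLists : List (List ℕ) := (List.finRange I.m).map (topicList I)

theorem mem_topicList {t : Fin I.m} {u : ℕ} :
    u ∈ topicList I t ↔ ∃ v ∈ I.users t, v.val = u := by
  simp [topicList]

theorem length_topicList (t : Fin I.m) : (topicList I t).length = (I.users t).card := by
  simp [topicList]

theorem toFinset_topicList (t : Fin I.m) :
    (topicList I t).toFinset = (I.users t).map Fin.valEmbedding := by
  ext u
  simp [mem_topicList]

theorem nodup_topicList (t : Fin I.m) : (topicList I t).Nodup :=
  (Finset.sort_nodup _ _).map Fin.val_injective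

theorem mem_topicLists {l : List ℕ} : l ∈ topicLists I ↔ ∃ t, topicList I t = l := by
  simp [topicLists]

theorem encode_eq (k : ℕ) :
    I.encode k = I.n :: (topicLists I).length :: k :: encodeTopics (topicLists I) := by
  simp [TCOInstance.encode, encodeTopics, topicLists, List.flatMap_map, topicList]

theorem repeatedTopics_eq :
    I.repeatedTopics =
      (topicLists I).length - ((topicLists I).map List.toFinset).toFinset.card := by
  have h1 : ((topicLists I).map List.toFinset).toFinset =
      (Finset.univ.image I.users).image fun U => U.map Fin.valEmbedding := by
    ext S
    simp [topicLists, toFinset_topicList]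
  rw [h1, Finset.card_image_of_injective _ (Finset.map_injective _)]
  simp [TCOInstance.repeatedTopics, topicLists]

variable {I}

theorem crosses_of_topicConnected {E : Finset (Sym2 (Fin I.n))} {t : Fin I.m}
    (h : I.TopicConnected E t) : Crosses (E.image edgeId) (topicList I t).toFinset := by
  rw [toFinset_topicList]
  intro A hA hne hne'
  rw [topicConnected_iff] at h
  obtain ⟨A', hA', rfl⟩ := Finset.subset_map_iff.1 hA
  obtain ⟨u, hu, v, hv, huv⟩ := h A' hA' (by simpa using hne) (fun h => hne' (by rw [h]))
  refine ⟨u.val, Finset.mem_map_of_mem Fin.valEmbedding hu, v.val, ?_,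
    Finset.mem_image.2 ⟨_, huv, rfl⟩⟩
  obtain ⟨hv1, hv2⟩ := Finset.mem_sdiff.1 hv
  refine Finset.mem_sdiff.2 ⟨Finset.mem_map_of_mem Fin.valEmbedding hv1, fun h => hv2 ?_⟩
  obtain ⟨v', hv', h1⟩ := Finset.mem_map.1 h
  rwa [← Fin.ext (show v'.val = v.val from h1)]

theorem zero_notMem_image_edgeId {n : ℕ} (E : Finset (Sym2 (Fin n))) : 0 ∉ E.image edgeId := by
  intro h
  obtain ⟨e, -, h⟩ := Finset.mem_image.1 h
  induction e with | _ a b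
  simp at h

/-- A feasible solution yields a hitting set. -/
theorem hits_of_feasible {E : Finset (Sym2 (Fin I.n))} (hE : I.Feasible E) {w M : ℕ}
    {f d1 d2 : ℕ → ℕ} (hF : Family I.n w M f d1 d2 (topicLists I)) :
    Hits f w M (E.image edgeId) := by
  intro j hj
  obtain ⟨l, hl, -, h⟩ := hF.sound j hj
  obtain ⟨t, rfl⟩ := (mem_topicLists I).1 hl
  exact h _ (crosses_of_topicConnected (hE.2 t))

/-- A solution with `k` edges touches `2 k` users, which bounds the number of topics. -/
theorem card_distinctSet_le {E : Finset (Sym2 (Fin I.n))} (hE : I.Feasible E) {d k : ℕ}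
    (hk : E.card ≤ k) (hd : ∀ t, (I.users t).card ≤ d) :
    (distinctSet (topicLists I)).card ≤ (2 * k + 1) ^ d := by
  classical
  -- Each set of at least two users consists of end points, and is the image of a map `Fin d → V`.
  set V : Finset ℕ := E.biUnion fun e => e.toFinset.image Fin.val with hV
  have hVc : V.card ≤ 2 * k := by
    refine (Finset.card_biUnion_le_card_mul _ _ 2 fun e _ => Finset.card_image_le.trans ?_).trans ?_
    · by_cases h : e.IsDiag
      · rw [Sym2.card_toFinset_of_isDiag e h]; omega
      · rw [Sym2.card_toFinset_of_not_isDiag e h]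
    · omega
  have hsub : distinctSet (topicLists I) ⊆
      (Fintype.piFinset fun _ : Fin d => V).image fun g => Finset.univ.image g := by
    intro S hS
    obtain ⟨l, hl, h2, rfl⟩ := mem_distinctSet.1 hS
    obtain ⟨t, rfl⟩ := (mem_topicLists I).1 hl
    have hne : topicList I t ≠ [] := List.ne_nil_of_length_pos (by omega)
    have hlV : ∀ u ∈ topicList I t, u ∈ V := by
      intro u hu
      obtain ⟨v, hv, rfl⟩ := (mem_topicList I).1 hu
      obtain ⟨u', hu', v', -, huv⟩ := (topicConnected_iff I E t).1 (hE.2 t) {v} (by simpa using hv)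
        ⟨v, by simp⟩ (fun h => by
          rw [length_topicList, ← h] at h2
          simp at h2)
      obtain rfl : u' = v := by simpa using hu'
      exact Finset.mem_biUnion.2 ⟨_, huv, Finset.mem_image.2 ⟨u', by simp, rfl⟩⟩
    have hget : ∀ i, (topicList I t).getD i ((topicList I t).head hne) ∈ topicList I t := by
      intro i
      by_cases hi : i < (topicList I t).length
      · rw [List.getD_eq_getElem _ _ hi]
        exact List.getElem_mem hi
      · rw [List.getD_eq_default _ _ (by omega)]
        exact List.head_mem hne
    refine Finset.mem_image.2 ⟨fun i => (topicList I t).getD i ((topicList I t).head hne),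
      Fintype.mem_piFinset.2 fun i => hlV _ (hget _), ?_⟩
    ext u
    simp only [Finset.mem_image, Finset.mem_univ, true_and, List.mem_toFinset]
    constructor
    · rintro ⟨i, rfl⟩
      exact hget i
    · intro hu
      obtain ⟨i, hi, rfl⟩ := List.getElem_of_mem hu
      have := hd t
      rw [← length_topicList] at this
      exact ⟨⟨i, by omega⟩, List.getD_eq_getElem _ _ hi⟩
  refine (Finset.card_le_card hsub).trans (Finset.card_image_le.trans ?_)
  rw [Fintype.card_piFinset]
  simpa using Nat.pow_le_pow_left (hVc.trans (Nat.le_succ _)) d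

/-- The output of a successful search is a feasible solution. -/
theorem correctAnswer_of_hits {w M k : ℕ} {f d1 d2 : ℕ → ℕ} {p : TreePath}
    (hF : Family I.n w M f d1 d2 (topicLists I)) (hp : NodeOk f w M k p)
    (hh : Hits f w M p.chosen.toFinset) : I.CorrectAnswer k (outWord d1 d2 p) := by
  have hdec : ∀ e ∈ p.chosen, Decodes I.n d1 d2 e := by
    intro e he
    obtain ⟨h0, j, hj, hej⟩ := hp.mem e he
    exact hF.decodes j hj e hej h0
  let g : (e : ℕ) → e ∈ p.chosen → Fin I.n × Fin I.n :=
    fun e he => (⟨d1 e, (hdec e he).1⟩, ⟨d2 e, (hdec e he).2.1⟩)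
  let L := p.chosen.pmap g fun _ h => h
  let E := L.map fun e => s(e.1, e.2)
  have hid : E.map edgeId = p.chosen := by
    simp only [E, L, List.map_pmap]
    conv_rhs => rw [← List.map_id p.chosen, ← List.pmap_eq_map (H := fun _ h => h)]
    exact List.pmap_congr_left _ fun e he _ _ => (hdec e he).2.2.2.symm
  have hdiag : ∀ e ∈ E, ¬ e.IsDiag := by
    intro e he
    obtain ⟨q, hq, rfl⟩ := List.mem_map.1 he
    obtain ⟨a, ha, rfl⟩ := List.mem_pmap.1 hq
    simp only [g, Sym2.mk_isDiag_iff, Fin.mk.injEq]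
    exact (hdec a ha).2.2.1
  have hnd : E.Nodup := List.Nodup.of_map edgeId (hid ▸ hp.nodup)
  have hEc : E.toFinset.card ≤ k := by
    refine (List.toFinset_card_le _).trans ?_
    have : E.length = p.length := by
      rw [← List.length_map (f := edgeId), hid]
      simp [chosen]
    exact this ▸ hp.length
  refine .inl ⟨L, ?_, hnd, ⟨fun e he => hdiag e (List.mem_toFinset.1 he), fun t => ?_⟩, hEc⟩
  · rw [outWord]
    congr 1
    rw [List.flatMap_def, List.flatMap_def]
    congr 1
    simp only [L, List.map_pmap]
    conv_lhs => rw [← List.pmap_eq_map (H := fun _ h => h)]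
  · rw [topicConnected_iff]
    intro A hA hne hne'
    have hcard : 2 ≤ (I.users t).card := by
      have h1 := hne.card_pos
      have h2 := Finset.card_lt_card (Finset.ssubset_iff_subset_ne.2 ⟨hA, hne'⟩)
      omega
    have hcr := hF.complete (topicList I t) ((mem_topicLists I).2 ⟨t, rfl⟩)
      (by rwa [length_topicList]) p.chosen.toFinset
      (fun h => (hp.mem 0 (List.mem_toFinset.1 h)).1 rfl) hh
    rw [toFinset_topicList] at hcr
    obtain ⟨u, hu, v, hv, huv⟩ := hcr (A.map Fin.valEmbedding) (Finset.map_subset_map.2 hA)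
      (by simpa using hne) (fun h => hne' (Finset.map_injective _ h))
    obtain ⟨u, hu', rfl⟩ := Finset.mem_map.1 hu
    obtain ⟨hv1, hv2⟩ := Finset.mem_sdiff.1 hv
    obtain ⟨v, hv', rfl⟩ := Finset.mem_map.1 hv1
    have hvA : v ∉ A := fun h => hv2 (Finset.mem_map_of_mem _ h)
    refine ⟨u, hu', v, Finset.mem_sdiff.2 ⟨hv', hvA⟩, ?_⟩
    have hmem : edgeId s(u, v) ∈ E.map edgeId := hid ▸ List.mem_toFinset.1 huv
    obtain ⟨e, he, heq⟩ := List.mem_map.1 hmem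
    have huv' : ¬ (s(u, v)).IsDiag := by
      rw [Sym2.mk_isDiag_iff]
      rintro rfl
      exact hvA hu'
    rw [← edgeId_inj (hdiag e he) huv' heq]
    exact List.mem_toFinset.2 he

end Overlay

end TCO

/-! ### The time bound -/

namespace TCO

open TCO.TreePath

/-- The time for a node is linear in `K`, as the number of blocks is. -/
theorem processTime_le (w q : ℕ) : ∃ A, ∀ k K, k ≤ K → 1 ≤ K →
    processTime w (K * q) k + 100 ≤ A * K := by
  refine ⟨400 + (q * (200 * w + 300) + 100) + (w * (q * (200 * w + 300) + 300) + 100) +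
    500 * w + 1100, fun k K hk hK => ?_⟩
  simp only [processTime, branchTime, domTime, selectTime, scanTime]
  have := Nat.mul_le_mul_left w hK
  nlinarith

theorem mainTime_le {d : ℕ} (hd : 1 ≤ d) (w : ℕ) : ∃ C, ∀ n k r t,
    t ≤ r + (2 * k + 1) ^ d + n + 2 →
      mainTime d w n k t ≤ C * (n + r + (2 * k + 1) ^ d * (nodeBound (w - 1) k).2) := by
  obtain ⟨A, hA⟩ := processTime_le w (masks d).length
  refine ⟨100 + 140 * d + 20 * (slots d w).length + 3 * (topicTime d (slots d w).length + 10) +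
    A + 600, fun n k r t ht => ?_⟩
  have hK : 2 * k + 1 ≤ (2 * k + 1) ^ d := Nat.le_self_pow (by omega) _
  have hB : 1 ≤ (nodeBound (w - 1) k).2 := by
    cases k <;> simp only [nodeBound] <;> omega
  have hA' := Nat.mul_le_mul_right (nodeBound (w - 1) k).2
    (hA k ((2 * k + 1) ^ d) (by omega) (by omega))
  have hKB := Nat.mul_le_mul_left ((2 * k + 1) ^ d) hB
  simp only [mainTime]
  rw [mul_assoc] at hA'
  generalize (processTime w ((2 * k + 1) ^ d * (masks d).length) k + 100) *
    (nodeBound (w - 1) k).2 = X at *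
  generalize (2 * k + 1) ^ d * (nodeBound (w - 1) k).2 = Y at *
  generalize topicTime d (slots d w).length + 10 = τ
  generalize (slots d w).length = l
  have h1 : t * τ ≤ (3 * τ) * (n + r + Y) := by
    have : t ≤ 3 * (n + r + Y) := by omega
    calc t * τ ≤ 3 * (n + r + Y) * τ := Nat.mul_le_mul_right _ this
      _ = _ := by ring
  have h2 : d * ((2 * k + 1) * 40 + 100) ≤ (140 * d) * (n + r + Y) := by
    have : (2 * k + 1) * 40 + 100 ≤ 140 * (n + r + Y) := by omega
    calc _ ≤ d * (140 * (n + r + Y)) := Nat.mul_le_mul_left _ this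
      _ = _ := by ring
  have h3 : 2 * (l * 10 + 1) ≤ (20 * l) * (n + r + Y) + 2 := by
    have := Nat.le_mul_of_pos_right (20 * l) (show 0 < n + r + Y by omega)
    omega
  have h4 : A * Y ≤ A * (n + r + Y) := Nat.mul_le_mul_left _ (by omega)
  have h5 : n * 100 + 600 ≤ 700 * (n + r + Y) := by omega
  have h6 : (100 + 140 * d + 20 * l + 3 * τ + A + 600) * (n + r + Y) =
    700 * (n + r + Y) + (140 * d) * (n + r + Y) + (20 * l) * (n + r + Y) + (3 * τ) * (n + r + Y) +
      A * (n + r + Y) := by ring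
  rw [h6]
  omega

/-- A polynomial factor is absorbed by a larger base. -/
theorem pow_mul_pow_le {x c : ℝ} (hx : 0 ≤ x) (hxc : x < c) (d : ℕ) :
    ∃ C : ℝ, 0 ≤ C ∧ ∀ k : ℕ, (2 * k + 1 : ℝ) ^ d * x ^ k ≤ C * c ^ k := by
  have hc : 0 < c := hx.trans_lt hxc
  have hr0 : 0 ≤ x / c := div_nonneg hx hc.le
  have hr1 : x / c < 1 := (div_lt_one hc).2 hxc
  obtain ⟨S, hS⟩ := (tendsto_pow_const_mul_const_pow_of_abs_lt_one d
    (by rwa [abs_of_nonneg hr0])).bddAbove_range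
  have hS' : ∀ k : ℕ, (k : ℝ) ^ d * (x / c) ^ k ≤ S := fun k => hS ⟨k, rfl⟩
  have hS0 : 0 ≤ S := le_trans (by positivity) (hS' 0)
  refine ⟨3 ^ d * S + 1, by positivity, fun k => ?_⟩
  have h1 : (2 * k + 1 : ℝ) ^ d ≤ 3 ^ d * (k : ℝ) ^ d + 1 := by
    rcases Nat.eq_zero_or_pos k with rfl | hk
    · simp
    · rw [← mul_pow]
      have : (1 : ℝ) ≤ k := by exact_mod_cast hk
      have h : (2 * k + 1 : ℝ) ≤ 3 * k := by linarith
      exact (pow_le_pow_left₀ (by positivity) h d).trans (by linarith)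
  have h2 : x ^ k = (x / c) ^ k * c ^ k := by
    rw [← mul_pow, div_mul_cancel₀ _ hc.ne']
  have h3 : (x / c) ^ k ≤ 1 := pow_le_one₀ hr0 hr1.le
  rw [h2, ← mul_assoc]
  refine mul_le_mul_of_nonneg_right ?_ (by positivity)
  calc (2 * k + 1 : ℝ) ^ d * (x / c) ^ k ≤ (3 ^ d * (k : ℝ) ^ d + 1) * (x / c) ^ k :=
        mul_le_mul_of_nonneg_right h1 (by positivity)
    _ = 3 ^ d * ((k : ℝ) ^ d * (x / c) ^ k) + (x / c) ^ k := by ring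
    _ ≤ _ := add_le_add (mul_le_mul_of_nonneg_left (hS' k) (by positivity)) h3

/-- The number of slots of a block: the number of edges that cross a cut of `d` users, but at
least `3`. -/
def blockWidth (d : ℕ) : ℕ := max (d / 2 * ((d + 1) / 2)) 3

/-- The base `W + 3 / W` of the exponential running time, for blocks with `W + 1` slots. It is
larger than the growth rate `W + 2 / W` of the search tree, to absorb the polynomial factor. -/
noncomputable def base (d : ℕ) : ℝ :=
  ((blockWidth d - 1 : ℕ) : ℝ) + 3 / ((blockWidth d - 1 : ℕ) : ℝ)

theorem two_le_blockWidth (d : ℕ) : 2 ≤ blockWidth d - 1 := by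
  have : 3 ≤ blockWidth d := le_max_right _ _
  omega

theorem one_le_base (d : ℕ) : 1 ≤ base d := by
  have h : (2 : ℝ) ≤ ((blockWidth d - 1 : ℕ) : ℝ) := by exact_mod_cast two_le_blockWidth d
  have : 0 ≤ 3 / ((blockWidth d - 1 : ℕ) : ℝ) := by positivity
  unfold base
  linarith

theorem mainTime_le_base {d : ℕ} (hd : 1 ≤ d) : ∃ C : ℝ, ∀ n k r t : ℕ,
    t ≤ r + (2 * k + 1) ^ d + n + 2 →
      (mainTime d (blockWidth d) n k t : ℝ) ≤ C * (base d ^ k + (n : ℝ) ^ 2 + r) := by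
  obtain ⟨C1, h1⟩ := mainTime_le hd (blockWidth d)
  set W := blockWidth d - 1 with hWdef
  have hW : 2 ≤ W := two_le_blockWidth d
  have hW' : (0 : ℝ) < W := by exact_mod_cast (show 0 < W by omega)
  obtain ⟨C2, hC2, h2⟩ := pow_mul_pow_le (x := W + 2 / W) (c := base d) (by positivity)
    (by
      unfold base
      rw [← hWdef]
      have := div_lt_div_of_pos_right (show (2 : ℝ) < 3 by norm_num) hW'
      linarith) d
  refine ⟨C1 * (1 + (W + 3) * C2), fun n k r t ht => ?_⟩
  have h3 : (mainTime d (blockWidth d) n k t : ℝ) ≤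
      C1 * (n + r + (2 * k + 1) ^ d * ((nodeBound W k).2 : ℝ)) := by
    exact_mod_cast h1 n k r t ht
  have h4 : ((2 * k + 1) ^ d * ((nodeBound W k).2 : ℝ)) ≤ (W + 3) * C2 * base d ^ k := by
    calc _ ≤ (2 * k + 1 : ℝ) ^ d * ((W + 3) * (W + 2 / W : ℝ) ^ k) :=
          mul_le_mul_of_nonneg_left (nodeBound_le_pow hW k) (by positivity)
      _ = (W + 3) * ((2 * k + 1 : ℝ) ^ d * (W + 2 / W : ℝ) ^ k) := by ring
      _ ≤ (W + 3) * (C2 * base d ^ k) := mul_le_mul_of_nonneg_left (h2 k) (by positivity)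
      _ = _ := by ring
  have h5 : (n : ℝ) ≤ (n : ℝ) ^ 2 := by exact_mod_cast Nat.le_self_pow (by omega) n
  have h6 : 0 ≤ base d ^ k := pow_nonneg (zero_le_one.trans (one_le_base d)) k
  refine h3.trans ?_
  rw [mul_assoc]
  refine mul_le_mul_of_nonneg_left ?_ (by positivity)
  have h7 : 0 ≤ (W + 3) * C2 * ((n : ℝ) ^ 2 + r) := by positivity
  nlinarith

/-- The base differs from `W` by `3 / W`, and `W = ⌊d/2⌋ * ⌈d/2⌉ - 1 ≥ d ^ 2 / 8` for `d ≥ 4`; the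
constant `48` also covers `d ≤ 3`, where the blocks have more slots than needed. -/
theorem base_asymptotics : ∃ A : ℝ, ∀ d : ℕ, 1 ≤ d →
    |base d - ((⌊(d : ℝ) / 2⌋₊ : ℝ) * (⌈(d : ℝ) / 2⌉₊ : ℝ) - 1)| ≤ A / (d : ℝ) ^ 2 := by
  refine ⟨48, fun d hd => ?_⟩
  have hfloor : ⌊(d : ℝ) / 2⌋₊ = d / 2 := by
    exact_mod_cast Nat.floor_div_eq_div (K := ℝ) d 2
  have hceil : ⌈(d : ℝ) / 2⌉₊ = (d + 1) / 2 := by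
    rw [Nat.ceil_eq_iff (by omega)]
    have h1 : d ≤ 2 * ((d + 1) / 2) := by omega
    have h2 : 2 * ((d + 1) / 2 - 1) < d := by omega
    have h1' : (d : ℝ) ≤ 2 * ((d + 1) / 2 : ℕ) := by exact_mod_cast h1
    have h2' : 2 * (((d + 1) / 2 - 1 : ℕ) : ℝ) < d := by exact_mod_cast h2
    constructor <;> linarith
  rw [hfloor, hceil]
  by_cases h4 : d < 4
  · have : blockWidth d = 3 := by interval_cases d <;> rfl
    unfold base
    rw [this]
    interval_cases d <;> norm_num [abs_le]
  · have hP : d * d ≤ 8 * (d / 2 * ((d + 1) / 2) - 1) := by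
      obtain ⟨e, rfl | rfl⟩ := Nat.even_or_odd' d
      · have h1 : 2 * e / 2 = e := by omega
        have h2 : (2 * e + 1) / 2 = e := by omega
        rw [h1, h2]
        have : 2 * e ≤ e * e := Nat.mul_le_mul_right _ (by omega)
        have h3 : 2 * e * (2 * e) = 4 * (e * e) := by ring
        omega
      · have h1 : (2 * e + 1) / 2 = e := by omega
        have h2 : (2 * e + 1 + 1) / 2 = e + 1 := by omega
        rw [h1, h2]
        have : 2 * e ≤ e * e := Nat.mul_le_mul_right _ (by omega)
        have h3 : (2 * e + 1) * (2 * e + 1) = 4 * (e * e) + 4 * e + 1 := by ring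
        have h4 : e * (e + 1) = e * e + e := by ring
        omega
    have h16 : 16 ≤ d * d := Nat.mul_le_mul (show 4 ≤ d by omega) (show 4 ≤ d by omega)
    have hw : blockWidth d = d / 2 * ((d + 1) / 2) := max_eq_left (by omega)
    unfold base
    rw [hw]
    set P := d / 2 * ((d + 1) / 2) with hPdef
    have hP1 : 1 ≤ P := by omega
    have hP' : (d : ℝ) ^ 2 ≤ 8 * ((P - 1 : ℕ) : ℝ) := by
      rw [sq]
      exact_mod_cast hP
    have hd' : (0 : ℝ) < (d : ℝ) ^ 2 := by positivity
    have hP0 : (0 : ℝ) < ((P - 1 : ℕ) : ℝ) := by linarith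
    rw [← Nat.cast_mul, ← hPdef]
    rw [Nat.cast_sub hP1, Nat.cast_one] at hP' hP0 ⊢
    rw [add_sub_cancel_left, abs_of_nonneg (by positivity), div_le_div_iff₀ hP0 hd']
    linarith

/-! ### The algorithm -/

theorem ctorIdx_var_injective : Function.Injective Var.ctorIdx := by
  intro v v' h
  cases v <;> cases v' <;> first | rfl | exact absurd h (by decide)

theorem ctorIdx_arr_injective : Function.Injective Arr.ctorIdx := by
  intro v v' h
  cases v <;> cases v' <;> first | rfl | exact absurd h (by decide)

/-- What the program does on an instance, on the level of the programming language. -/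
theorem mainProg_correct {d : ℕ} (hd : 1 ≤ d) (I : TCOInstance) (k : ℕ)
    (hI : ∀ t, (I.users t).card ≤ d) :
    Tr (mainProg d (blockWidth d)) (initSta (I.encode k)) fun s =>
      I.CorrectAnswer k s.out ∧
        ∃ t ≤ I.repeatedTopics + (2 * k + 1) ^ d + I.n + 2,
          s.tm ≤ mainTime d (blockWidth d) I.n k t := by
  have hT : ∀ l ∈ topicLists I, l.Nodup ∧ l.length ≤ d ∧ ∀ u ∈ l, u < I.n := by
    intro l hl
    obtain ⟨t, rfl⟩ := (mem_topicLists I).1 hl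
    refine ⟨nodup_topicList I t, (length_topicList I t).trans_le (hI t), fun u hu => ?_⟩
    obtain ⟨v, -, rfl⟩ := (mem_topicList I).1 hu
    exact v.isLt
  rw [encode_eq]
  refine (mainProg_spec hd (le_max_left _ _) (le_trans (by norm_num) (le_max_right _ _)) hT).mono ?_
  rintro s ⟨⟨t, ht, hprev, htm⟩, hout⟩
  refine ⟨?_, t, ?_, htm⟩
  · rcases hout with ⟨ho, hmany⟩ | ⟨f, d1, d2, M, hF, ⟨p, hp, hh, ho⟩ | ⟨ho, hno⟩⟩
    · refine .inr ⟨ho, ?_⟩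
      rintro ⟨E, hE, hk⟩
      exact absurd (card_distinctSet_le hE hk hI) (by omega)
    · rw [ho]
      exact correctAnswer_of_hits hF hp hh
    · refine .inr ⟨ho, ?_⟩
      rintro ⟨E, hE, hk⟩
      exact hno ⟨E.image edgeId, zero_notMem_image_edgeId E, hits_of_feasible hE hF,
        Finset.card_image_le.trans hk⟩
  · rw [repeatedTopics_eq]
    exact topics_read_le (fun l hl => (hT l hl).2.2) ht hprev

end TCO

theorem mainTheorem10 :
    ∃ c : ℕ → ℝ,
      (∃ A : ℝ, ∀ d : ℕ, 1 ≤ d →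
        |c d - ((⌊(d : ℝ) / 2⌋₊ : ℝ) * (⌈(d : ℝ) / 2⌉₊ : ℝ) - 1)| ≤ A / (d : ℝ) ^ 2) ∧
      ∀ d : ℕ, 1 ≤ d →
        ∃ (P : RAMProg) (C : ℝ),
          ∀ (I : TCOInstance) (k : ℕ), (∀ t, (I.users t).card ≤ d) →
            ∃ (time : ℕ) (out : List ℕ),
              P.HaltsWith (I.encode k) time out ∧
              I.CorrectAnswer k out ∧
              (time : ℝ) ≤ C * (c d ^ k + (I.n : ℝ) ^ 2 + (I.repeatedTopics : ℝ)) := by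
  refine ⟨TCO.base, TCO.base_asymptotics, fun d hd => ?_⟩
  obtain ⟨C, hC⟩ := TCO.mainTime_le_base hd
  refine ⟨(TCO.mainProg d (TCO.blockWidth d)).compile TCO.Var.ctorIdx TCO.Arr.ctorIdx, C,
    fun I k hI => ?_⟩
  obtain ⟨s, hs, hans, t, ht, htm⟩ := TCO.mainProg_correct hd I k hI
  obtain ⟨time, r, hr, hrep, htime⟩ := TCO.Cmd.compile_correct TCO.ctorIdx_var_injective
    TCO.ctorIdx_arr_injective (fun a => by cases a <;> decide) hs (RAMState.init (I.encode k))
    ⟨fun _ => rfl, fun _ _ => rfl, rfl, rfl⟩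
  refine ⟨time, s.out, ⟨r, hr, hrep.out⟩, hans, le_trans ?_ (hC I.n k I.repeatedTopics t ht)⟩
  exact_mod_cast (show time ≤ _ by omega)
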